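/- Let $S$ be a locally compact Abelian (Hausdorff, second countable) group with Haar measure $\rho$, and let $W=(W_t)_{t\ge 0}$ be an $S$-valued process with stationary independent increments and càdlàg paths such that for each $s>0$ the law of $W_s-W_0$ has a strictly positive symmetric density with respect to $\rho$. Put $T_s\varphi(x)=E\,\varphi(x+W_s-W_0)$, $G_t\varphi=\int_0^t T_s\varphi\,ds$, $G\varphi=\int_0^\infty T_s\varphi\,ds$ and $(\varphi,\psi)_\rho=\int_S\varphi\psi\,d\rho$. Let $\mathcal C_c(S)$ be the space of continuous real functions on $S$ with compact support and $\mathcal C_c^+(S)$ the set of its non-negative elements. The motion $W$ is called transient if $\sup_x G\varphi(x)<\infty$ for all $\varphi\in\mathcal C_c^+(S)$, and recurrent if $G\varphi\equiv\infty$ for all $\varphi\in\mathcal C_c^+(S)$, $\varphi\ne0$. Let $X_t=\sum_i\delta_{Z^i_t}$ be the empirical measure at time $t$ of the system of particles that starts off from a Poisson system of points with intensity $\rho$ and in which the particles move independently of each other and of the initial configuration, each according to the motion $W$ (there is no branching). Let $Y_t=\int_0^t(X_s-\rho)\,ds$, i.e. $\langle Y_t,\varphi\rangle=\int_0^t\left(\langle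 X_s,\varphi\rangle-\langle\rho,\varphi\rangle\right)ds$. Convergence to a Gaussian field with covariance functional $\Gamma$ means that a centred Gaussian field indexed by $\mathcal C_c^+(S)$ with covariance functional $\Gamma$ exists and that, as $t\to\infty$, the finite-dimensional distributions of the random fields, considered over $\mathcal C_c^+(S)$, converge weakly to those of this Gaussian field. (a) If $W$ is transient, then $t^{-1/2}Y_t$ converges to a Gaussian field with covariance functional $2(\varphi,G\psi)_\rho$. (b) Suppose that $S$ is not compact, that $W$ is recurrent, and that $G_t\sim f_tH$, which means that $H$ is a symmetric non-negative definite bilinear form on $\mathcal C_c(S)$ and $f_t^{-1}(\varphi,G_t\psi)_\rho\to H(\varphi,\psi)$ as $t\to\infty$ for all $\varphi,\psi\in\mathcal C_c^+(S)$, where $f$ is a growth function: for some $T>0$, $f:[T,\infty)\to[0,\infty)$ is increasing (not necessarily strictly) with $f_t\to\infty$. Extend $f$ to $[0,T)$ by any integrable function (for example by $0$). Then $\left(\int_0^t f_s\,ds\right)^{-1/2}Y_t$ converges to a Gaussian field with covariance functional $2H(\varphi,\psi)$. -/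

import Mathlib

open MeasureTheory ProbabilityTheory Filter Topology Set
open scoped NNReal ENNReal CompactlySupported

noncomputable section

/-- The test functions: non-negative continuous functions with compact support on `S`. -/
abbrev TestFn (S : Type*) [TopologicalSpace S] : Type _ := {φ : C_c(S, ℝ) // 0 ≤ φ}

/-- A path is càdlàg: right-continuous with left limits. -/
def IsCadlagPath {S : Type*} [TopologicalSpace S] (w : ℝ≥0 → S) : Prop :=
  ∀ t, ContinuousWithinAt w (Ici t) t ∧ ∃ l, Tendsto w (𝓝[<] t) (𝓝 l)

/-- The individual particle motion: a process with stationary independent increments and càdlàg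
paths such that, for each `s > 0`, the law of `W s - W 0` has a strictly positive symmetric density
with respect to `ρ`. -/
structure IsParticleMotion {S Ω : Type*} [AddCommGroup S] [TopologicalSpace S]
    [MeasurableSpace S] [MeasurableSpace Ω] (ρ : Measure S) (P : Measure Ω)
    (W : ℝ≥0 → Ω → S) : Prop where
  measurable : ∀ t, Measurable (W t)
  cadlag : ∀ᵐ ω ∂P, IsCadlagPath (fun t => W t ω)
  indep_increments : HasIndepIncrements W P
  stationary_increments : ∀ s t : ℝ≥0,
    IdentDistrib (fun ω => W (s + t) ω - W s ω) (fun ω => W t ω - W 0 ω) P P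
  density : ∀ s : ℝ≥0, 0 < s → ∃ p : S → ℝ, Measurable p ∧ (∀ x, 0 < p x) ∧ (∀ x, p (-x) = p x) ∧
    P.map (fun ω => W s ω - W 0 ω) = ρ.withDensity (fun x => ENNReal.ofReal (p x))

section Semigroup

variable {S Ω : Type*} [AddCommGroup S] [TopologicalSpace S] [MeasurableSpace Ω]

/-- The semigroup `(T_s φ)(x) = E[φ(x + W_s - W_0)]` of the motion. -/
def semigroup (P : Measure Ω) (W : ℝ≥0 → Ω → S) (s : ℝ≥0) (φ : S → ℝ) (x : S) : ℝ :=
  ∫ ω, φ (x + (W s ω - W 0 ω)) ∂P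

/-- The Green potential `(G φ)(x) = ∫_0^∞ (T_s φ)(x) ds ∈ [0, ∞]` of a non-negative test
function. -/
def green (P : Measure Ω) (W : ℝ≥0 → Ω → S) (φ : TestFn S) (x : S) : ℝ≥0∞ :=
  ∫⁻ s in Ioi (0 : ℝ), ENNReal.ofReal (semigroup P W s.toNNReal φ.1 x)

/-- The truncated Green potential `(G_t φ)(x) = ∫_0^t (T_s φ)(x) ds`. -/
def greenUpTo (P : Measure Ω) (W : ℝ≥0 → Ω → S) (t : ℝ) (φ : S → ℝ) (x : S) : ℝ :=
  ∫ s in (0 : ℝ)..t, semigroup P W s.toNNReal φ x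

/-- Transience: `‖G φ‖ < ∞` (supremum norm) for all test functions. -/
def IsTransientMotion (P : Measure Ω) (W : ℝ≥0 → Ω → S) : Prop :=
  ∀ φ : TestFn S, (⨆ x, green P W φ x) < ∞

/-- Recurrence: `G φ ≡ ∞` for all non-zero test functions. -/
def IsRecurrentMotion (P : Measure Ω) (W : ℝ≥0 → Ω → S) : Prop :=
  ∀ φ : TestFn S, φ.1 ≠ 0 → ∀ x, green P W φ x = ∞

/-- `G_t ∼ f_t H`: `H` is a (symmetric, non-negative definite) bilinear form on `C_c(S)` and
`f_t⁻¹ (φ, G_t ψ)_ρ → H(φ, ψ)` as `t → ∞` for all non-negative test functions. -/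
structure GreenGrowsLike [MeasurableSpace S] (ρ : Measure S) (P : Measure Ω) (W : ℝ≥0 → Ω → S)
    (f : ℝ → ℝ) (H : LinearMap.BilinForm ℝ C_c(S, ℝ)) : Prop where
  posSemidef : H.IsPosSemidef
  tendsto : ∀ φ ψ : TestFn S,
    Tendsto (fun t : ℝ => (f t)⁻¹ * ∫ x, φ.1 x * greenUpTo P W t ψ.1 x ∂ρ) atTop (𝓝 (H φ.1 ψ.1))

end Semigroup

/-- A growth function on `[T, ∞)`: non-negative, increasing, tending to infinity. Its values on
`[0, T)` are arbitrary, subject to `∫_0^T f_s ds` being defined. -/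
structure IsGrowthFunction (T : ℝ) (f : ℝ → ℝ) : Prop where
  pos : 0 < T
  nonneg : ∀ t, T ≤ t → 0 ≤ f t
  mono : MonotoneOn f (Ici T)
  tendsto : Tendsto f atTop atTop
  integrable : IntervalIntegrable f volume 0 T

/-- `N` is a Poisson random measure (Poisson system of points) with intensity `μ`. -/
structure IsPoissonSystem {S Ω : Type*} [MeasurableSpace S] [MeasurableSpace Ω]
    (P : Measure Ω) (N : Ω → Measure S) (μ : Measure S) : Prop where
  law : ∀ B, MeasurableSet B → μ B < ∞ →
    HasLaw (fun ω => N ω B) ((poissonMeasure (μ B).toNNReal).map (Nat.cast : ℕ → ℝ≥0∞)) P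
  indep : ∀ (n : ℕ) (B : Fin n → Set S), (∀ i, MeasurableSet (B i)) → (∀ i, μ (B i) < ∞) →
    Pairwise (fun i j => Disjoint (B i) (B j)) → iIndepFun (fun i ω => N ω (B i)) P

/-- The empirical measure `X_t = ∑_{i < κ} δ_{Z^i_t}` of the particles present at time `t`; the
number `κ ∈ {0, 1, …, ∞}` of particles is random. -/
def empiricalMeasure {S Ω : Type*} [MeasurableSpace S] (κ : Ω → ℕ∞) (Z : ℕ → ℝ≥0 → Ω → S)
    (t : ℝ≥0) (ω : Ω) : Measure S :=
  Measure.sum (fun i : ℕ => if (i : ℕ∞) < κ ω then Measure.dirac (Z i t ω) else 0)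

/-- The `0`-level system: it starts off from a Poisson system with intensity `ρ`, and the particles
`Z^i`, `i < κ`, move independently of each other and of the initial configuration, each one
according to the motion `W`. -/
structure IsZeroLevelSystem {S Ω₀ Ω : Type*} [AddCommGroup S] [TopologicalSpace S]
    [MeasurableSpace S] [MeasurableSpace Ω₀] [MeasurableSpace Ω] (ρ : Measure S)
    (P₀ : Measure Ω₀) (W : ℝ≥0 → Ω₀ → S) (P : Measure Ω) (κ : Ω → ℕ∞)
    (Z : ℕ → ℝ≥0 → Ω → S) : Prop where
  measurable_number : Measurable κ
  measurable_position : ∀ i t, Measurable (Z i t)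
  cadlag : ∀ i, ∀ᵐ ω ∂P, IsCadlagPath (fun t => Z i t ω)
  initial_poisson : IsPoissonSystem P (empiricalMeasure κ Z 0) ρ
  motion_law : ∀ i,
    IdentDistrib (fun ω t => Z i t ω - Z i 0 ω) (fun ω t => W t ω - W 0 ω) P P₀
  motions_indep : iIndepFun (fun i ω t => Z i t ω - Z i 0 ω) P
  initial_indep_motions :
    IndepFun (fun ω => (κ ω, fun i => Z i 0 ω)) (fun ω i t => Z i t ω - Z i 0 ω) P

/-- The occupation time fluctuation `Y_t = ∫_0^t (X_s - ρ) ds`, tested against `φ`: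
`⟨Y_t, φ⟩ = ∫_0^t (⟨X_s, φ⟩ - ⟨ρ, φ⟩) ds`. -/
def occupationFluctuation {S Ω : Type*} [MeasurableSpace S] (ρ : Measure S)
    (X : ℝ≥0 → Ω → Measure S) (t : ℝ) (φ : S → ℝ) (ω : Ω) : ℝ :=
  ∫ s in (0 : ℝ)..t, ((∫ x, φ x ∂(X s.toNNReal ω)) - ∫ x, φ x ∂ρ)

/-- Convergence in distribution, as `t → ∞`, of random fields over the non-negative test functions
to a centred Gaussian field with covariance functional `Γ`: there is such a field (realised as the
coordinate field under a probability measure `ν`), and all finite-dimensional distributions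
converge to those of that field. -/
def ConvergesToGaussianField {S Ω : Type*} [TopologicalSpace S] [MeasurableSpace Ω]
    (P : Measure Ω) [IsProbabilityMeasure P] (Y : ℝ → TestFn S → Ω → ℝ)
    (Γ : TestFn S → TestFn S → ℝ) : Prop :=
  ∃ (ν : Measure (TestFn S → ℝ)) (_ : IsProbabilityMeasure ν),
    IsGaussianProcess (fun (φ : TestFn S) (z : TestFn S → ℝ) => z φ) ν ∧
    (∀ φ, ∫ z, z φ ∂ν = 0) ∧
    (∀ φ ψ, covariance (fun z => z φ) (fun z => z ψ) ν = Γ φ ψ) ∧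
    ∀ I : Finset (TestFn S),
      TendstoInDistribution (fun (t : ℝ) (ω : Ω) (φ : I) => Y t φ ω) atTop
        (fun (z : TestFn S → ℝ) (φ : I) => z φ) (fun _ => P) ν

end

/-!
The occupation time `∫_0^t ⟨X_s, φ⟩ ds` is a sum over the particles of the functional
`F_φ(x, w) = ∫_0^t φ(x + w_s) ds` of the starting point `x` and the displacement path `w`. Starting
points and paths form a Poisson system with intensity `m = ρ ⊗ (law of the path)`, so the centred sum
`⟨Y_t, φ⟩` has the explicit characteristic function
`E exp(i a⁻¹ᐟ² ⟨Y_t, φ⟩) = exp ∫ (e^{iV} - 1 - iV) dm`, with `V = a⁻¹ᐟ² F_φ`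
(`IsZeroLevelSystem.integral_cexp_occupationFluctuation`). By a third order Taylor expansion the
exponent tends to `-σ²/2` as soon as `∫ V² dm → σ²` and `∫ |V|³ dm → 0`
(`tendsto_integral_cexp_sub_one_sub`); applied to linear combinations of test functions this gives the
convergence of finite-dimensional distributions. The limiting field exists because its covariance is
a limit of the positive semidefinite kernels `a⁻¹ ∫ F_φ F_ψ dm` (`exists_gaussianField`).

*Second moments.* By stationarity under Haar measure and symmetry of the semigroup,
`∫ F_φ F_ψ dm = 2 ∫_0^t (φ, G_r ψ)_ρ dr` (`IsParticleMotion.lintegral_occupation_mul`). If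
`(φ, G_r ψ)_ρ / f_r` converges, then so does the quotient of the integrals
(`tendsto_intervalIntegral_div`). The transient case is `f = 1`, where `(φ, G_r ψ)_ρ` increases to
`(φ, G ψ)_ρ`.

*Third moments.* Integrating out the largest of three times by the Markov property yields
`∫ F_ψ³ dm ≤ 4 N_t ∫ F_ψ² dm` with `N_t = sup_y G_t ψ(y)`
(`IsParticleMotion.lintegral_occupation_cube_le`), so that `N_t² = o(a_t)` suffices. In the transient
case `N_t` is bounded. Otherwise `ψ` is dominated by a multiple of the autocorrelation `A` of a test
function `χ`; by symmetry `T_s A` is maximal at the origin, where it equals `(χ, T_s χ)_ρ`, hence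
`N_t ≤ C c_t` with `c_t = ∫_0^t (χ, T_s χ)_ρ ds`. The integrand is non-increasing, and it tends to `0`
because `S` has infinite Haar measure (`IsParticleMotion.tendsto_energy_atTop`). Therefore
`t c_t ≤ 4 ∫_0^t c_r dr = O(a_t)` and `c_t / t → 0`, so `c_t² = o(a_t)`
(`tendsto_sq_div_of_antitone`).
-/

set_option linter.unusedSectionVars false

noncomputable section

/-! ### Gaussian fields with a given covariance -/

section GaussianField

/-- The product of standard Gaussian measures over an arbitrary index set (white noise). -/
abbrev whiteNoise (ι : Type*) : Measure (ι → ℝ) :=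
  Measure.infinitePi (fun _ : ι => gaussianReal 0 1)

lemma charFun_finset_sum_whiteNoise {ι : Type*} (s : Finset ι) (c : ι → ℝ) :
    ∫ ω, Complex.exp ((∑ i ∈ s, c i * ω i : ℝ) * Complex.I) ∂(whiteNoise ι)
      = Complex.exp (-(∑ i ∈ s, c i ^ 2 : ℝ) / 2) := by
  classical
  have hind : iIndepFun (fun (i : ι) (ω : ι → ℝ) => ω i) (whiteNoise ι) :=
    iIndepFun_infinitePi (X := fun _ ω => ω) (fun _ => measurable_id)
  have h0 : iIndepFun (fun (i : s) (ω : ι → ℝ) => ω i) (whiteNoise ι) :=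
    hind.precomp Subtype.val_injective
  have h1 := h0.integral_fun_prod_comp (ι := s) (𝓧 := fun _ => ℝ)
    (X := fun (i : s) (ω : ι → ℝ) => ω i) (μ := whiteNoise ι) (f := fun i x => Complex.exp ((c i * x : ℝ) * Complex.I))
    (fun i => (measurable_pi_apply (i : ι)).aemeasurable)
    (fun i => by fun_prop)
  have h2 : ∀ i : ι, ∫ ω, Complex.exp ((c i * ω i : ℝ) * Complex.I) ∂(whiteNoise ι)
      = Complex.exp (-(c i ^ 2 : ℝ) / 2) := by
    intro i
    have := (measurePreserving_eval_infinitePi (fun _ : ι => gaussianReal 0 1) i)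
    have h3 := charFun_gaussianReal (μ := 0) (v := 1) (c i)
    rw [charFun_apply_real, ← this.map_eq, integral_map this.measurable.aemeasurable
      (by fun_prop)] at h3
    simp only [Function.eval, NNReal.coe_one, Complex.ofReal_zero] at h3
    push_cast
    rw [h3]
    congr 1
    push_cast
    ring
  simp only [h2] at h1
  rw [Finset.prod_coe_sort s (fun i => Complex.exp (-(c i ^ 2 : ℝ) / 2)), ← Complex.exp_sum] at h1
  refine Eq.trans ?_ (h1.trans ?_)
  · congr 1
    ext ω
    rw [Finset.prod_coe_sort s (fun i => Complex.exp ((c i * ω i : ℝ) * Complex.I)),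
      ← Complex.exp_sum, ← Finset.sum_mul, Complex.ofReal_sum]
  · congr 1
    push_cast
    rw [← Finset.sum_div, Finset.sum_neg_distrib]

lemma memLp_eval_whiteNoise {ι : Type*} (i : ι) :
    MemLp (fun ω : ι → ℝ => ω i) 2 (whiteNoise ι) :=
  (memLp_id_gaussianReal (μ := 0) (v := 1) 2).comp_measurePreserving
    (measurePreserving_eval_infinitePi (fun _ : ι => gaussianReal 0 1) i)

/-- The coordinates of white noise as elements of `L²`. -/
def whiteNoiseCoord (ι : Type*) (i : ι) : Lp ℝ 2 (whiteNoise ι) :=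
  (memLp_eval_whiteNoise i).toLp (fun ω => ω i)

lemma coeFn_whiteNoiseCoord {ι : Type*} (i : ι) :
    whiteNoiseCoord ι i =ᵐ[whiteNoise ι] fun ω => ω i :=
  (memLp_eval_whiteNoise i).coeFn_toLp

lemma Lp_coeFn_finset_sum {Ω ι : Type*} [MeasurableSpace Ω] {μ : Measure Ω} (s : Finset ι)
    (f : ι → Lp ℝ 2 μ) (c : ι → ℝ) :
    (∑ i ∈ s, c i • f i : Lp ℝ 2 μ) =ᵐ[μ] fun ω => ∑ i ∈ s, c i * f i ω := by
  classical
  induction s using Finset.induction_on with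
  | empty =>
    simp only [Finset.sum_empty]
    exact Lp.coeFn_zero ℝ 2 μ
  | insert a s ha ih =>
    rw [Finset.sum_insert ha]
    filter_upwards [ih, Lp.coeFn_add (c a • f a) (∑ i ∈ s, c i • f i), Lp.coeFn_smul (c a) (f a)]
      with ω h1 h2 h3
    rw [h2, Pi.add_apply, h1, h3, Finset.sum_insert ha]
    rfl

lemma orthonormal_eval_whiteNoise (ι : Type*) :
    Orthonormal ℝ (whiteNoiseCoord ι) := by
  classical
  have hind : iIndepFun (fun (i : ι) (ω : ι → ℝ) => ω i) (whiteNoise ι) :=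
    iIndepFun_infinitePi (X := fun _ ω => ω) (fun _ => measurable_id)
  have hmp := fun i : ι => measurePreserving_eval_infinitePi (fun _ : ι => gaussianReal 0 1) i
  have hmean : ∀ i : ι, ∫ ω, ω i ∂(whiteNoise ι) = 0 := fun i => by
    have := integral_map (hmp i).measurable.aemeasurable (μ := whiteNoise ι) (f := fun x : ℝ => x)
      (by fun_prop)
    rw [(hmp i).map_eq, integral_id_gaussianReal] at this
    exact this.symm
  have hvar : ∀ i : ι, ∫ ω, ω i * ω i ∂(whiteNoise ι) = 1 := fun i => by
    have := integral_map (hmp i).measurable.aemeasurable (μ := whiteNoise ι) (f := fun x : ℝ => x * x)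
      (by fun_prop)
    rw [(hmp i).map_eq] at this
    have h2 := variance_id_gaussianReal (μ := 0) (v := 1)
    rw [variance_eq_integral (by fun_prop)] at h2
    simp only [id, integral_id_gaussianReal, sub_zero, NNReal.coe_one, sq] at h2
    rw [h2] at this
    exact this.symm
  rw [orthonormal_iff_ite]
  intro i j
  rw [L2.inner_def]
  have : ∫ ω, inner ℝ (whiteNoiseCoord ι i ω) (whiteNoiseCoord ι j ω)
      ∂(whiteNoise ι) = ∫ ω, ω i * ω j ∂(whiteNoise ι) := by
    apply integral_congr_ae
    filter_upwards [coeFn_whiteNoiseCoord i, coeFn_whiteNoiseCoord j]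
      with ω h1 h2
    rw [h1, h2]; simp [mul_comm]
  rw [this]
  split_ifs with h
  · subst h; exact hvar i
  · rw [(hind.indepFun h).integral_fun_mul_eq_mul_integral
      (measurable_pi_apply i).aestronglyMeasurable (measurable_pi_apply j).aestronglyMeasurable,
      hmean i, zero_mul]

/-- `X ↦ E exp(iX)` is continuous on `L²`. -/
lemma continuous_integral_cexp_Lp {Ω : Type*} [MeasurableSpace Ω] (μ : Measure Ω)
    [IsProbabilityMeasure μ] :
    Continuous (fun X : Lp ℝ 2 μ => ∫ ω, Complex.exp ((X ω : ℝ) * Complex.I) ∂μ) := by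
  have hint : ∀ X : Lp ℝ 2 μ, Integrable (fun ω => Complex.exp ((X ω : ℝ) * Complex.I)) μ := by
    intro X
    have := Lp.aestronglyMeasurable X
    refine Integrable.mono' (integrable_const (1 : ℝ)) ?_ ?_
    · exact (Complex.continuous_exp.comp_aestronglyMeasurable
        ((Complex.continuous_ofReal.comp_aestronglyMeasurable this).mul_const _))
    · exact ae_of_all _ fun ω => by rw [Complex.norm_exp_ofReal_mul_I]
  apply LipschitzWith.continuous (K := 1)
  apply LipschitzWith.of_dist_le_mul
  intro X Y
  rw [dist_eq_norm, dist_eq_norm, ← integral_sub (hint X) (hint Y), NNReal.coe_one, one_mul]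
  have hle : ∀ x y : ℝ, ‖Complex.exp (x * Complex.I) - Complex.exp (y * Complex.I)‖ ≤ ‖x - y‖ := by
    intro x y
    have : Complex.exp (x * Complex.I) - Complex.exp (y * Complex.I)
        = Complex.exp (y * Complex.I) * (Complex.exp (Complex.I * (x - y : ℝ)) - 1) := by
      rw [mul_sub, ← Complex.exp_add]; push_cast; ring_nf
    rw [this, norm_mul, Complex.norm_exp_ofReal_mul_I, one_mul]
    exact Real.norm_exp_I_mul_ofReal_sub_one_le
  have hXY : MemLp (X - Y : Lp ℝ 2 μ) 2 μ := Lp.memLp _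
  have h1 : MemLp (X - Y : Lp ℝ 2 μ) 1 μ := hXY.mono_exponent (by norm_num)
  calc ‖∫ ω, (Complex.exp ((X ω : ℝ) * Complex.I) - Complex.exp ((Y ω : ℝ) * Complex.I)) ∂μ‖
      ≤ ∫ ω, ‖(X - Y : Lp ℝ 2 μ) ω‖ ∂μ := by
        apply norm_integral_le_of_norm_le (memLp_one_iff_integrable.1 h1).norm
        filter_upwards [Lp.coeFn_sub X Y] with ω hω
        rw [hω]; exact hle _ _
    _ = (eLpNorm (X - Y : Lp ℝ 2 μ) 1 μ).toReal := by
        rw [eLpNorm_one_eq_lintegral_enorm, integral_norm_eq_lintegral_enorm h1.1]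
    _ ≤ (eLpNorm (X - Y : Lp ℝ 2 μ) 2 μ).toReal :=
        ENNReal.toReal_mono hXY.2.ne (eLpNorm_le_eLpNorm_of_exponent_le (by norm_num) h1.1)
    _ = ‖X - Y‖ := by rw [Lp.norm_def]

/-- The isonormal Gaussian process over a real Hilbert space: an isometry into the `L²` space of a
white noise, sending an orthonormal basis to the independent standard Gaussian coordinates. -/
lemma exists_isonormal.{u} (E : Type u) [NormedAddCommGroup E] [InnerProductSpace ℝ E]
    [CompleteSpace E] :
    ∃ (ι : Type u) (w : E →ₗᵢ[ℝ] Lp ℝ 2 (whiteNoise ι)),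
      ∀ h, (whiteNoise ι).map (w h) = gaussianReal 0 (‖h‖₊ ^ 2) := by
  classical
  obtain ⟨s, b, -⟩ := exists_hilbertBasis ℝ E
  set v := (orthonormal_eval_whiteNoise s).orthogonalFamily.linearIsometry with hv
  refine ⟨s, v.comp b.repr.toLinearIsometry, fun h => ?_⟩
  have key : ∀ h : E, ∫ ω, Complex.exp (((v.comp b.repr.toLinearIsometry) h ω : ℝ) * Complex.I)
      ∂(whiteNoise s) = Complex.exp (-(‖h‖ ^ 2 : ℝ) / 2) := by
    intro h
    have hsum : HasSum (fun i => (b.repr h i) • whiteNoiseCoord s i)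
        ((v.comp b.repr.toLinearIsometry) h) :=
      (orthonormal_eval_whiteNoise s).orthogonalFamily.hasSum_linearIsometry (b.repr h)
    have h1 := ((continuous_integral_cexp_Lp (whiteNoise s)).tendsto _).comp hsum
    have hsq : HasSum (fun i => b.repr h i ^ 2) (‖h‖ ^ 2) := by
      have := b.hasSum_inner_mul_inner h h
      rw [real_inner_self_eq_norm_sq] at this
      convert! this using 2 with i
      rw [b.repr_apply_apply, real_inner_comm h, sq]
    have h2 : Tendsto (fun t : Finset s => Complex.exp (-(∑ i ∈ t, b.repr h i ^ 2 : ℝ) / 2)) atTop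
        (𝓝 (Complex.exp (-(‖h‖ ^ 2 : ℝ) / 2))) := by
      have hc : Continuous (fun x : ℝ => Complex.exp (-(x : ℂ) / 2)) := by fun_prop
      exact (hc.tendsto _).comp hsq
    refine tendsto_nhds_unique h1 (h2.congr fun t => ?_)
    rw [← charFun_finset_sum_whiteNoise t (fun i => b.repr h i)]
    apply integral_congr_ae
    have hco : ∀ᵐ ω ∂(whiteNoise s), ∀ i ∈ t, whiteNoiseCoord s i ω = ω i :=
      (Finset.eventually_all _).2 fun i _ => coeFn_whiteNoiseCoord i
    filter_upwards [Lp_coeFn_finset_sum t (whiteNoiseCoord s) (fun i => b.repr h i), hco]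
      with ω h1 h2
    rw [h1]
    congr 3
    exact (Finset.sum_congr rfl fun i hi => by rw [h2 i hi]).symm
  have hmeas : Measurable ((v.comp b.repr.toLinearIsometry) h) := (Lp.stronglyMeasurable _).measurable
  have : IsProbabilityMeasure ((whiteNoise s).map ((v.comp b.repr.toLinearIsometry) h)) :=
    Measure.isProbabilityMeasure_map hmeas.aemeasurable
  apply Measure.ext_of_charFun
  ext t
  rw [charFun_gaussianReal, charFun_apply_real, integral_map hmeas.aemeasurable (by fun_prop)]
  have h3 := key (t • h)
  rw [map_smul] at h3
  have h4 : ∫ ω, Complex.exp ((t : ℂ) * ((v.comp b.repr.toLinearIsometry) h ω : ℝ) * Complex.I)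
      ∂(whiteNoise s) = ∫ ω, Complex.exp (((t • (v.comp b.repr.toLinearIsometry) h : Lp ℝ 2 (whiteNoise s)) ω : ℝ) * Complex.I)
      ∂(whiteNoise s) := by
    apply integral_congr_ae
    filter_upwards [Lp.coeFn_smul t ((v.comp b.repr.toLinearIsometry) h)] with ω hω
    rw [hω]; simp
  rw [h4, h3, norm_smul, mul_pow, Real.norm_eq_abs, sq_abs]
  congr 1
  push_cast
  ring

open RKHS in
/-- A positive semidefinite kernel is the covariance of a centred Gaussian field: embed the index set
into the reproducing kernel Hilbert space and restrict the isonormal process to it. -/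
theorem exists_gaussianField {T : Type*} (Γ : T → T → ℝ) (hsymm : ∀ s t, Γ s t = Γ t s)
    (hpos : ∀ c : T →₀ ℝ, 0 ≤ c.sum fun s a => c.sum fun t b => a * b * Γ s t) :
    ∃ (ν : Measure (T → ℝ)) (_ : IsProbabilityMeasure ν),
      IsGaussianProcess (fun (t : T) (z : T → ℝ) => z t) ν ∧
      (∀ t, ∫ z, z t ∂ν = 0) ∧
      (∀ s t, covariance (fun z => z s) (fun z => z t) ν = Γ s t) := by
  classical
  let K : Matrix T T (ℝ →L[ℝ] ℝ) := fun s t => Γ s t • ContinuousLinearMap.id ℝ ℝ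
  have hK : K.PosSemidef := by
    have hiff := (RKHS.posSemidef_tfae (𝕜 := ℝ) (K := K)).out 0 2
    refine hiff.mpr ⟨?_, ?_⟩
    · ext s t
      rw [Matrix.conjTranspose_apply]
      have h1 : (1 : ℝ →L[ℝ] ℝ) = ContinuousLinearMap.id ℝ ℝ := rfl
      simp [K, hsymm s t, ← h1]
    · intro c
      refine (hpos c).trans_eq ?_
      simp only [Finsupp.sum, RCLike.re_to_real]
      refine Finset.sum_congr rfl fun s _ => Finset.sum_congr rfl fun t _ => ?_
      simp [K, hsymm s t]
      ring
  have : Fact K.PosSemidef := ⟨hK⟩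
  obtain ⟨ι, w, hw⟩ := exists_isonormal (OfKernel K)
  let e : T → OfKernel K := fun t => kerFun (OfKernel K) t 1
  have he : ∀ s t, inner ℝ (e s) (e t) = Γ s t := by
    intro s t
    have := kernel_inner (OfKernel K) (𝕜 := ℝ) t s (1 : ℝ) 1
    rw [OfKernel.kernel_ofKernel] at this
    rw [← this]
    simp [K, hsymm s t]
  let X : T → (ι → ℝ) → ℝ := fun t => w (e t)
  have hXm : ∀ t, Measurable (X t) := fun t => (Lp.stronglyMeasurable _).measurable
  have hXm' : Measurable (fun ω t => X t ω) := measurable_pi_lambda _ hXm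
  have hmean : ∀ t, ∫ ω, X t ω ∂(whiteNoise ι) = 0 := by
    intro t
    have h1 := integral_map (hXm t).aemeasurable (μ := whiteNoise ι) (f := fun x : ℝ => x)
      (by fun_prop)
    rw [hw, integral_id_gaussianReal] at h1
    exact h1.symm
  have hprob : IsProbabilityMeasure ((whiteNoise ι).map (fun ω t => X t ω)) :=
    Measure.isProbabilityMeasure_map hXm'.aemeasurable
  refine ⟨(whiteNoise ι).map (fun ω t => X t ω), hprob, ⟨fun I => ⟨?_⟩⟩, fun t => ?_, fun s t => ?_⟩
  · apply isGaussian_of_map_eq_gaussianReal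
    intro L
    rw [Measure.map_map L.measurable (by fun_prop), Measure.map_map (by fun_prop) hXm']
    let h : OfKernel K := ∑ i : I, L (Pi.single i 1) • e i
    refine ⟨0, ‖h‖₊ ^ 2, ?_⟩
    rw [← hw h]
    apply Measure.map_congr
    have hs : w h = ∑ i : I, L (Pi.single i 1) • w (e i) := by simp [h, map_sum]
    rw [hs]
    filter_upwards [Lp_coeFn_finset_sum Finset.univ (fun i : I => w (e i))
      (fun i => L (Pi.single i 1))] with ω h1
    rw [h1]
    simp only [Function.comp_apply]
    have hL := LinearMap.pi_apply_eq_sum_univ L.toLinearMap (I.restrict fun t => X t ω)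
    refine hL.trans (Finset.sum_congr rfl fun i _ => ?_)
    rw [smul_eq_mul, mul_comm]
    refine congrArg (· * X i ω) (congrArg L (funext fun j => ?_))
    simp [Pi.single_apply, eq_comm]
  · rw [integral_map hXm'.aemeasurable (measurable_pi_apply t).aestronglyMeasurable]
    exact hmean t
  · rw [covariance_map (measurable_pi_apply s).aestronglyMeasurable
      (measurable_pi_apply t).aestronglyMeasurable hXm'.aemeasurable]
    change covariance (X s) (X t) (whiteNoise ι) = _
    rw [covariance, ← he s t, ← w.inner_map_map, L2.inner_def]
    simp only [hmean, sub_zero]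
    apply integral_congr_ae
    exact ae_of_all _ fun ω => by simp [X, mul_comm]
end GaussianField

/-! ### Convergence through characteristic functions -/

section Convergence

lemma integral_cexp_gaussianProcess {T : Type*} {ν : Measure (T → ℝ)} [IsProbabilityMeasure ν]
    (hν : IsGaussianProcess (fun (t : T) (z : T → ℝ) => z t) ν) (h0 : ∀ t, ∫ z, z t ∂ν = 0)
    {Γ : T → T → ℝ} (hΓ : ∀ s t, covariance (fun z => z s) (fun z => z t) ν = Γ s t)
    (I : Finset T) (θ : I → ℝ) :
    ∫ z, Complex.exp ((∑ i, θ i * z i : ℝ) * Complex.I) ∂ν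
      = Complex.exp (-(∑ i, ∑ j, θ i * θ j * Γ i j : ℝ) / 2) := by
  have hL := hν.hasGaussianLaw I
  let L : StrongDual ℝ (I → ℝ) := ∑ i, θ i • ContinuousLinearMap.proj i
  have hLa : ∀ z : T → ℝ, L (I.restrict z) = ∑ i, θ i * z i := by
    intro z; simp [L]
  have h1 := hL.charFunDual_map_eq L
  rw [charFunDual_apply, integral_map hL.aemeasurable (by fun_prop)] at h1
  have hmem : ∀ i : T, MemLp (fun z : T → ℝ => z i) 2 ν :=
    fun i => (hν.hasGaussianLaw_eval i).memLp_two
  have hmemθ : ∀ i : I, MemLp (fun z : T → ℝ => θ i * z i) 2 ν :=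
    fun i => (hmem i).const_mul (θ i)
  have hcomp : (L ∘ fun z : T → ℝ => I.restrict fun t => z t) = fun z => ∑ i : I, θ i * z i := by
    ext z; exact hLa z
  have hmean : ∫ z, (∑ i : I, θ i * z i) ∂ν = 0 := by
    rw [integral_finsetSum _ fun i _ => (hmemθ i).integrable (by norm_num)]
    simp [integral_const_mul, h0]
  have hvar : variance (fun z : T → ℝ => ∑ i : I, θ i * z i) ν
      = ∑ i : I, ∑ j : I, θ i * θ j * Γ i j := by
    rw [variance_fun_sum hmemθ]
    refine Finset.sum_congr rfl fun i _ => Finset.sum_congr rfl fun j _ => ?_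
    rw [covariance_const_mul_left, covariance_const_mul_right, hΓ, mul_assoc]
  rw [hcomp, hmean, hvar] at h1
  simp only [hLa] at h1
  rw [h1]
  congr 1
  push_cast
  ring

/-- Convergence of characteristic functions to those of a centred Gaussian field implies
convergence of the finite-dimensional distributions. -/
lemma tendstoInDistribution_of_tendsto_integral_cexp {T Ω : Type*} [MeasurableSpace Ω]
    (P : Measure Ω) [IsProbabilityMeasure P] {ν : Measure (T → ℝ)} [IsProbabilityMeasure ν]
    (hν : IsGaussianProcess (fun (t : T) (z : T → ℝ) => z t) ν) (h0 : ∀ t, ∫ z, z t ∂ν = 0)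
    {Γ : T → T → ℝ} (hΓ : ∀ s t, covariance (fun z => z s) (fun z => z t) ν = Γ s t)
    (I : Finset T) (Y : ℝ → T → Ω → ℝ) (hY : ∀ t φ, AEMeasurable (Y t φ) P)
    (h : ∀ θ : I → ℝ, Tendsto
      (fun t => ∫ ω, Complex.exp ((∑ i, θ i * Y t i ω : ℝ) * Complex.I) ∂P) atTop
      (𝓝 (Complex.exp (-(∑ i, ∑ j, θ i * θ j * Γ i j : ℝ) / 2)))) :
    TendstoInDistribution (fun (t : ℝ) (ω : Ω) (φ : I) => Y t φ ω) atTop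
        (fun (z : T → ℝ) (φ : I) => z φ) (fun _ => P) ν := by
  have hYm : ∀ t, AEMeasurable (fun (ω : Ω) (φ : I) => Y t φ ω) P :=
    fun t => aemeasurable_pi_lambda _ fun φ => hY t φ
  have hzm : Measurable (fun (z : T → ℝ) (φ : I) => z φ) :=
    measurable_pi_lambda _ fun φ => measurable_pi_apply _
  have htl : Measurable (WithLp.toLp 2 : (I → ℝ) → EuclideanSpace ℝ I) :=
    (MeasurableEquiv.toLp 2 (I → ℝ)).measurable
  have htY : ∀ t, AEMeasurable (fun ω => WithLp.toLp 2 fun φ : I => Y t φ ω) P :=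
    fun t => htl.comp_aemeasurable (hYm t)
  have htz : Measurable (fun z : T → ℝ => WithLp.toLp 2 fun φ : I => z φ) := htl.comp hzm
  refine ⟨hYm, hzm.aemeasurable, ?_⟩
  apply tendsto_of_seq_tendsto
  intro u hu
  let μ : ℕ → ProbabilityMeasure (EuclideanSpace ℝ I) := fun n =>
    ⟨P.map (fun ω => WithLp.toLp 2 fun φ : I => Y (u n) φ ω),
      Measure.isProbabilityMeasure_map (htY (u n))⟩
  let μ₀ : ProbabilityMeasure (EuclideanSpace ℝ I) :=
    ⟨ν.map (fun z => WithLp.toLp 2 fun φ : I => z φ),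
      Measure.isProbabilityMeasure_map htz.aemeasurable⟩
  have hμ : Tendsto μ atTop (𝓝 μ₀) := by
    apply ProbabilityMeasure.tendsto_of_tendsto_charFun
    intro x
    have h1 : charFun (μ₀ : Measure (EuclideanSpace ℝ I)) x
        = Complex.exp (-(∑ i, ∑ j, x i * x j * Γ i j : ℝ) / 2) := by
      rw [← integral_cexp_gaussianProcess hν h0 hΓ I x, charFun_apply]
      change ∫ y, _ ∂(ν.map (fun z => WithLp.toLp 2 fun φ : I => z φ)) = _
      rw [integral_map htz.aemeasurable (by fun_prop)]
      congr 1
    rw [h1]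
    refine ((h x).comp hu).congr fun n => ?_
    rw [charFun_apply]
    change _ = ∫ y, _ ∂(P.map (fun ω => WithLp.toLp 2 fun φ : I => Y (u n) φ ω))
    rw [integral_map (htY (u n)) (by fun_prop)]
    simp [PiLp.inner_apply]
  have hof : Continuous (WithLp.ofLp : EuclideanSpace ℝ I → (I → ℝ)) :=
    PiLp.continuous_ofLp 2 _
  have := ProbabilityMeasure.tendsto_map_of_tendsto_of_continuous μ μ₀ hμ hof
  convert! this using 1
  · ext1 n
    apply Subtype.ext
    change P.map _ = (P.map _).map _
    rw [AEMeasurable.map_map_of_aemeasurable hof.measurable.aemeasurable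
      (htY (u n))]
    rfl
  · congr 1
    apply Subtype.ext
    change ν.map _ = (ν.map _).map _
    rw [Measure.map_map hof.measurable htz]
    rfl

end Convergence

/-! ### Taylor bounds for the characteristic exponent -/

section Exponential

lemma hasDerivAt_cexp_ofReal_mul_I (x : ℝ) :
    HasDerivAt (fun x : ℝ => Complex.exp (x * Complex.I)) (Complex.I * Complex.exp (x * Complex.I)) x := by
  have h := ((Complex.ofRealCLM.hasDerivAt (x := x)).mul_const Complex.I).cexp
  simpa [mul_comm] using h

lemma norm_cexp_sub_one_le (x : ℝ) : ‖Complex.exp (x * Complex.I) - 1‖ ≤ |x| := by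
  have := Real.norm_exp_I_mul_ofReal_sub_one_le (x := x)
  rwa [mul_comm, Real.norm_eq_abs] at this

/-- Integrating a bound on the derivative along `[0, ∞)`. -/
lemma norm_le_of_norm_deriv_le {f f' : ℝ → ℂ} {B B' : ℝ → ℝ} (hf : ∀ x, HasDerivAt f (f' x) x)
    (hf0 : f 0 = 0) (hB : ∀ x, HasDerivAt B (B' x) x) (hB0 : B 0 = 0)
    (h : ∀ x, 0 ≤ x → ‖f' x‖ ≤ B' x) (x : ℝ) (hx : 0 ≤ x) : ‖f x‖ ≤ B x :=
  image_norm_le_of_norm_deriv_right_le_deriv_boundary (a := 0) (b := x)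
    (fun y _ => (hf y).continuousAt.continuousWithinAt) (fun y _ => (hf y).hasDerivWithinAt)
    (by rw [hf0, hB0, norm_zero]) hB (fun y hy => h y hy.1) ⟨hx, le_rfl⟩

lemma cexp_neg_mul_I (x : ℝ) :
    Complex.exp ((-x : ℝ) * Complex.I) = (starRingEnd ℂ) (Complex.exp (x * Complex.I)) := by
  rw [← Complex.exp_conj]; simp

lemma norm_cexp_sub_one_sub_le (x : ℝ) :
    ‖Complex.exp (x * Complex.I) - 1 - x * Complex.I‖ ≤ x ^ 2 / 2 := by
  have key : ∀ x : ℝ, 0 ≤ x → ‖Complex.exp (x * Complex.I) - 1 - x * Complex.I‖ ≤ x ^ 2 / 2 := by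
    refine norm_le_of_norm_deriv_le (f' := fun x => Complex.I * (Complex.exp (x * Complex.I) - 1))
      (B' := fun x => x) (fun x => ?_) (by simp) (fun x => ?_) (by simp) (fun x hx => ?_)
    · convert! ((hasDerivAt_cexp_ofReal_mul_I x).sub_const 1).sub
        ((Complex.ofRealCLM.hasDerivAt (x := x)).mul_const Complex.I) using 1
      simp; ring
    · convert! ((hasDerivAt_pow 2 x).div_const 2) using 1
      simp
    · rw [norm_mul, Complex.norm_I, one_mul]
      exact (norm_cexp_sub_one_le x).trans_eq (abs_of_nonneg hx)
  rcases le_total 0 x with hx | hx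
  · exact key x hx
  · have := key (-x) (by linarith)
    rw [cexp_neg_mul_I, ← Complex.norm_conj] at this
    simpa [sub_eq_add_neg] using this

lemma norm_cexp_sub_one_sub_add_le (x : ℝ) :
    ‖Complex.exp (x * Complex.I) - 1 - x * Complex.I + x ^ 2 / 2‖ ≤ |x| ^ 3 / 6 := by
  have key : ∀ x : ℝ, 0 ≤ x →
      ‖Complex.exp (x * Complex.I) - 1 - x * Complex.I + x ^ 2 / 2‖ ≤ x ^ 3 / 6 := by
    refine norm_le_of_norm_deriv_le
      (f' := fun x => Complex.I * (Complex.exp (x * Complex.I) - 1 - x * Complex.I))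
      (B' := fun x => x ^ 2 / 2) (fun x => ?_) (by simp) (fun x => ?_) (by simp) (fun x hx => ?_)
    · convert! (((hasDerivAt_cexp_ofReal_mul_I x).sub_const 1).sub
        ((Complex.ofRealCLM.hasDerivAt (x := x)).mul_const Complex.I)).add
        (((Complex.ofRealCLM.hasDerivAt (x := x)).pow 2).div_const 2) using 1
      simp
      ring_nf
      simp
    · convert! ((hasDerivAt_pow 3 x).div_const 6) using 1
      simp; ring
    · rw [norm_mul, Complex.norm_I, one_mul]
      exact norm_cexp_sub_one_sub_le x
  rcases le_total 0 x with hx | hx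
  · rw [abs_of_nonneg hx]; exact key x hx
  · have := key (-x) (by linarith)
    rw [cexp_neg_mul_I, ← Complex.norm_conj] at this
    rw [abs_of_nonpos hx]
    simpa [sub_eq_add_neg, Complex.conj_ofNat] using this

/-- If second moments converge and third absolute moments vanish in the limit, the exponent of
a centred Poisson integral converges to the Gaussian exponent. -/
lemma tendsto_integral_cexp_sub_one_sub {E : Type*} [MeasurableSpace E] (m : Measure E)
    (V : ℝ → E → ℝ) (U : ℝ → E → ℝ) {l : Filter ℝ} {σ : ℝ}
    (h1 : ∀ t, Integrable (V t) m) (h2 : ∀ t, Integrable (fun x => V t x ^ 2) m)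
    (hUV : ∀ t x, |V t x| ≤ U t x) (h3 : ∀ t, Integrable (fun x => U t x ^ 3) m)
    (h2σ : Tendsto (fun t => ∫ x, V t x ^ 2 ∂m) l (𝓝 σ))
    (h30 : Tendsto (fun t => ∫ x, U t x ^ 3 ∂m) l (𝓝 0)) :
    Tendsto (fun t => ∫ x, (Complex.exp (V t x * Complex.I) - 1 - V t x * Complex.I) ∂m) l
      (𝓝 (-(σ : ℂ) / 2)) := by
  have hmeas : ∀ t, AEStronglyMeasurable
      (fun x => Complex.exp (V t x * Complex.I) - 1 - V t x * Complex.I) m := fun t => by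
    have hV : AEStronglyMeasurable (fun x => (V t x : ℂ) * Complex.I) m :=
      (Complex.continuous_ofReal.comp_aestronglyMeasurable (h1 t).1).mul_const _
    exact ((Complex.continuous_exp.comp_aestronglyMeasurable hV).sub
      aestronglyMeasurable_const).sub hV
  have hint : ∀ t, Integrable
      (fun x => Complex.exp (V t x * Complex.I) - 1 - V t x * Complex.I) m := fun t => by
    refine ((h2 t).div_const 2).mono' (hmeas t) (ae_of_all _ fun x => ?_)
    exact norm_cexp_sub_one_sub_le _
  have hint2 : ∀ t, Integrable (fun x => (V t x : ℂ) ^ 2 / 2) m := fun t => by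
    have := ((h2 t).ofReal (𝕜 := ℂ)).div_const 2
    simpa using this
  have hbound : ∀ t, ‖(∫ x, (Complex.exp (V t x * Complex.I) - 1 - V t x * Complex.I) ∂m)
      + ((∫ x, V t x ^ 2 ∂m : ℝ) : ℂ) / 2‖ ≤ (∫ x, U t x ^ 3 ∂m) / 6 := by
    intro t
    have : ((∫ x, V t x ^ 2 ∂m : ℝ) : ℂ) / 2 = ∫ x, (V t x : ℂ) ^ 2 / 2 ∂m := by
      rw [integral_div, ← integral_complex_ofReal]; simp
    rw [this, ← integral_add (hint t) (hint2 t), ← integral_div]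
    refine norm_integral_le_of_norm_le ((h3 t).div_const 6) (ae_of_all _ fun x => ?_)
    refine (norm_cexp_sub_one_sub_add_le _).trans ?_
    have := hUV t x
    gcongr
  have hz : Tendsto (fun t => (∫ x, (Complex.exp (V t x * Complex.I) - 1 - V t x * Complex.I) ∂m)
      + ((∫ x, V t x ^ 2 ∂m : ℝ) : ℂ) / 2) l (𝓝 0) := by
    refine squeeze_zero_norm hbound ?_
    simpa using h30.div_const 6
  have h4 : Tendsto (fun t => ((∫ x, V t x ^ 2 ∂m : ℝ) : ℂ) / 2) l (𝓝 ((σ : ℂ) / 2)) :=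
    ((Complex.continuous_ofReal.tendsto _).comp h2σ).div_const 2
  have := hz.sub h4
  simp only [add_sub_cancel_right, zero_sub] at this
  rwa [neg_div]

end Exponential

/-! ### Poisson systems of points -/

section Poisson

lemma integral_pow_poissonMeasure (r : ℝ≥0) (c : ℂ) :
    ∫ n, c ^ n ∂(poissonMeasure r) = Complex.exp ((c - 1) * (r : ℝ)) := by
  rw [integral_poissonMeasure]
  have h : HasSum (fun n : ℕ => (c * (r : ℝ)) ^ n / (n.factorial : ℂ)) (Complex.exp (c * (r : ℝ))) := by
    rw [Complex.exp_eq_exp_ℂ]; exact NormedSpace.expSeries_div_hasSum_exp _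
  have h2 := (h.mul_left (Complex.exp (-(r : ℝ)))).tsum_eq
  rw [← Complex.exp_add] at h2
  rw [show (c - 1) * (r : ℝ) = -(r : ℝ) + c * (r : ℝ) by ring, ← h2]
  refine tsum_congr fun n => ?_
  rw [Complex.real_smul]
  push_cast
  ring

lemma lintegral_cast_poissonMeasure (r : ℝ≥0) : ∫⁻ n, (n : ℝ≥0∞) ∂(poissonMeasure r) = r := by
  rw [lintegral_countable']
  simp only [poissonMeasure_singleton]
  rw [tsum_eq_zero_add' ENNReal.summable]
  have h : ∀ n : ℕ, ((n + 1 : ℕ) : ℝ≥0∞)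
      * ENNReal.ofReal (Real.exp (-r) * r ^ (n + 1) / ((n + 1).factorial : ℝ))
      = r * ENNReal.ofReal (Real.exp (-r) * r ^ n / (n.factorial : ℝ)) := by
    intro n
    rw [← ENNReal.ofReal_natCast, ← ENNReal.ofReal_coe_nnreal (p := r), ← ENNReal.ofReal_mul (by positivity),
      ← ENNReal.ofReal_mul (by positivity)]
    congr 1
    rw [Nat.factorial_succ]
    have : (n.factorial : ℝ) ≠ 0 := by positivity
    have : ((n + 1 : ℕ) : ℝ) ≠ 0 := by positivity
    push_cast at *
    field_simp
    ring
  simp only [h, ENNReal.tsum_mul_left]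
  rw [← ENNReal.ofReal_tsum_of_nonneg (fun n => by positivity) (hasSum_one_poissonMeasure r).summable,
    (hasSum_one_poissonMeasure r).tsum_eq]
  simp

lemma eventually_card_filter_range_eq (p : ℕ → Prop) [DecidablePred p] {k : ℕ}
    (h : ∑' i, (if p i then 1 else 0 : ℝ≥0∞) = k) :
    ∀ᶠ n in atTop, ((Finset.range n).filter p).card = k := by
  have h1 := (ENNReal.summable (f := fun i => (if p i then 1 else 0 : ℝ≥0∞))).hasSum.tendsto_sum_nat
  rw [h] at h1
  have h2 := (ENNReal.tendsto_toReal (ENNReal.natCast_ne_top k)).comp h1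
  have h3 : Tendsto (fun n => ((((Finset.range n).filter p).card : ℕ) : ℝ)) atTop (𝓝 (k : ℝ)) := by
    refine h2.congr fun n => ?_
    simp
  have h4 := Nat.isClosedEmbedding_coe_real.isEmbedding.tendsto_nhds_iff (f := fun n => ((Finset.range n).filter p).card)
    (l := atTop) (y := k)
  have h5 := h4.2 h3
  rw [nhds_discrete, tendsto_pure] at h5
  exact h5

lemma norm_prod_sub_prod_le_sum {ι : Type*} (s : Finset ι) (a b : ι → ℂ)
    (ha : ∀ i, ‖a i‖ ≤ 1) (hb : ∀ i, ‖b i‖ ≤ 1) :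
    ‖∏ i ∈ s, a i - ∏ i ∈ s, b i‖ ≤ ∑ i ∈ s, ‖a i - b i‖ := by
  classical
  induction s using Finset.induction_on with
  | empty => simp
  | insert j s hj ih =>
    rw [Finset.prod_insert hj, Finset.prod_insert hj, Finset.sum_insert hj]
    have h1 : ‖∏ i ∈ s, b i‖ ≤ 1 := by
      rw [norm_prod]; exact Finset.prod_le_one (fun _ _ => norm_nonneg _) fun i _ => hb i
    calc ‖a j * ∏ i ∈ s, a i - b j * ∏ i ∈ s, b i‖
        = ‖a j * (∏ i ∈ s, a i - ∏ i ∈ s, b i) + (a j - b j) * ∏ i ∈ s, b i‖ := by ring_nf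
      _ ≤ ‖a j‖ * ‖∏ i ∈ s, a i - ∏ i ∈ s, b i‖ + ‖a j - b j‖ * ‖∏ i ∈ s, b i‖ := by
          refine (norm_add_le _ _).trans ?_; rw [norm_mul, norm_mul]
      _ ≤ 1 * ‖∏ i ∈ s, a i - ∏ i ∈ s, b i‖ + ‖a j - b j‖ * 1 := by
          gcongr; exact ha j
      _ ≤ ‖a j - b j‖ + ∑ i ∈ s, ‖a i - b i‖ := by linarith

variable {S Ω : Type*} [MeasurableSpace S] [MeasurableSpace Ω] {P : Measure Ω} {ρ : Measure S}

omit [MeasurableSpace Ω] in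
lemma lintegral_empiricalMeasure (κ : Ω → ℕ∞) (Z : ℕ → ℝ≥0 → Ω → S) (t : ℝ≥0) (ω : Ω)
    {u : S → ℝ≥0∞} (hu : Measurable u) :
    ∫⁻ x, u x ∂(empiricalMeasure κ Z t ω)
      = ∑' i : ℕ, if (i : ℕ∞) < κ ω then u (Z i t ω) else 0 := by
  rw [empiricalMeasure, lintegral_sum_measure]
  refine tsum_congr fun i => ?_
  split_ifs
  · exact lintegral_dirac' _ hu
  · simp

lemma measurableSet_index_lt {κ : Ω → ℕ∞} (hκ : Measurable κ) (i : ℕ) :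
    MeasurableSet {ω | (i : ℕ∞) < κ ω} :=
  hκ (MeasurableSet.of_discrete (s := Ioi (i : ℕ∞)))

lemma measurable_ite_index_lt {β : Type*} [MeasurableSpace β] {κ : Ω → ℕ∞} (hκ : Measurable κ)
    (i : ℕ) {f g : Ω → β} (hf : Measurable f) (hg : Measurable g) :
    Measurable (fun ω => if (i : ℕ∞) < κ ω then f ω else g ω) :=
  Measurable.ite (measurableSet_index_lt hκ i) hf hg

/-- Campbell's formula: the intensity of the Poisson system is its mean measure. -/
lemma lintegral_tsum_poissonSystem [SigmaFinite ρ] {κ : Ω → ℕ∞} {Z : ℕ → ℝ≥0 → Ω → S}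
    (hκ : Measurable κ) (hZ : ∀ i, Measurable (Z i 0))
    (hN : IsPoissonSystem P (empiricalMeasure κ Z 0) ρ) {u : S → ℝ≥0∞} (hu : Measurable u) :
    ∫⁻ ω, ∑' i : ℕ, (if (i : ℕ∞) < κ ω then u (Z i 0 ω) else 0) ∂P = ∫⁻ x, u x ∂ρ := by
  let η : Measure S := Measure.sum fun i : ℕ => (P.restrict {ω | (i : ℕ∞) < κ ω}).map (Z i 0)
  have hη : ∀ v : S → ℝ≥0∞, Measurable v → ∫⁻ x, v x ∂η
      = ∫⁻ ω, ∑' i : ℕ, (if (i : ℕ∞) < κ ω then v (Z i 0 ω) else 0) ∂P := by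
    intro v hv
    have hm : ∀ i : ℕ, AEMeasurable (fun ω => if (i : ℕ∞) < κ ω then v (Z i 0 ω) else 0) P :=
      fun i => (measurable_ite_index_lt hκ i (hv.comp (hZ i)) measurable_const).aemeasurable
    rw [lintegral_tsum hm, lintegral_sum_measure]
    refine tsum_congr fun i => ?_
    rw [lintegral_map hv (hZ i), ← lintegral_indicator (measurableSet_index_lt hκ i)]
    exact lintegral_congr fun ω => by simp [indicator_apply]
  have hηN : ∀ B, MeasurableSet B → η B = ∫⁻ ω, empiricalMeasure κ Z 0 ω B ∂P := by
    intro B hB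
    rw [← lintegral_indicator_one hB, hη _ (measurable_one.indicator hB)]
    refine lintegral_congr fun ω => ?_
    rw [← lintegral_indicator_one hB, lintegral_empiricalMeasure _ _ _ _ (measurable_one.indicator hB)]
  have hfin : ∀ B, MeasurableSet B → ρ B < ∞ → η B = ρ B := by
    intro B hB hρB
    rw [hηN B hB]
    have hl := hN.law B hB hρB
    have := hl.lintegral_comp (f := fun x : ℝ≥0∞ => x) measurable_id.aemeasurable
    rw [this, lintegral_map (f := fun x : ℝ≥0∞ => x) measurable_id Measurable.of_discrete]
    rw [lintegral_cast_poissonMeasure, ENNReal.coe_toNNReal hρB.ne]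
  -- by σ-finiteness it is enough to compare on sets of finite measure
  have heq : η = ρ := by
    ext B hB
    have hd : B = ⋃ n, B ∩ disjointed (spanningSets ρ) n := by
      rw [← inter_iUnion, iUnion_disjointed, iUnion_spanningSets, inter_univ]
    have hm : ∀ n, MeasurableSet (B ∩ disjointed (spanningSets ρ) n) := fun n =>
      hB.inter (MeasurableSet.disjointed (measurableSet_spanningSets ρ) n)
    have hdis : Pairwise (Function.onFun Disjoint fun n => B ∩ disjointed (spanningSets ρ) n) :=
      fun i j hij => ((disjoint_disjointed _) hij).mono inter_subset_right inter_subset_right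
    rw [hd, measure_iUnion hdis hm, measure_iUnion hdis hm]
    refine tsum_congr fun n => hfin _ (hm n) ?_
    exact (measure_mono (inter_subset_right.trans (disjointed_subset _ n))).trans_lt
      (measure_spanningSets_lt_top ρ n)
  rw [← hη u hu, heq]

lemma IsPoissonSystem.iIndepFun_fintype {N : Ω → Measure S} (hN : IsPoissonSystem P N ρ)
    {ι : Type*} [Fintype ι] (B : ι → Set S) (hB : ∀ i, MeasurableSet (B i))
    (hfin : ∀ i, ρ (B i) < ∞) (hd : Pairwise fun i j => Disjoint (B i) (B j)) :
    iIndepFun (fun i ω => N ω (B i)) P := by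
  let e := Fintype.equivFin ι
  have h := hN.indep _ (fun j => B (e.symm j)) (fun j => hB _) (fun j => hfin _)
    (fun i j hij => hd (e.symm.injective.ne hij))
  have h2 := h.precomp e.injective
  simpa using h2

/-- Generating functional of a Poisson system for simple functions with values in the unit disc:
the numbers of points in the level sets are independent Poisson variables. -/
lemma tendsto_integral_prod_poissonSystem_simpleFunc [IsProbabilityMeasure P] {κ : Ω → ℕ∞}
    {Z : ℕ → ℝ≥0 → Ω → S} (hκ : Measurable κ) (hZ : ∀ i, Measurable (Z i 0))
    (hN : IsPoissonSystem P (empiricalMeasure κ Z 0) ρ) (g : SimpleFunc S ℂ)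
    (hg : ∀ x, ‖g x‖ ≤ 1) (hgi : Integrable (fun x => g x - 1) ρ) :
    Tendsto (fun n => ∫ ω, ∏ i ∈ Finset.range n, (if (i : ℕ∞) < κ ω then g (Z i 0 ω) else 1) ∂P)
      atTop (𝓝 (Complex.exp (∫ x, (g x - 1) ∂ρ))) := by
  classical
  let R : Finset ℂ := g.range.erase 1
  let B : ℂ → Set S := fun y => g ⁻¹' {y}
  have hB : ∀ y, MeasurableSet (B y) := fun y => g.measurableSet_fiber y
  have hR : ∀ x, g x ≠ 1 ↔ g x ∈ R := fun x => by simp [R]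
  have hBfin : ∀ y : R, ρ (B y) < ∞ := by
    rintro ⟨y, hy⟩
    have hy1 : y ≠ 1 := Finset.ne_of_mem_erase hy
    have h0 : 0 < ‖y - 1‖ := norm_pos_iff.2 (sub_ne_zero.2 hy1)
    refine (measure_mono ?_).trans_lt (hgi.measure_norm_ge_lt_top h0)
    intro x hx
    simp only [B, mem_preimage, mem_singleton_iff] at hx
    simp [hx]
  have hBd : Pairwise fun i j : R => Disjoint (B i) (B j) := fun i j hij =>
    Disjoint.preimage _ (Set.disjoint_singleton.2 (Subtype.coe_injective.ne hij))
  have hind := hN.iIndepFun_fintype (fun y : R => B y) (fun y => hB y) hBfin hBd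
  have hNB : ∀ y ω, empiricalMeasure κ Z 0 ω (B y)
      = ∑' i : ℕ, (if (i : ℕ∞) < κ ω ∧ g (Z i 0 ω) = y then 1 else 0) := by
    intro y ω
    rw [← lintegral_indicator_one (hB y),
      lintegral_empiricalMeasure _ _ _ _ (measurable_one.indicator (hB y))]
    refine tsum_congr fun i => ?_
    by_cases h1 : (i : ℕ∞) < κ ω <;> by_cases h2 : g (Z i 0 ω) = y <;>
      simp [h1, h2, B]
  -- the law of the limit
  have hlim : ∫ ω, ∏ y : R, (y : ℂ) ^ ⌊(empiricalMeasure κ Z 0 ω (B y)).toReal⌋₊ ∂P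
      = Complex.exp (∫ x, (g x - 1) ∂ρ) := by
    have h1 := hind.integral_fun_prod_comp (ι := R)
      (f := fun (y : R) x => (y : ℂ) ^ ⌊(x : ℝ≥0∞).toReal⌋₊)
      (fun y => (hN.law _ (hB y) (hBfin y)).aemeasurable)
      (fun y => Measurable.aestronglyMeasurable
        ((measurable_from_nat (f := fun n => (y : ℂ) ^ n)).comp
          (Nat.measurable_floor.comp ENNReal.measurable_toReal)))
    rw [h1]
    have h2 : ∀ y : R, ∫ ω, (y : ℂ) ^ ⌊(empiricalMeasure κ Z 0 ω (B y)).toReal⌋₊ ∂P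
        = Complex.exp (((y : ℂ) - 1) * (ρ.real (B y) : ℝ)) := by
      intro y
      have hm : Measurable (fun x : ℝ≥0∞ => (y : ℂ) ^ ⌊x.toReal⌋₊) :=
        (measurable_from_nat (f := fun n => (y : ℂ) ^ n)).comp
          (Nat.measurable_floor.comp ENNReal.measurable_toReal)
      have h3 := (hN.law _ (hB y) (hBfin y)).integral_comp hm.aestronglyMeasurable
      refine h3.trans ?_
      rw [integral_map (by fun_prop) hm.aestronglyMeasurable]
      simp only [ENNReal.toReal_natCast, Nat.floor_natCast]
      rw [integral_pow_poissonMeasure]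
      rfl
    rw [Finset.prod_congr rfl fun y _ => h2 y, ← Complex.exp_sum]
    congr 1
    have h4 : ∀ x, g x - 1 = ∑ y : R, (B y).indicator (fun _ => (y : ℂ) - 1) x := by
      intro x
      rw [Finset.sum_coe_sort R (fun y => (B y).indicator (fun _ => y - 1) x)]
      by_cases hx : g x = 1
      · rw [hx, sub_self]
        refine (Finset.sum_eq_zero fun y hy => ?_).symm
        have : y ≠ 1 := Finset.ne_of_mem_erase hy
        simp [B, hx, this.symm]
      · rw [Finset.sum_eq_single (g x)]
        · simp [B]
        · intro y _ hy
          simp [B, hy.symm]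
        · intro h; exact absurd ((hR x).1 hx) h
    simp only [h4]
    rw [integral_finsetSum]
    · refine Finset.sum_congr rfl fun y _ => ?_
      rw [integral_indicator_const _ (hB y), Complex.real_smul, mul_comm]
    · intro y _
      rw [integrable_indicator_iff (hB y)]
      exact integrableOn_const (hBfin y).ne
  rw [← hlim]
  -- almost surely all counts are finite, hence the products are eventually constant
  refine tendsto_integral_of_dominated_convergence (fun _ => (1 : ℝ)) ?_ (integrable_const _) ?_ ?_
  · intro n
    refine (Finset.measurable_fun_prod _ fun i _ => ?_).aestronglyMeasurable
    exact measurable_ite_index_lt hκ i (g.measurable.comp (hZ i)) measurable_const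
  · refine fun n => ae_of_all _ fun ω => ?_
    rw [norm_prod]
    refine Finset.prod_le_one (fun _ _ => norm_nonneg _) fun i _ => ?_
    split_ifs
    · exact hg _
    · simp
  · have hnat : ∀ y : R, ∀ᵐ ω ∂P, ∃ k : ℕ, empiricalMeasure κ Z 0 ω (B y) = k := by
      intro y
      have hl := hN.law _ (hB y) (hBfin y)
      have hms : MeasurableSet (range (Nat.cast : ℕ → ℝ≥0∞)) :=
        (countable_range _).measurableSet
      have h1 : ∀ᵐ x ∂((poissonMeasure (ρ (B y)).toNNReal).map (Nat.cast : ℕ → ℝ≥0∞)),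
          x ∈ range (Nat.cast : ℕ → ℝ≥0∞) := by
        refine (ae_map_iff Measurable.of_discrete.aemeasurable hms).2 ?_
        exact ae_of_all _ fun n => mem_range_self n
      rw [← hl.map_eq] at h1
      have h2 := ae_of_ae_map hl.aemeasurable h1
      filter_upwards [h2] with ω hω
      obtain ⟨k, hk⟩ := hω
      exact ⟨k, hk.symm⟩
    filter_upwards [ae_all_iff.2 hnat] with ω hω
    refine tendsto_const_nhds.congr' ?_
    have hev : ∀ y : R, ∀ᶠ n in atTop, ((Finset.range n).filter
        fun i : ℕ => (i : ℕ∞) < κ ω ∧ g (Z i 0 ω) = y).card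
          = ⌊(empiricalMeasure κ Z 0 ω (B y)).toReal⌋₊ := by
      intro y
      obtain ⟨k, hk⟩ := hω y
      rw [hk, ENNReal.toReal_natCast, Nat.floor_natCast]
      rw [hNB] at hk
      exact eventually_card_filter_range_eq _ hk
    filter_upwards [eventually_all.2 hev] with n hn
    have h5 : ∀ i : ℕ, (if (i : ℕ∞) < κ ω then g (Z i 0 ω) else 1)
        = ∏ y : R, (if (i : ℕ∞) < κ ω ∧ g (Z i 0 ω) = y then (y : ℂ) else 1) := by
      intro i
      rw [Finset.prod_coe_sort R
        (fun y => if (i : ℕ∞) < κ ω ∧ g (Z i 0 ω) = y then (y : ℂ) else 1)]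
      by_cases h1 : (i : ℕ∞) < κ ω
      · simp only [h1, true_and, if_true, Finset.prod_ite_eq]
        split_ifs with h2
        · rfl
        · by_contra h3; exact h2 ((hR _).1 h3)
      · simp [h1]
    rw [Finset.prod_congr rfl fun i _ => h5 i, Finset.prod_comm]
    refine Finset.prod_congr rfl fun y _ => ?_
    rw [← hn y, Finset.prod_ite, Finset.prod_const, Finset.prod_const_one, mul_one]

/-- Generating functional of a Poisson system: the expected partial products of `g` over the
points converge to `exp (∫ (g - 1) dρ)`. -/
lemma tendsto_integral_prod_poissonSystem [SigmaFinite ρ] [IsProbabilityMeasure P] {κ : Ω → ℕ∞}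
    {Z : ℕ → ℝ≥0 → Ω → S} (hκ : Measurable κ) (hZ : ∀ i, Measurable (Z i 0))
    (hN : IsPoissonSystem P (empiricalMeasure κ Z 0) ρ) {g : S → ℂ} (hgm : Measurable g)
    (hg : ∀ x, ‖g x‖ ≤ 1) (hgi : Integrable (fun x => g x - 1) ρ) :
    Tendsto (fun n => ∫ ω, ∏ i ∈ Finset.range n, (if (i : ℕ∞) < κ ω then g (Z i 0 ω) else 1) ∂P)
      atTop (𝓝 (Complex.exp (∫ x, (g x - 1) ∂ρ))) := by
  have h1mem : (1 : ℂ) ∈ Metric.closedBall (0 : ℂ) 1 := by simp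
  -- the approximations stay in the closed unit disc, and the error is controlled in `L¹(ρ)`
  let a : ℕ → SimpleFunc S ℂ := fun m => SimpleFunc.approxOn g hgm _ 1 h1mem m
  have ha : ∀ m x, ‖a m x‖ ≤ 1 := fun m x => by
    have := SimpleFunc.approxOn_mem hgm h1mem m x
    simpa using this
  have hL1 : Tendsto (fun m => ∫⁻ x, ‖a m x - g x‖ₑ ∂ρ) atTop (𝓝 0) :=
    SimpleFunc.tendsto_approxOn_L1_enorm hgm h1mem
      (ae_of_all _ fun x => subset_closure (by simpa using hg x)) hgi.2
  have hai : ∀ᶠ m in atTop, Integrable (fun x => a m x - g x) ρ := by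
    filter_upwards [hL1.eventually_lt_const ENNReal.zero_lt_top] with m hm
    exact ⟨((a m).measurable.sub hgm).aestronglyMeasurable, hm⟩
  have hconv : Tendsto (fun m => Complex.exp (∫ x, (a m x - 1) ∂ρ)) atTop
      (𝓝 (Complex.exp (∫ x, (g x - 1) ∂ρ))) := by
    refine (Complex.continuous_exp.tendsto _).comp ?_
    refine tendsto_integral_of_L1 _ hgi.1 (hai.mono fun m hm => ?_) ?_
    · exact (hm.add hgi).congr (ae_of_all _ fun x => by simp)
    · simpa using hL1
  have hclose : ∀ m n, ‖(∫ ω, ∏ i ∈ Finset.range n,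
        (if (i : ℕ∞) < κ ω then a m (Z i 0 ω) else 1) ∂P)
      - ∫ ω, ∏ i ∈ Finset.range n, (if (i : ℕ∞) < κ ω then g (Z i 0 ω) else 1) ∂P‖ₑ
      ≤ ∫⁻ x, ‖a m x - g x‖ₑ ∂ρ := by
    intro m n
    have hint : ∀ h : S → ℂ, Measurable h → (∀ x, ‖h x‖ ≤ 1) → Integrable (fun ω =>
        ∏ i ∈ Finset.range n, (if (i : ℕ∞) < κ ω then h (Z i 0 ω) else 1)) P := by
      intro h hm hb
      refine Integrable.mono' (integrable_const (1 : ℝ))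
        (Finset.measurable_fun_prod _ fun i _ => ?_).aestronglyMeasurable (ae_of_all _ fun ω => ?_)
      · exact measurable_ite_index_lt hκ i (hm.comp (hZ i)) measurable_const
      · rw [norm_prod]
        refine Finset.prod_le_one (fun _ _ => norm_nonneg _) fun i _ => ?_
        split_ifs
        · exact hb _
        · simp
    rw [← integral_sub (hint _ (a m).measurable (ha m)) (hint _ hgm hg)]
    refine (enorm_integral_le_lintegral_enorm _).trans ?_
    rw [← lintegral_tsum_poissonSystem hκ hZ hN (u := fun x => ‖a m x - g x‖ₑ)
      ((a m).measurable.sub hgm).enorm]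
    refine lintegral_mono fun ω => ?_
    refine le_trans ?_ (ENNReal.sum_le_tsum (Finset.range n))
    have h1 := norm_prod_sub_prod_le_sum (Finset.range n)
      (fun i : ℕ => if (i : ℕ∞) < κ ω then a m (Z i 0 ω) else 1)
      (fun i : ℕ => if (i : ℕ∞) < κ ω then g (Z i 0 ω) else 1)
      (fun i => by split_ifs; exacts [ha _ _, by simp])
      (fun i => by split_ifs; exacts [hg _, by simp])
    rw [← ofReal_norm]
    refine (ENNReal.ofReal_le_ofReal h1).trans ?_
    rw [ENNReal.ofReal_sum_of_nonneg fun _ _ => norm_nonneg _]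
    refine Finset.sum_le_sum fun i _ => ?_
    split_ifs
    · rw [ofReal_norm]
    · simp
  rw [EMetric.tendsto_nhds]
  intro ε hε
  have hε3 : 0 < ε / 3 := ENNReal.div_pos hε.ne' (by norm_num)
  obtain ⟨m, hm1, hm2, hm3⟩ := ((hL1.eventually_lt_const hε3).and
    (hai.and (EMetric.tendsto_nhds.1 hconv _ hε3))).exists
  have hsimple := tendsto_integral_prod_poissonSystem_simpleFunc hκ hZ hN (a m) (ha m)
    ((hm2.add hgi).congr (ae_of_all _ fun x => by simp))
  filter_upwards [EMetric.tendsto_nhds.1 hsimple _ hε3] with n hn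
  have h0 : edist (∫ ω, ∏ i ∈ Finset.range n, (if (i : ℕ∞) < κ ω then g (Z i 0 ω) else 1) ∂P)
      (∫ ω, ∏ i ∈ Finset.range n, (if (i : ℕ∞) < κ ω then a m (Z i 0 ω) else 1) ∂P) < ε / 3 := by
    rw [edist_comm, edist_eq_enorm_sub]
    exact (hclose m n).trans_lt hm1
  exact ((edist_triangle4 _ _ _ _).trans_lt
    (ENNReal.add_lt_add (ENNReal.add_lt_add h0 hn) hm3)).trans_eq (ENNReal.add_thirds ε)

end Poisson

/-! ### Marked Poisson systems -/

section MarkedPoisson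

variable {S Ω E : Type*} [MeasurableSpace S] [MeasurableSpace Ω] [MeasurableSpace E]
  {P : Measure Ω} [IsProbabilityMeasure P] {ρ : Measure S} [SigmaFinite ρ]
  {κ : Ω → ℕ∞} {Z : ℕ → ℝ≥0 → Ω → S} {ξ : ℕ → Ω → E} {Q : Measure E} [IsProbabilityMeasure Q]

/-- Campbell's formula for a Poisson system with independent marks. -/
lemma lintegral_tsum_markedPoisson (hκ : Measurable κ) (hZ : ∀ i, Measurable (Z i 0))
    (hN : IsPoissonSystem P (empiricalMeasure κ Z 0) ρ) (hξ : ∀ i, Measurable (ξ i))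
    (hQ : ∀ i, P.map (ξ i) = Q)
    (hind : IndepFun (fun ω => (κ ω, fun i => Z i 0 ω)) (fun ω i => ξ i ω) P)
    {u : S × E → ℝ≥0∞} (hu : Measurable u) :
    ∫⁻ ω, ∑' i : ℕ, (if (i : ℕ∞) < κ ω then u (Z i 0 ω, ξ i ω) else 0) ∂P
      = ∫⁻ x, u x ∂(ρ.prod Q) := by
  have hA : Measurable (fun ω => (κ ω, fun i => Z i 0 ω)) :=
    hκ.prodMk (measurable_pi_lambda _ hZ)
  have hlt : ∀ i : ℕ, MeasurableSet {a : ℕ∞ × (ℕ → S) | (i : ℕ∞) < a.1} := fun i =>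
    measurable_fst (MeasurableSet.of_discrete (s := Ioi (i : ℕ∞)))
  have hterm : ∀ i : ℕ, ∫⁻ ω, (if (i : ℕ∞) < κ ω then u (Z i 0 ω, ξ i ω) else 0) ∂P
      = ∫⁻ ω, (if (i : ℕ∞) < κ ω then ∫⁻ e, u (Z i 0 ω, e) ∂Q else 0) ∂P := by
    intro i
    have hi : IndepFun (fun ω => (κ ω, fun i => Z i 0 ω)) (ξ i) P :=
      hind.comp measurable_id (measurable_pi_apply i)
    rw [indepFun_iff_map_prod_eq_prod_map_map hA.aemeasurable (hξ i).aemeasurable, hQ i] at hi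
    have hm : Measurable (fun p : (ℕ∞ × (ℕ → S)) × E =>
        if (i : ℕ∞) < p.1.1 then u (p.1.2 i, p.2) else 0) :=
      Measurable.ite (measurable_fst (hlt i)) (hu.comp (by fun_prop)) measurable_const
    have h1 := lintegral_map (μ := P) hm (hA.prodMk (hξ i))
    rw [hi, lintegral_prod _ hm.aemeasurable, lintegral_map hm.lintegral_prod_right' hA] at h1
    refine h1.symm.trans (lintegral_congr fun ω => ?_)
    split_ifs <;> simp
  have hm1 : ∀ i : ℕ, AEMeasurable
      (fun ω => if (i : ℕ∞) < κ ω then u (Z i 0 ω, ξ i ω) else 0) P := fun i =>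
    (measurable_ite_index_lt hκ i (hu.comp ((hZ i).prodMk (hξ i))) measurable_const).aemeasurable
  have hm2 : ∀ i : ℕ, AEMeasurable
      (fun ω => if (i : ℕ∞) < κ ω then ∫⁻ e, u (Z i 0 ω, e) ∂Q else 0) P := fun i =>
    (measurable_ite_index_lt hκ i (hu.lintegral_prod_right'.comp (hZ i))
      measurable_const).aemeasurable
  rw [lintegral_tsum hm1, tsum_congr hterm, ← lintegral_tsum hm2,
    lintegral_tsum_poissonSystem hκ hZ hN hu.lintegral_prod_right', lintegral_prod _ hu.aemeasurable]

/-- Characteristic functional of finitely many marked points: the marks can be integrated out. -/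
lemma integral_cexp_sum_range_markedPoisson (hκ : Measurable κ) (hZ : ∀ i, Measurable (Z i 0))
    (hξ : ∀ i, Measurable (ξ i)) (hQ : ∀ i, P.map (ξ i) = Q) (hξi : iIndepFun ξ P)
    (hind : IndepFun (fun ω => (κ ω, fun i => Z i 0 ω)) (fun ω i => ξ i ω) P)
    {F : S × E → ℝ} (hF : Measurable F) (n : ℕ) :
    ∫ ω, Complex.exp ((∑ i ∈ Finset.range n,
        (if ((i : ℕ) : ℕ∞) < κ ω then F (Z i 0 ω, ξ i ω) else 0) : ℝ) * Complex.I) ∂P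
      = ∫ ω, ∏ i ∈ Finset.range n, (if ((i : ℕ) : ℕ∞) < κ ω then
          ∫ e, Complex.exp (F (Z i 0 ω, e) * Complex.I) ∂Q else 1) ∂P := by
  have hA : Measurable (fun ω => (κ ω, fun i => Z i 0 ω)) :=
    hκ.prodMk (measurable_pi_lambda _ hZ)
  have hlt : ∀ i : ℕ, MeasurableSet {a : ℕ∞ × (ℕ → S) | (i : ℕ∞) < a.1} := fun i =>
    measurable_fst (MeasurableSet.of_discrete (s := Ioi (i : ℕ∞)))
  have hξm : Measurable (fun ω i => ξ i ω) := measurable_pi_lambda _ hξ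
  rw [indepFun_iff_map_prod_eq_prod_map_map hA.aemeasurable hξm.aemeasurable] at hind
  let h : ℕ → (ℕ∞ × (ℕ → S)) → E → ℂ := fun i a e =>
    if (i : ℕ∞) < a.1 then Complex.exp (F (a.2 i, e) * Complex.I) else 1
  have hhm : ∀ i, Measurable (fun p : (ℕ∞ × (ℕ → S)) × (ℕ → E) => h i p.1 (p.2 i)) := by
    intro i
    refine Measurable.ite (measurable_fst (hlt i)) ?_ measurable_const
    exact Complex.measurable_exp.comp ((Complex.measurable_ofReal.comp
      (hF.comp (by fun_prop))).mul_const _)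
  have hhm' : ∀ i a, Measurable (h i a) := by
    intro i a
    by_cases hc : (i : ℕ∞) < a.1
    · simp only [h, hc, if_true]
      exact Complex.measurable_exp.comp ((Complex.measurable_ofReal.comp
        (hF.comp (by fun_prop))).mul_const _)
    · simp only [h, hc, if_false]; exact measurable_const
  let H : (ℕ∞ × (ℕ → S)) × (ℕ → E) → ℂ := fun p => ∏ i ∈ Finset.range n, h i p.1 (p.2 i)
  have hHm : Measurable H := Finset.measurable_fun_prod _ fun i _ => hhm i
  have hHb : ∀ p, ‖H p‖ ≤ 1 := by
    intro p
    rw [norm_prod]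
    refine Finset.prod_le_one (fun _ _ => norm_nonneg _) fun i _ => ?_
    simp only [h]
    split_ifs
    · rw [Complex.norm_exp_ofReal_mul_I]
    · simp
  have hpA : IsProbabilityMeasure (P.map (fun ω => (κ ω, fun i => Z i 0 ω))) :=
    Measure.isProbabilityMeasure_map hA.aemeasurable
  have hpξ : IsProbabilityMeasure (P.map (fun ω i => ξ i ω)) :=
    Measure.isProbabilityMeasure_map hξm.aemeasurable
  have h1 : ∫ ω, H ((κ ω, fun i => Z i 0 ω), fun i => ξ i ω) ∂P
      = ∫ ω, (∫ e, H ((κ ω, fun i => Z i 0 ω), e) ∂(P.map (fun ω i => ξ i ω))) ∂P := by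
    rw [← integral_map (φ := fun ω => ((κ ω, fun i => Z i 0 ω), fun i => ξ i ω))
      (hA.prodMk hξm).aemeasurable hHm.aestronglyMeasurable, hind, integral_prod,
      integral_map hA.aemeasurable]
    · exact (hHm.stronglyMeasurable.integral_prod_right').aestronglyMeasurable
    · exact Integrable.mono' (integrable_const (1 : ℝ)) hHm.aestronglyMeasurable
        (ae_of_all _ hHb)
  refine Eq.trans ?_ (h1.trans ?_)
  · congr 1
    ext ω
    simp only [H, h]
    rw [Complex.ofReal_sum, Finset.sum_mul, Complex.exp_sum]
    refine Finset.prod_congr rfl fun i _ => ?_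
    split_ifs <;> simp
  · congr 1
    ext ω
    set a : ℕ∞ × (ℕ → S) := (κ ω, fun i => Z i 0 ω) with ha
    rw [integral_map (f := fun e => H (a, e)) hξm.aemeasurable
      (hHm.comp (measurable_const.prodMk measurable_id)).aestronglyMeasurable]
    have hξn : iIndepFun (fun i : Finset.range n => ξ i) P := hξi.precomp Subtype.val_injective
    have h2 := hξn.integral_fun_prod_comp (ι := Finset.range n) (f := fun i e => h i a e)
      (fun i => (hξ i).aemeasurable) (fun i => (hhm' i a).aestronglyMeasurable)
    have h3 : ∀ ω', H (a, fun i => ξ i ω') = ∏ i : Finset.range n, h i a (ξ i ω') := fun ω' =>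
      (Finset.prod_coe_sort (Finset.range n) (fun i => h i a (ξ i ω'))).symm
    simp only [h3]
    rw [h2, Finset.prod_coe_sort (Finset.range n) (fun i => ∫ ω, h i a (ξ i ω) ∂P)]
    refine Finset.prod_congr rfl fun i _ => ?_
    rw [← integral_map (f := h i a) (hξ i).aemeasurable (hhm' i a).aestronglyMeasurable, hQ i]
    by_cases hc : (i : ℕ∞) < κ ω
    · simp [h, a, hc]
    · simp [h, a, hc]

/-- Characteristic functional of a Poisson system with independent marks. -/
lemma integral_cexp_tsum_markedPoisson (hκ : Measurable κ) (hZ : ∀ i, Measurable (Z i 0))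
    (hN : IsPoissonSystem P (empiricalMeasure κ Z 0) ρ)
    (hξ : ∀ i, Measurable (ξ i)) (hQ : ∀ i, P.map (ξ i) = Q) (hξi : iIndepFun ξ P)
    (hind : IndepFun (fun ω => (κ ω, fun i => Z i 0 ω)) (fun ω i => ξ i ω) P)
    {F : S × E → ℝ} (hF : Measurable F) (hFi : Integrable F (ρ.prod Q)) :
    (∀ᵐ ω ∂P, Summable fun i : ℕ => (if (i : ℕ∞) < κ ω then F (Z i 0 ω, ξ i ω) else 0)) ∧
    ∫ ω, Complex.exp ((∑' i : ℕ,
        (if (i : ℕ∞) < κ ω then F (Z i 0 ω, ξ i ω) else 0) : ℝ) * Complex.I) ∂P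
      = Complex.exp (∫ p, (Complex.exp (F p * Complex.I) - 1) ∂(ρ.prod Q)) := by
  have hsum : ∀ᵐ ω ∂P, Summable fun i : ℕ =>
      (if (i : ℕ∞) < κ ω then F (Z i 0 ω, ξ i ω) else 0) := by
    have h1 := lintegral_tsum_markedPoisson hκ hZ hN hξ hQ hind hF.enorm
    have h2 : ∀ᵐ ω ∂P, ∑' i : ℕ, (if (i : ℕ∞) < κ ω then ‖F (Z i 0 ω, ξ i ω)‖ₑ else 0) < ∞ := by
      refine ae_lt_top (Measurable.tsum fun i => ?_) (h1.trans_lt hFi.2).ne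
      exact measurable_ite_index_lt hκ i (hF.enorm.comp ((hZ i).prodMk (hξ i))) measurable_const
    filter_upwards [h2] with ω hω
    refine Summable.of_enorm (lt_of_le_of_lt (le_of_eq ?_) hω).ne
    refine tsum_congr fun i => ?_
    split_ifs <;> simp
  refine ⟨hsum, ?_⟩
  have hem : Measurable (fun p : S × E => Complex.exp (F p * Complex.I)) :=
    Complex.measurable_exp.comp ((Complex.measurable_ofReal.comp hF).mul_const _)
  have hei : Integrable (fun p : S × E => Complex.exp (F p * Complex.I) - 1) (ρ.prod Q) := by
    refine hFi.norm.mono' (hem.sub_const 1).aestronglyMeasurable (ae_of_all _ fun p => ?_)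
    exact norm_cexp_sub_one_le _
  have hQi : ∀ x, Integrable (fun e => Complex.exp (F (x, e) * Complex.I)) Q := fun x =>
    Integrable.mono' (integrable_const (1 : ℝ))
      (hem.comp (measurable_const.prodMk measurable_id)).aestronglyMeasurable
      (ae_of_all _ fun e => by rw [Complex.norm_exp_ofReal_mul_I])
  have hg1 : ∀ x, (∫ e, Complex.exp (F (x, e) * Complex.I) ∂Q) - 1
      = ∫ e, (Complex.exp (F (x, e) * Complex.I) - 1) ∂Q := by
    intro x
    rw [integral_sub (hQi x) (integrable_const _)]
    simp
  have hlim := tendsto_integral_prod_poissonSystem hκ hZ hN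
    (g := fun x => ∫ e, Complex.exp (F (x, e) * Complex.I) ∂Q)
    (hem.stronglyMeasurable.integral_prod_right').measurable
    (fun x => by
      refine (norm_integral_le_integral_norm _).trans ?_
      simp [Complex.norm_exp_ofReal_mul_I])
    (by simp only [hg1]; exact hei.integral_prod_left)
  -- integrating out the marks turns the points into an unmarked system with weights `g`
  simp only [hg1] at hlim
  rw [← integral_prod _ hei] at hlim
  refine tendsto_nhds_unique ?_ hlim
  simp only [← integral_cexp_sum_range_markedPoisson hκ hZ hξ hQ hξi hind hF]
  refine tendsto_integral_of_dominated_convergence (fun _ => (1 : ℝ)) ?_ (integrable_const _) ?_ ?_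
  · intro n
    refine (Complex.measurable_exp.comp ((Complex.measurable_ofReal.comp
      (Finset.measurable_fun_sum _ fun i _ => ?_)).mul_const _)).aestronglyMeasurable
    exact measurable_ite_index_lt hκ i (hF.comp ((hZ i).prodMk (hξ i))) measurable_const
  · exact fun n => ae_of_all _ fun ω => by rw [Complex.norm_exp_ofReal_mul_I]
  · filter_upwards [hsum] with ω hω
    have h3 := hω.hasSum.tendsto_sum_nat
    have hc : Continuous (fun x : ℝ => Complex.exp (x * Complex.I)) := by fun_prop
    exact (hc.tendsto _).comp h3

end MarkedPoisson

/-! ### Path laws of the motion -/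

section Motion

/-- This makes the set of convergence of a sequence of measurable `S`-valued maps measurable. -/
lemma isCompletelyMetrizableSpace_of_locallyCompact_addCommGroup (S : Type*) [AddCommGroup S]
    [TopologicalSpace S] [IsTopologicalAddGroup S] [LocallyCompactSpace S] [T2Space S]
    [SecondCountableTopology S] : TopologicalSpace.IsCompletelyMetrizableSpace S := by
  let u := IsTopologicalAddGroup.rightUniformSpace S
  have : IsUniformAddGroup S := isUniformAddGroup_of_addCommGroup
  have := IsUniformAddGroup.uniformity_countably_generated (α := S)
  have hc : CompleteSpace S := IsRightUniformAddGroup.completeSpace_of_weaklyLocallyCompactSpace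
  let m : MetricSpace S := UniformSpace.metricSpace S
  exact MetricSpace.toIsCompletelyMetrizableSpace

/-- The grid points `(⌊(n+1)s⌋+1)/(n+1)`, which decrease to `s` from the right. -/
def rightGrid (n : ℕ) (s : ℝ≥0) : ℝ≥0 := ((⌊((n : ℝ≥0) + 1) * s⌋₊ : ℝ≥0) + 1) / ((n : ℝ≥0) + 1)

lemma le_rightGrid (n : ℕ) (s : ℝ≥0) : s ≤ rightGrid n s := by
  rw [rightGrid, le_div_iff₀ (by positivity), mul_comm]
  exact (Nat.lt_floor_add_one _).le

lemma tendsto_rightGrid (s : ℝ≥0) : Tendsto (fun n => rightGrid n s) atTop (𝓝[≥] s) := by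
  refine tendsto_nhdsWithin_iff.2 ⟨?_, Eventually.of_forall fun n => le_rightGrid n s⟩
  have h1 : ∀ n : ℕ, rightGrid n s ≤ s + 1 / ((n : ℝ≥0) + 1) := by
    intro n
    have hn : (0 : ℝ≥0) < (n : ℝ≥0) + 1 := by positivity
    have h3 : (s + 1 / ((n : ℝ≥0) + 1)) * ((n : ℝ≥0) + 1) = ((n : ℝ≥0) + 1) * s + 1 := by
      field_simp
    rw [rightGrid, div_le_iff₀ hn, h3]
    gcongr
    exact Nat.floor_le (by positivity)
  have h2 : Tendsto (fun n : ℕ => s + 1 / ((n : ℝ≥0) + 1)) atTop (𝓝 (s + 0)) :=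
    tendsto_const_nhds.add tendsto_one_div_add_atTop_nhds_zero_nat
  rw [add_zero] at h2
  exact tendsto_of_tendsto_of_tendsto_of_le_of_le tendsto_const_nhds h2
    (fun n => le_rightGrid n s) h1

variable {S : Type*} [AddCommGroup S] [TopologicalSpace S] [IsTopologicalAddGroup S]
    [LocallyCompactSpace S] [T2Space S] [SecondCountableTopology S]
    [MeasurableSpace S] [BorelSpace S]

/-- Evaluation of a path through right limits along the grid. It agrees with the path at
right-continuous paths and, unlike plain evaluation, is jointly measurable in time and path. -/
def regEval (s : ℝ≥0) (w : ℝ≥0 → S) : S := limUnder atTop fun n => w (rightGrid n s)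

lemma regEval_eq {w : ℝ≥0 → S} {s : ℝ≥0} (hw : ContinuousWithinAt w (Ici s) s) :
    regEval s w = w s :=
  (hw.tendsto.comp (tendsto_rightGrid s)).limUnder_eq

lemma measurable_regEval : Measurable fun p : ℝ≥0 × (ℝ≥0 → S) => regEval p.1 p.2 := by
  have := isCompletelyMetrizableSpace_of_locallyCompact_addCommGroup S
  refine (StronglyMeasurable.limUnder fun n => Measurable.stronglyMeasurable ?_).measurable
  -- for each `n` only countably many times are used
  have h1 : Measurable fun q : ℕ × (ℝ≥0 → S) => q.2 (((q.1 : ℝ≥0) + 1) / ((n : ℝ≥0) + 1)) :=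
    measurable_from_prod_countable_right fun k =>
      measurable_pi_apply (((k : ℝ≥0) + 1) / ((n : ℝ≥0) + 1))
  exact h1.comp ((Nat.measurable_floor.comp (measurable_fst.const_mul ((n : ℝ≥0) + 1))).prodMk
    measurable_snd)

variable {Ω : Type*} [MeasurableSpace Ω]

/-- The law of the increment `W_s - W_0`. -/
def stepLaw (P : Measure Ω) (W : ℝ≥0 → Ω → S) (s : ℝ≥0) : Measure S :=
  P.map fun ω => W s ω - W 0 ω

/-- The law of the path `W - W_0`. -/
def motionLaw (P : Measure Ω) (W : ℝ≥0 → Ω → S) : Measure (ℝ≥0 → S) :=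
  P.map fun ω t => W t ω - W 0 ω

variable {ρ : Measure S} {P : Measure Ω} [IsProbabilityMeasure P] {W : ℝ≥0 → Ω → S}

lemma IsParticleMotion.measurable_increment (hW : IsParticleMotion ρ P W) (s t : ℝ≥0) :
    Measurable fun ω => W s ω - W t ω :=
  (hW.measurable s).sub (hW.measurable t)

lemma IsParticleMotion.measurable_path (hW : IsParticleMotion ρ P W) :
    Measurable fun ω t => W t ω - W 0 ω :=
  measurable_pi_lambda _ fun t => hW.measurable_increment t 0

lemma IsParticleMotion.isProbabilityMeasure_stepLaw (hW : IsParticleMotion ρ P W) (s : ℝ≥0) :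
    IsProbabilityMeasure (stepLaw P W s) :=
  Measure.isProbabilityMeasure_map (hW.measurable_increment s 0).aemeasurable

lemma IsParticleMotion.isProbabilityMeasure_motionLaw (hW : IsParticleMotion ρ P W) :
    IsProbabilityMeasure (motionLaw P W) :=
  Measure.isProbabilityMeasure_map hW.measurable_path.aemeasurable

lemma IsParticleMotion.map_sub_eq (hW : IsParticleMotion ρ P W) {r s : ℝ≥0} (hrs : r ≤ s) :
    P.map (fun ω => W s ω - W r ω) = stepLaw P W (s - r) := by
  have := (hW.stationary_increments r (s - r)).map_eq
  rwa [add_tsub_cancel_of_le hrs] at this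

lemma stepLaw_zero : stepLaw P W 0 = Measure.dirac 0 := by
  simp [stepLaw, Measure.map_const]

/-- The finite-dimensional distributions of the motion at three ordered times. -/
lemma IsParticleMotion.lintegral_increments (hW : IsParticleMotion ρ P W) {r s u : ℝ≥0}
    (hrs : r ≤ s) (hsu : s ≤ u) {G : S × S × S → ℝ≥0∞} (hG : Measurable G) :
    ∫⁻ ω, G (W r ω - W 0 ω, W s ω - W 0 ω, W u ω - W 0 ω) ∂P
      = ∫⁻ a, ∫⁻ b, ∫⁻ c, G (a, a + b, a + b + c) ∂(stepLaw P W (u - s))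
          ∂(stepLaw P W (s - r)) ∂(stepLaw P W r) := by
  have hi := hW.indep_increments 3 ![0, r, s, u] (by
    rw [Fin.monotone_iff_le_succ]
    intro i
    fin_cases i <;> simp [hrs, hsu])
  have hm : ∀ i : Fin 3, Measurable (fun ω => W (![0, r, s, u] i.succ) ω
      - W (![0, r, s, u] i.castSucc) ω) := fun i => hW.measurable_increment _ _
  have h01 := hi.indepFun (i := 0) (j := 1) (by decide)
  have h2 := hi.indepFun_prodMk hm 0 1 2 (by decide) (by decide)
  rw [indepFun_iff_map_prod_eq_prod_map_map (hm 0).aemeasurable (hm 1).aemeasurable] at h01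
  rw [indepFun_iff_map_prod_eq_prod_map_map ((hm 0).prodMk (hm 1)).aemeasurable
    (hm 2).aemeasurable, h01] at h2
  have e0 : P.map (fun ω => W (![0, r, s, u] (0 : Fin 3).succ) ω
      - W (![0, r, s, u] (0 : Fin 3).castSucc) ω) = stepLaw P W r := rfl
  have e1 : P.map (fun ω => W (![0, r, s, u] (1 : Fin 3).succ) ω
      - W (![0, r, s, u] (1 : Fin 3).castSucc) ω) = stepLaw P W (s - r) := hW.map_sub_eq hrs
  have e2 : P.map (fun ω => W (![0, r, s, u] (2 : Fin 3).succ) ω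
      - W (![0, r, s, u] (2 : Fin 3).castSucc) ω) = stepLaw P W (u - s) := hW.map_sub_eq hsu
  rw [e0, e1, e2] at h2
  have hp := fun t => hW.isProbabilityMeasure_stepLaw t
  let G' : (S × S) × S → ℝ≥0∞ := fun p => G (p.1.1, p.1.1 + p.1.2, p.1.1 + p.1.2 + p.2)
  have hG' : Measurable G' := hG.comp (by fun_prop)
  have h3 := lintegral_map (μ := P) hG' (((hm 0).prodMk (hm 1)).prodMk (hm 2))
  rw [h2, lintegral_prod _ hG'.aemeasurable,
    lintegral_prod _ hG'.lintegral_prod_right'.aemeasurable] at h3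
  rw [h3]
  refine lintegral_congr fun ω => ?_
  change _ = G (W r ω - W 0 ω, (W r ω - W 0 ω) + (W s ω - W r ω),
    (W r ω - W 0 ω) + (W s ω - W r ω) + (W u ω - W s ω))
  congr 2
  congr 1 <;> abel

/-- The semigroup property of the increment laws. -/
lemma IsParticleMotion.lintegral_stepLaw_add (hW : IsParticleMotion ρ P W) (s r : ℝ≥0)
    {g : S → ℝ≥0∞} (hg : Measurable g) :
    ∫⁻ y, g y ∂(stepLaw P W (s + r))
      = ∫⁻ a, ∫⁻ b, g (a + b) ∂(stepLaw P W r) ∂(stepLaw P W s) := by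
  have h := hW.lintegral_increments (le_refl s) (le_add_right (le_refl s) : s ≤ s + r)
    (G := fun p => g p.2.2) (hg.comp (by fun_prop))
  rw [stepLaw, lintegral_map hg (hW.measurable_increment _ _), h]
  simp only [tsub_self, add_tsub_cancel_left, stepLaw_zero]
  refine lintegral_congr fun a => ?_
  rw [lintegral_dirac']
  · simp
  · have := hW.isProbabilityMeasure_stepLaw r
    exact Measurable.lintegral_prod_right' (f := fun p : S × S => g (a + p.1 + p.2))
      (hg.comp (by fun_prop))

/-- The increment laws are symmetric. -/
lemma IsParticleMotion.map_neg_stepLaw [ρ.IsAddHaarMeasure] (hW : IsParticleMotion ρ P W)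
    (s : ℝ≥0) : (stepLaw P W s).map (fun x => -x) = stepLaw P W s := by
  rcases eq_or_lt_of_le (zero_le (a := s)) with rfl | hs
  · rw [stepLaw_zero, Measure.map_dirac' measurable_neg]
    simp
  · obtain ⟨p, hp, -, hsymm, hlaw⟩ := hW.density s hs
    change (P.map _).map _ = P.map _
    rw [hlaw]
    ext B hB
    rw [Measure.map_apply measurable_neg hB, withDensity_apply _ (measurable_neg hB),
      withDensity_apply _ hB, ← lintegral_indicator (measurable_neg hB), ← lintegral_indicator hB]
    rw [← lintegral_neg_eq_self]
    refine lintegral_congr fun x => ?_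
    by_cases hx : x ∈ B
    · simp [hx, hsymm]
    · simp [hx]

/-- Strict positivity of the transition densities: a set that is null for an increment law is null
for Haar measure. -/
lemma IsParticleMotion.absolutelyContinuous_stepLaw (hW : IsParticleMotion ρ P W)
    {s : ℝ≥0} (hs : 0 < s) : ρ ≪ stepLaw P W s := by
  obtain ⟨p, hp, hpos, -, hlaw⟩ := hW.density s hs
  rw [stepLaw, hlaw]
  exact withDensity_absolutelyContinuous' (by fun_prop)
    (ae_of_all _ fun x => by simpa using hpos x)

lemma IsParticleMotion.ae_regEval_path (hW : IsParticleMotion ρ P W) :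
    ∀ᵐ ω ∂P, ∀ s, regEval s (fun t => W t ω - W 0 ω) = W s ω - W 0 ω := by
  filter_upwards [hW.cadlag] with ω hω s
  exact regEval_eq (w := fun t => W t ω - W 0 ω) ((hω s).1.sub continuousWithinAt_const)

/-- Three-point expectations under the path law. -/
lemma IsParticleMotion.lintegral_motionLaw (hW : IsParticleMotion ρ P W) {r s u : ℝ≥0}
    (hrs : r ≤ s) (hsu : s ≤ u) {G : S × S × S → ℝ≥0∞} (hG : Measurable G) :
    ∫⁻ w, G (regEval r w, regEval s w, regEval u w) ∂(motionLaw P W)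
      = ∫⁻ a, ∫⁻ b, ∫⁻ c, G (a, a + b, a + b + c) ∂(stepLaw P W (u - s))
          ∂(stepLaw P W (s - r)) ∂(stepLaw P W r) := by
  have hR : ∀ t, Measurable fun w : ℝ≥0 → S => regEval t w := fun t =>
    measurable_regEval.comp (measurable_const.prodMk measurable_id)
  rw [← hW.lintegral_increments hrs hsu hG, motionLaw,
    lintegral_map (f := fun w => G (regEval r w, regEval s w, regEval u w))
      (hG.comp ((hR r).prodMk ((hR s).prodMk (hR u)))) hW.measurable_path]
  refine lintegral_congr_ae ?_
  filter_upwards [hW.ae_regEval_path] with ω hω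
  rw [hω, hω, hω]

lemma IsParticleMotion.map_regEval_motionLaw (hW : IsParticleMotion ρ P W) (s : ℝ≥0) :
    (motionLaw P W).map (regEval s) = stepLaw P W s := by
  have hR : Measurable fun w : ℝ≥0 → S => regEval s w :=
    measurable_regEval.comp (measurable_const.prodMk measurable_id)
  rw [motionLaw, Measure.map_map hR hW.measurable_path]
  refine Measure.map_congr ?_
  filter_upwards [hW.ae_regEval_path] with ω hω
  exact hω s

end Motion

/-! ### Ordered time integrals -/

section OrderedIntegrals

variable {μ : Measure ℝ} [SFinite μ]

/-- Integrating a symmetric kernel over the square is twice integrating it below the diagonal. -/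
lemma lintegral_lintegral_eq_two_mul_Iio [NullSingletonClass μ] {K : ℝ → ℝ → ℝ≥0∞}
    (hK : Measurable fun p : ℝ × ℝ => K p.1 p.2) (hsymm : ∀ r s, K r s = K s r) :
    ∫⁻ r, ∫⁻ s, K r s ∂μ ∂μ = 2 * ∫⁻ r, ∫⁻ s in Iio r, K r s ∂μ ∂μ := by
  have hm : ∀ A : Set (ℝ × ℝ), MeasurableSet A →
      Measurable fun p : ℝ × ℝ => A.indicator (fun p => K p.1 p.2) p := fun A hA =>
    hK.indicator hA
  have hI : ∀ r, ∫⁻ s in Iio r, K r s ∂μ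
      = ∫⁻ s, {p : ℝ × ℝ | p.2 < p.1}.indicator (fun p => K p.1 p.2) (r, s) ∂μ := fun r => by
    rw [← lintegral_indicator measurableSet_Iio]; rfl
  have hJ : ∀ r, ∫⁻ s in Ioi r, K r s ∂μ
      = ∫⁻ s, {p : ℝ × ℝ | p.1 < p.2}.indicator (fun p => K p.1 p.2) (r, s) ∂μ := fun r => by
    rw [← lintegral_indicator measurableSet_Ioi]; rfl
  have hlt1 : MeasurableSet {p : ℝ × ℝ | p.2 < p.1} := measurableSet_lt measurable_snd measurable_fst
  have hlt2 : MeasurableSet {p : ℝ × ℝ | p.1 < p.2} := measurableSet_lt measurable_fst measurable_snd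
  have hsplit : ∀ r, ∫⁻ s, K r s ∂μ
      = (∫⁻ s in Iio r, K r s ∂μ) + ∫⁻ s in Ioi r, K r s ∂μ := by
    intro r
    rw [← lintegral_add_compl _ (measurableSet_Iio (a := r)), compl_Iio]
    congr 1
    exact setLIntegral_congr Ioi_ae_eq_Ici.symm
  have hswap : ∫⁻ r, ∫⁻ s in Ioi r, K r s ∂μ ∂μ = ∫⁻ r, ∫⁻ s in Iio r, K r s ∂μ ∂μ := by
    simp only [hI, hJ]
    rw [lintegral_lintegral_swap (hm _ hlt2).aemeasurable]
    refine lintegral_congr fun r => lintegral_congr fun s => ?_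
    simp only [indicator_apply, mem_ofPred_eq]
    rw [hsymm]
  simp only [hsplit]
  rw [lintegral_add_left, hswap, two_mul]
  simp only [hI]
  exact (hm _ hlt1).lintegral_prod_right'

/-- Ordering the largest variable last: a cube is bounded by an ordered triple integral. -/
lemma lintegral_cube_le {q : ℝ → ℝ≥0∞} (hq : Measurable q) :
    (∫⁻ s, q s ∂μ) ^ 3
      ≤ 4 * ∫⁻ r, ∫⁻ s, ∫⁻ u in Ici (max r s), q r * q s * q u ∂μ ∂μ ∂μ := by
  set L := ∫⁻ s, q s ∂μ with hL
  let J : ℝ → ℝ≥0∞ := fun u => ∫⁻ r in Iic u, q r ∂μ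
  have hle : MeasurableSet {p : ℝ × ℝ | p.1 ≤ p.2} := measurableSet_le measurable_fst measurable_snd
  have hJ : ∀ u, J u = ∫⁻ r, {p : ℝ × ℝ | p.1 ≤ p.2}.indicator (fun p => q p.1) (r, u) ∂μ := fun u => by
    simp only [J]; rw [← lintegral_indicator measurableSet_Iic]; rfl
  have hJm : Measurable J := by
    have h1 : Measurable fun p : ℝ × ℝ => {p : ℝ × ℝ | p.1 ≤ p.2}.indicator (fun p => q p.1) p :=
      (hq.comp measurable_fst).indicator hle
    have h2 := h1.lintegral_prod_left' (μ := μ)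
    simpa only [← hJ] using h2
  have hJmono : Monotone J := fun a b hab => lintegral_mono_set (Iic_subset_Iic.2 hab)
  -- one variable is the larger one
  have key : ∀ k : ℝ → ℝ≥0∞, Measurable k →
      (∫⁻ r, k r ∂μ) * L ≤ (∫⁻ r, k r * J r ∂μ) + ∫⁻ u, q u * (∫⁻ r in Iic u, k r ∂μ) ∂μ := by
    intro k hk
    have h1 : ∀ r, k r * L ≤ k r * J r + k r * ∫⁻ u in Ici r, q u ∂μ := by
      intro r
      rw [← mul_add]
      gcongr
      rw [hL, ← lintegral_add_compl _ (measurableSet_Iic (a := r)), compl_Iic]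
      gcongr
      exact Ioi_subset_Ici_self
    have h2 : ∫⁻ r, k r * ∫⁻ u in Ici r, q u ∂μ ∂μ = ∫⁻ u, q u * (∫⁻ r in Iic u, k r ∂μ) ∂μ := by
      have e1 : ∀ r, k r * ∫⁻ u in Ici r, q u ∂μ
          = ∫⁻ u, {p : ℝ × ℝ | p.1 ≤ p.2}.indicator (fun p => k p.1 * q p.2) (r, u) ∂μ := by
        intro r
        rw [← lintegral_const_mul _ hq, ← lintegral_indicator measurableSet_Ici]; rfl
      have e2 : ∀ u, q u * (∫⁻ r in Iic u, k r ∂μ)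
          = ∫⁻ r, {p : ℝ × ℝ | p.1 ≤ p.2}.indicator (fun p => k p.1 * q p.2) (r, u) ∂μ := by
        intro u
        rw [← lintegral_const_mul _ hk, ← lintegral_indicator measurableSet_Iic]
        refine lintegral_congr fun r => ?_
        simp only [indicator_apply, mem_Iic, mem_ofPred_eq, mul_comm]
      simp only [e1, e2]
      rw [lintegral_lintegral_swap]
      exact (((hk.comp measurable_fst).mul (hq.comp measurable_snd)).indicator hle).aemeasurable
    calc (∫⁻ r, k r ∂μ) * L = ∫⁻ r, k r * L ∂μ := (lintegral_mul_const _ hk).symm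
      _ ≤ ∫⁻ r, (k r * J r + k r * ∫⁻ u in Ici r, q u ∂μ) ∂μ := lintegral_mono h1
      _ = (∫⁻ r, k r * J r ∂μ) + ∫⁻ u, q u * (∫⁻ r in Iic u, k r ∂μ) ∂μ := by
          rw [lintegral_add_left (f := fun r => k r * J r) (hk.mul hJm), h2]
  have hsq : L * L ≤ 2 * ∫⁻ r, q r * J r ∂μ := by
    refine (key q hq).trans_eq ?_
    rw [two_mul]
  have hcube : L ^ 3 ≤ 4 * ∫⁻ u, q u * (J u * J u) ∂μ := by
    calc L ^ 3 = (L * L) * L := by ring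
      _ ≤ (2 * ∫⁻ r, q r * J r ∂μ) * L := by gcongr
      _ = 2 * ((∫⁻ r, q r * J r ∂μ) * L) := by ring
      _ ≤ 2 * ((∫⁻ r, q r * J r * J r ∂μ) + ∫⁻ u, q u * (∫⁻ r in Iic u, q r * J r ∂μ) ∂μ) := by
          gcongr; exact key _ (hq.mul hJm)
      _ ≤ 2 * ((∫⁻ u, q u * (J u * J u) ∂μ) + ∫⁻ u, q u * (J u * J u) ∂μ) := by
          refine mul_le_mul_right (add_le_add (lintegral_mono fun r => ?_)
            (lintegral_mono fun u => ?_)) 2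
          · rw [mul_assoc]
          · refine mul_le_mul_right ?_ (q u)
            calc ∫⁻ r in Iic u, q r * J r ∂μ ≤ ∫⁻ r in Iic u, q r * J u ∂μ := by
                  refine setLIntegral_mono' measurableSet_Iic fun r hr => ?_
                  gcongr; exact hJmono hr
              _ = J u * J u := lintegral_mul_const _ hq
      _ = 4 * ∫⁻ u, q u * (J u * J u) ∂μ := by ring
  refine hcube.trans_eq ?_
  congr 1
  -- move the integration over the largest variable inside
  have hA : MeasurableSet {p : (ℝ × ℝ) × ℝ | p.1.1 ≤ p.2 ∧ p.1.2 ≤ p.2} :=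
    (measurableSet_le (f := fun p : (ℝ × ℝ) × ℝ => p.1.1) (g := fun p => p.2)
      (by fun_prop) (by fun_prop)).inter
    (measurableSet_le (f := fun p : (ℝ × ℝ) × ℝ => p.1.2) (g := fun p => p.2)
      (by fun_prop) (by fun_prop))
  let Φ : (ℝ × ℝ) × ℝ → ℝ≥0∞ := {p : (ℝ × ℝ) × ℝ | p.1.1 ≤ p.2 ∧ p.1.2 ≤ p.2}.indicator
    (fun p => q p.1.1 * q p.1.2 * q p.2)
  have hΦ : Measurable Φ := Measurable.indicator
    (((hq.comp (by fun_prop)).mul (hq.comp (by fun_prop))).mul (hq.comp (by fun_prop))) hA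
  have e1 : ∀ u, q u * (J u * J u) = ∫⁻ r, ∫⁻ s, Φ ((r, s), u) ∂μ ∂μ := by
    intro u
    have : ∀ r s, Φ ((r, s), u) = q u * ((Iic u).indicator q r * (Iic u).indicator q s) := by
      intro r s
      simp only [Φ, indicator_apply, mem_ofPred_eq, mem_Iic]
      by_cases h1 : r ≤ u <;> by_cases h2 : s ≤ u <;> simp [h1, h2, mul_comm]
    simp only [this]
    have hi : Measurable ((Iic u).indicator q) := hq.indicator measurableSet_Iic
    simp only [lintegral_const_mul _ hi, lintegral_const_mul _ (hi.const_mul _)]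
    rw [lintegral_const_mul _ (hi.mul_const _), lintegral_mul_const _ hi,
      lintegral_indicator measurableSet_Iic]
  have e2 : ∀ r s, ∫⁻ u in Ici (max r s), q r * q s * q u ∂μ = ∫⁻ u, Φ ((r, s), u) ∂μ := by
    intro r s
    rw [← lintegral_indicator measurableSet_Ici]
    refine lintegral_congr fun u => ?_
    simp only [Φ, indicator_apply, mem_ofPred_eq, mem_Ici, max_le_iff]
  simp only [e1, e2]
  rw [lintegral_lintegral_swap]
  · refine lintegral_congr fun r => ?_
    rw [lintegral_lintegral_swap]
    exact (hΦ.comp (by fun_prop)).aemeasurable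
  · have : Measurable fun p : (ℝ × ℝ) × ℝ => Φ ((p.1.2, p.2), p.1.1) := hΦ.comp (by fun_prop)
    exact this.lintegral_prod_right'.aemeasurable

end OrderedIntegrals

/-! ### Moments of the occupation times -/

section Moments

variable {S : Type*} [AddCommGroup S] [TopologicalSpace S] [IsTopologicalAddGroup S]
    [LocallyCompactSpace S] [T2Space S] [SecondCountableTopology S]
    [MeasurableSpace S] [BorelSpace S]
    {Ω : Type*} [MeasurableSpace Ω]

/-- The semigroup of the motion, acting on `[0, ∞]`-valued functions. -/
def stepOp (P : Measure Ω) (W : ℝ≥0 → Ω → S) (s : ℝ≥0) (h : S → ℝ≥0∞) (x : S) : ℝ≥0∞ :=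
  ∫⁻ y, h (x + y) ∂(stepLaw P W s)

/-- The quadratic form `(g, T_s h)_ρ` of the semigroup. -/
def energy (ρ : Measure S) (P : Measure Ω) (W : ℝ≥0 → Ω → S) (s : ℝ≥0) (g h : S → ℝ≥0∞) : ℝ≥0∞ :=
  ∫⁻ x, g x * stepOp P W s h x ∂ρ

/-- The occupation time functional `∫_0^t g(x + w_s) ds` of the path `w` started at `x`. -/
def occupation (t : ℝ) (g : S → ℝ≥0∞) (p : S × (ℝ≥0 → S)) : ℝ≥0∞ :=
  ∫⁻ s in Ioc 0 t, g (p.1 + regEval s.toNNReal p.2)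

variable {ρ : Measure S} {P : Measure Ω} [IsProbabilityMeasure P] {W : ℝ≥0 → Ω → S}
  {g h : S → ℝ≥0∞}

lemma measurable_regEval_right (s : ℝ≥0) : Measurable fun w : ℝ≥0 → S => regEval s w :=
  measurable_regEval.comp (measurable_const.prodMk measurable_id)

lemma IsParticleMotion.stepOp_eq_lintegral_motionLaw (hW : IsParticleMotion ρ P W)
    (hh : Measurable h) (s : ℝ≥0) (x : S) :
    stepOp P W s h x = ∫⁻ w, h (x + regEval s w) ∂(motionLaw P W) := by
  rw [stepOp, ← hW.map_regEval_motionLaw s,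
    lintegral_map (f := fun y => h (x + y)) (hh.comp (by fun_prop)) (measurable_regEval_right s)]

lemma IsParticleMotion.measurable_stepOp (hW : IsParticleMotion ρ P W) (hh : Measurable h) :
    Measurable fun p : ℝ≥0 × S => stepOp P W p.1 h p.2 := by
  simp only [hW.stepOp_eq_lintegral_motionLaw hh]
  have := hW.isProbabilityMeasure_motionLaw
  have h1 : Measurable fun q : (ℝ≥0 × S) × (ℝ≥0 → S) => regEval q.1.1 q.2 :=
    measurable_regEval.comp (f := fun q : (ℝ≥0 × S) × (ℝ≥0 → S) => (q.1.1, q.2)) (by fun_prop)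
  exact Measurable.lintegral_prod_right'
    (f := fun q : (ℝ≥0 × S) × (ℝ≥0 → S) => h (q.1.2 + regEval q.1.1 q.2))
    (hh.comp ((measurable_snd.comp measurable_fst).add h1))

lemma IsParticleMotion.measurable_stepOp_right (hW : IsParticleMotion ρ P W) (hh : Measurable h)
    (s : ℝ≥0) : Measurable (stepOp P W s h) :=
  (hW.measurable_stepOp hh).comp (measurable_const.prodMk measurable_id)

lemma stepOp_mono (s : ℝ≥0) (hgh : g ≤ h) (x : S) : stepOp P W s g x ≤ stepOp P W s h x :=
  lintegral_mono fun y => hgh (x + y)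

lemma stepOp_zero (hh : Measurable h) (x : S) : stepOp P W 0 h x = h x := by
  rw [stepOp, stepLaw_zero, lintegral_dirac' (f := fun y => h (x + y)) _ (hh.comp (by fun_prop)),
    add_zero]

lemma IsParticleMotion.stepOp_add (hW : IsParticleMotion ρ P W) (hh : Measurable h) (s r : ℝ≥0)
    (x : S) : stepOp P W (s + r) h x = stepOp P W s (stepOp P W r h) x := by
  rw [stepOp, hW.lintegral_stepLaw_add s r (g := fun y => h (x + y)) (hh.comp (by fun_prop))]
  simp only [stepOp, add_assoc]

variable [ρ.IsAddHaarMeasure]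

/-- Haar measure is invariant under the motion. -/
lemma IsParticleMotion.lintegral_lintegral_motionLaw (hW : IsParticleMotion ρ P W)
    (hh : Measurable h) (s : ℝ≥0) :
    ∫⁻ x, ∫⁻ w, h (x + regEval s w) ∂(motionLaw P W) ∂ρ = ∫⁻ x, h x ∂ρ := by
  have := hW.isProbabilityMeasure_motionLaw
  rw [lintegral_lintegral_swap]
  · simp only [lintegral_add_right_eq_self, lintegral_const, measure_univ, mul_one]
  · exact (hh.comp (measurable_fst.add
      ((measurable_regEval_right s).comp measurable_snd))).aemeasurable

lemma IsParticleMotion.lintegral_stepOp (hW : IsParticleMotion ρ P W) (hh : Measurable h)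
    (s : ℝ≥0) : ∫⁻ x, stepOp P W s h x ∂ρ = ∫⁻ x, h x ∂ρ := by
  simp only [hW.stepOp_eq_lintegral_motionLaw hh]
  exact hW.lintegral_lintegral_motionLaw hh s

/-- The semigroup is symmetric with respect to Haar measure. -/
lemma IsParticleMotion.energy_comm (hW : IsParticleMotion ρ P W) (hg : Measurable g)
    (hh : Measurable h) (s : ℝ≥0) : energy ρ P W s g h = energy ρ P W s h g := by
  have := hW.isProbabilityMeasure_stepLaw s
  have e : ∀ (g h : S → ℝ≥0∞), Measurable g → Measurable h →
      energy ρ P W s g h = ∫⁻ y, ∫⁻ x, g x * h (x + y) ∂ρ ∂(stepLaw P W s) := by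
    intro g h hg hh
    have e1 : ∀ x, g x * stepOp P W s h x = ∫⁻ y, g x * h (x + y) ∂(stepLaw P W s) := fun x =>
      (lintegral_const_mul _ (hh.comp (by fun_prop))).symm
    simp only [energy, e1]
    rw [lintegral_lintegral_swap]
    exact ((hg.comp measurable_fst).mul (hh.comp (measurable_fst.add measurable_snd))).aemeasurable
  rw [e g h hg hh, e h g hh hg, ← hW.map_neg_stepLaw s, lintegral_map _ measurable_neg,
    hW.map_neg_stepLaw s]
  · refine lintegral_congr fun y => ?_
    rw [← lintegral_add_right_eq_self _ y]
    refine lintegral_congr fun x => ?_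
    rw [add_neg_cancel_right, mul_comm]
  · exact Measurable.lintegral_prod_right' (f := fun q : S × S => g q.2 * h (q.2 + q.1))
      ((hg.comp measurable_snd).mul (hh.comp (measurable_snd.add measurable_fst)))

lemma IsParticleMotion.measurable_energy (hW : IsParticleMotion ρ P W) (hg : Measurable g)
    (hh : Measurable h) : Measurable fun s => energy ρ P W s g h :=
  Measurable.lintegral_prod_right' (f := fun q : ℝ≥0 × S => g q.2 * stepOp P W q.1 h q.2)
    ((hg.comp measurable_snd).mul (hW.measurable_stepOp hh))

lemma measurable_evaluation (hg : Measurable g) :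
    Measurable fun q : (S × (ℝ≥0 → S)) × ℝ => g (q.1.1 + regEval q.2.toNNReal q.1.2) := by
  have h1 : Measurable fun q : (S × (ℝ≥0 → S)) × ℝ => regEval q.2.toNNReal q.1.2 :=
    measurable_regEval.comp (f := fun q : (S × (ℝ≥0 → S)) × ℝ => (q.2.toNNReal, q.1.2))
      (by fun_prop)
  exact hg.comp ((measurable_fst.comp measurable_fst).add h1)

lemma measurable_occupation (hg : Measurable g) (t : ℝ) :
    Measurable (occupation (S := S) t g) :=
  (measurable_evaluation hg).lintegral_prod_right'

/-- The Markov property at time `s`, in the form needed for three-point expectations. -/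
lemma IsParticleMotion.lintegral_motionLaw_mul (hW : IsParticleMotion ρ P W) {r s u : ℝ≥0}
    (hrs : r ≤ s) (hsu : s ≤ u) {G : S × S → ℝ≥0∞} (hG : Measurable G) (hg : Measurable g)
    (x : S) :
    ∫⁻ w, G (regEval r w, regEval s w) * g (x + regEval u w) ∂(motionLaw P W)
      = ∫⁻ w, G (regEval r w, regEval s w) * stepOp P W (u - s) g (x + regEval s w)
          ∂(motionLaw P W) := by
  have hs := hW.measurable_stepOp_right hg (u - s)
  rw [hW.lintegral_motionLaw hrs hsu (G := fun p => G (p.1, p.2.1) * g (x + p.2.2))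
      ((hG.comp (by fun_prop)).mul (hg.comp (by fun_prop))),
    hW.lintegral_motionLaw hrs le_rfl
      (G := fun p => G (p.1, p.2.1) * stepOp P W (u - s) g (x + p.2.1))
      ((hG.comp (by fun_prop)).mul (hs.comp (by fun_prop)))]
  refine lintegral_congr fun a => lintegral_congr fun b => ?_
  rw [tsub_self, stepLaw_zero, lintegral_dirac, stepOp,
    ← lintegral_const_mul _ (f := fun y => g (x + (a + b) + y)) (hg.comp (by fun_prop))]
  simp only [add_assoc]

/-- Two-point expectations of the occupation times, started from Haar measure, only depend on the
time difference. -/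
lemma IsParticleMotion.lintegral_prod_motionLaw_mul (hW : IsParticleMotion ρ P W)
    (hg : Measurable g) (hh : Measurable h) {r s : ℝ≥0} (hrs : r ≤ s) :
    ∫⁻ x, ∫⁻ w, g (x + regEval r w) * h (x + regEval s w) ∂(motionLaw P W) ∂ρ
      = energy ρ P W (s - r) g h := by
  have h1 : ∀ x, ∫⁻ w, g (x + regEval r w) * h (x + regEval s w) ∂(motionLaw P W)
      = ∫⁻ w, (fun y => g y * stepOp P W (s - r) h y) (x + regEval r w) ∂(motionLaw P W) :=
    fun x => hW.lintegral_motionLaw_mul le_rfl hrs (G := fun p => g (x + p.1))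
      (hg.comp (by fun_prop)) hh x
  simp only [h1]
  rw [hW.lintegral_lintegral_motionLaw (h := fun y => g y * stepOp P W (s - r) h y)
    (hg.mul (hW.measurable_stepOp_right hh _))]
  rfl

lemma IsParticleMotion.lintegral_prod_motionLaw_eq (hW : IsParticleMotion ρ P W)
    (hg : Measurable g) (hh : Measurable h) {r s : ℝ} (hr : 0 ≤ r) (hs : 0 ≤ s) :
    ∫⁻ x, ∫⁻ w, g (x + regEval r.toNNReal w) * h (x + regEval s.toNNReal w) ∂(motionLaw P W) ∂ρ
      = energy ρ P W |r - s|.toNNReal g h := by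
  rcases le_total r s with hrs | hrs
  · rw [hW.lintegral_prod_motionLaw_mul hg hh (Real.toNNReal_le_toNNReal hrs), abs_sub_comm,
      abs_of_nonneg (sub_nonneg.2 hrs), NNReal.sub_def, Real.coe_toNNReal _ hr,
      Real.coe_toNNReal _ hs]
  · simp only [mul_comm (g _)]
    rw [hW.lintegral_prod_motionLaw_mul hh hg (Real.toNNReal_le_toNNReal hrs),
      abs_of_nonneg (sub_nonneg.2 hrs), NNReal.sub_def, Real.coe_toNNReal _ hr,
      Real.coe_toNNReal _ hs, hW.energy_comm hh hg]

lemma IsParticleMotion.lintegral_occupation (hW : IsParticleMotion ρ P W) (hg : Measurable g)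
    (t : ℝ) :
    ∫⁻ p, occupation t g p ∂(ρ.prod (motionLaw P W)) = ENNReal.ofReal t * ∫⁻ x, g x ∂ρ := by
  have := hW.isProbabilityMeasure_motionLaw
  unfold occupation
  rw [lintegral_lintegral_swap (measurable_evaluation hg).aemeasurable]
  have h1 : ∀ s : ℝ, ∫⁻ p : S × (ℝ≥0 → S), g (p.1 + regEval s.toNNReal p.2)
      ∂(ρ.prod (motionLaw P W)) = ∫⁻ x, g x ∂ρ := by
    intro s
    rw [lintegral_prod (fun p : S × (ℝ≥0 → S) => g (p.1 + regEval s.toNNReal p.2))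
      ((measurable_evaluation hg).comp (measurable_id.prodMk measurable_const)).aemeasurable]
    exact hW.lintegral_lintegral_motionLaw hg _
  simp only [h1, lintegral_const, Measure.restrict_apply MeasurableSet.univ, univ_inter,
    Real.volume_Ioc, sub_zero]
  rw [mul_comm]

lemma IsParticleMotion.lintegral_occupation_mul_eq (hW : IsParticleMotion ρ P W)
    (hg : Measurable g) (hh : Measurable h) (t : ℝ) :
    ∫⁻ p, occupation t g p * occupation t h p ∂(ρ.prod (motionLaw P W))
      = ∫⁻ r in Ioc 0 t, ∫⁻ s in Ioc 0 t, energy ρ P W |r - s|.toNNReal g h := by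
  have := hW.isProbabilityMeasure_motionLaw
  have hg1 : ∀ p : S × (ℝ≥0 → S), Measurable fun s : ℝ => g (p.1 + regEval s.toNNReal p.2) :=
    fun p => (measurable_evaluation hg).comp (measurable_const.prodMk measurable_id)
  have hh1 : ∀ p : S × (ℝ≥0 → S), Measurable fun s : ℝ => h (p.1 + regEval s.toNNReal p.2) :=
    fun p => (measurable_evaluation hh).comp (measurable_const.prodMk measurable_id)
  have hJ : Measurable fun q : ((S × (ℝ≥0 → S)) × ℝ) × ℝ =>
      g (q.1.1.1 + regEval q.1.2.toNNReal q.1.1.2) * h (q.1.1.1 + regEval q.2.toNNReal q.1.1.2) :=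
    ((measurable_evaluation hg).comp measurable_fst).mul ((measurable_evaluation hh).comp
      (f := fun q : ((S × (ℝ≥0 → S)) × ℝ) × ℝ => (q.1.1, q.2)) (by fun_prop))
  have h1 : ∀ p : S × (ℝ≥0 → S), occupation t g p * occupation t h p
      = ∫⁻ r in Ioc 0 t, ∫⁻ s in Ioc 0 t,
        g (p.1 + regEval r.toNNReal p.2) * h (p.1 + regEval s.toNNReal p.2) := by
    intro p
    simp only [lintegral_const_mul _ (hh1 p)]
    rw [lintegral_mul_const _ (hg1 p)]
    rfl
  simp only [h1]
  rw [lintegral_lintegral_swap hJ.lintegral_prod_right'.aemeasurable]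
  refine setLIntegral_congr_fun measurableSet_Ioc fun r hr => ?_
  have hJr : Measurable fun q : (S × (ℝ≥0 → S)) × ℝ =>
      g (q.1.1 + regEval r.toNNReal q.1.2) * h (q.1.1 + regEval q.2.toNNReal q.1.2) :=
    hJ.comp (f := fun q : (S × (ℝ≥0 → S)) × ℝ => ((q.1, r), q.2)) (by fun_prop)
  rw [lintegral_lintegral_swap hJr.aemeasurable]
  refine setLIntegral_congr_fun measurableSet_Ioc fun s hs => ?_
  rw [lintegral_prod (fun p : S × (ℝ≥0 → S) => g (p.1 + regEval r.toNNReal p.2) *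
    h (p.1 + regEval s.toNNReal p.2))
    (hJr.comp (measurable_id.prodMk measurable_const)).aemeasurable]
  exact hW.lintegral_prod_motionLaw_eq hg hh hr.1.le hs.1.le

/-- The covariance of the occupation times. -/
lemma IsParticleMotion.lintegral_occupation_mul (hW : IsParticleMotion ρ P W)
    (hg : Measurable g) (hh : Measurable h) (t : ℝ) :
    ∫⁻ p, occupation t g p * occupation t h p ∂(ρ.prod (motionLaw P W))
      = 2 * ∫⁻ r in Ioc 0 t, ∫⁻ u in Ioc 0 r, energy ρ P W u.toNNReal g h := by
  have hK : Measurable fun p : ℝ × ℝ => energy ρ P W |p.1 - p.2|.toNNReal g h :=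
    (hW.measurable_energy hg hh).comp (by fun_prop)
  rw [hW.lintegral_occupation_mul_eq hg hh, lintegral_lintegral_eq_two_mul_Iio
    (K := fun r s => energy ρ P W |r - s|.toNNReal g h) hK (fun r s => by rw [abs_sub_comm])]
  congr 1
  refine setLIntegral_congr_fun measurableSet_Ioc fun r hr => ?_
  have h1 : Iio r ∩ Ioc 0 t = Ioo 0 r := by
    ext s
    simp only [mem_inter_iff, mem_Iio, mem_Ioc, mem_Ioo]
    exact ⟨fun h => ⟨h.2.1, h.1⟩, fun h => ⟨h.2, h.1, h.2.le.trans hr.2⟩⟩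
  rw [Measure.restrict_restrict measurableSet_Iio, h1, setLIntegral_congr Ioo_ae_eq_Ioc.symm,
    ← lintegral_indicator measurableSet_Ioo, ← lintegral_indicator measurableSet_Ioo,
    ← lintegral_sub_left_eq_self _ r]
  refine lintegral_congr fun s => ?_
  by_cases hs : s ∈ Ioo 0 r
  · have hs' : r - s ∈ Ioo 0 r := ⟨by linarith [hs.2], by linarith [hs.1]⟩
    rw [indicator_of_mem hs, indicator_of_mem hs', sub_sub_cancel, abs_of_pos hs.1]
  · have hs' : r - s ∉ Ioo 0 r := fun h => hs ⟨by linarith [h.2], by linarith [h.1]⟩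
    rw [indicator_of_notMem hs, indicator_of_notMem hs']

/-- The third moment of the occupation times is controlled by the second one and the supremum of
the truncated potential. -/
lemma IsParticleMotion.lintegral_occupation_cube_le (hW : IsParticleMotion ρ P W)
    (hg : Measurable g) (t : ℝ) :
    ∫⁻ p, occupation t g p ^ 3 ∂(ρ.prod (motionLaw P W))
      ≤ 4 * (⨆ y, ∫⁻ v in Ioc 0 t, stepOp P W v.toNNReal g y) *
        ∫⁻ p, occupation t g p * occupation t g p ∂(ρ.prod (motionLaw P W)) := by
  have := hW.isProbabilityMeasure_motionLaw
  set N : ℝ≥0∞ := ⨆ y, ∫⁻ v in Ioc 0 t, stepOp P W v.toNNReal g y with hN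
  let e : S × (ℝ≥0 → S) → ℝ → ℝ≥0∞ := fun p s => g (p.1 + regEval s.toNNReal p.2)
  have he : Measurable fun q : (S × (ℝ≥0 → S)) × ℝ => e q.1 q.2 := measurable_evaluation hg
  have he1 : ∀ p, Measurable (e p) := fun p => he.comp (measurable_const.prodMk measurable_id)
  have hes : ∀ s, Measurable fun p => e p s := fun s =>
    he.comp (measurable_id.prodMk measurable_const)
  -- the potential of the part of the path after time `s`
  have hshift : ∀ (s : ℝ) (y : S), 0 < s → ∫⁻ u in Ici s,
      stepOp P W (u.toNNReal - s.toNNReal) g y ∂(volume.restrict (Ioc 0 t)) ≤ N := by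
    intro s y hs
    refine le_trans ?_ (le_iSup _ y)
    rw [Measure.restrict_restrict measurableSet_Ici, setLIntegral_congr Ioc_ae_eq_Icc,
      ← lintegral_indicator (measurableSet_Ici.inter measurableSet_Ioc),
      ← lintegral_indicator measurableSet_Icc,
      ← lintegral_sub_right_eq_self ((Icc 0 t).indicator _) s]
    refine lintegral_mono fun u => ?_
    by_cases hu : u ∈ Ici s ∩ Ioc 0 t
    · have hu' : u - s ∈ Icc 0 t := ⟨sub_nonneg.2 hu.1, by linarith [hu.2.2]⟩
      rw [indicator_of_mem hu, indicator_of_mem hu', NNReal.sub_def,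
        Real.coe_toNNReal _ hs.le, Real.coe_toNNReal _ (hs.le.trans hu.1)]
    · rw [indicator_of_notMem hu]
      exact zero_le
  -- integrating out the largest time, for ordered smaller times
  have key' : ∀ r s : ℝ, 0 < r → r ≤ s →
      ∫⁻ p, ∫⁻ u in Ici s, e p r * e p s * e p u ∂(volume.restrict (Ioc 0 t))
          ∂(ρ.prod (motionLaw P W))
        ≤ N * ∫⁻ p, e p r * e p s ∂(ρ.prod (motionLaw P W)) := by
    intro r s hr hrs
    have hs : 0 < s := hr.trans_le hrs
    let k : S × (ℝ≥0 → S) → ℝ → ℝ≥0∞ := fun p u => e p r * e p s *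
      stepOp P W (u.toNNReal - s.toNNReal) g (p.1 + regEval s.toNNReal p.2)
    have hst : Measurable fun q : (S × (ℝ≥0 → S)) × ℝ =>
        stepOp P W (q.2.toNNReal - s.toNNReal) g (q.1.1 + regEval s.toNNReal q.1.2) :=
      (hW.measurable_stepOp hg).comp
        (f := fun q : (S × (ℝ≥0 → S)) × ℝ =>
          (q.2.toNNReal - s.toNNReal, q.1.1 + regEval s.toNNReal q.1.2))
        (((measurable_real_toNNReal.comp measurable_snd).sub_const _).prodMk
          ((measurable_fst.comp measurable_fst).add
            ((measurable_regEval_right _).comp (measurable_snd.comp measurable_fst))))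
    have hrsm : Measurable fun q : (S × (ℝ≥0 → S)) × ℝ => e q.1 r * e q.1 s :=
      ((hes r).mul (hes s)).comp measurable_fst
    have hk : Measurable fun q : (S × (ℝ≥0 → S)) × ℝ => k q.1 q.2 := hrsm.mul hst
    have he3 : Measurable fun q : (S × (ℝ≥0 → S)) × ℝ => e q.1 r * e q.1 s * e q.1 q.2 :=
      hrsm.mul he
    calc ∫⁻ p, ∫⁻ u in Ici s, e p r * e p s * e p u ∂(volume.restrict (Ioc 0 t))
          ∂(ρ.prod (motionLaw P W))
        = ∫⁻ u in Ici s, ∫⁻ p, e p r * e p s * e p u ∂(ρ.prod (motionLaw P W))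
            ∂(volume.restrict (Ioc 0 t)) := lintegral_lintegral_swap he3.aemeasurable
      _ = ∫⁻ u in Ici s, ∫⁻ p, k p u ∂(ρ.prod (motionLaw P W))
            ∂(volume.restrict (Ioc 0 t)) := by
          refine setLIntegral_congr_fun measurableSet_Ici fun u hu => ?_
          rw [lintegral_prod (fun p => e p r * e p s * e p u)
              (he3.comp (measurable_id.prodMk measurable_const)).aemeasurable,
            lintegral_prod (fun p => k p u)
              (hk.comp (measurable_id.prodMk measurable_const)).aemeasurable]
          refine lintegral_congr fun x => ?_
          exact hW.lintegral_motionLaw_mul (Real.toNNReal_le_toNNReal hrs)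
            (Real.toNNReal_le_toNNReal hu) (G := fun p => g (x + p.1) * g (x + p.2))
            ((hg.comp (by fun_prop)).mul (hg.comp (by fun_prop))) hg x
      _ = ∫⁻ p, ∫⁻ u in Ici s, k p u ∂(volume.restrict (Ioc 0 t))
            ∂(ρ.prod (motionLaw P W)) := (lintegral_lintegral_swap hk.aemeasurable).symm
      _ ≤ ∫⁻ p, N * (e p r * e p s) ∂(ρ.prod (motionLaw P W)) := by
          refine lintegral_mono fun p => ?_
          simp only [k]
          rw [lintegral_const_mul _ (f := fun u : ℝ => stepOp P W (u.toNNReal - s.toNNReal) g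
            (p.1 + regEval s.toNNReal p.2)) (hst.comp (measurable_const.prodMk measurable_id)),
            mul_comm]
          exact mul_le_mul_left (hshift s _ hs) _
      _ = N * ∫⁻ p, e p r * e p s ∂(ρ.prod (motionLaw P W)) :=
          lintegral_const_mul _ ((hes r).mul (hes s))
  have key : ∀ r s : ℝ, 0 < r → 0 < s →
      ∫⁻ p, ∫⁻ u in Ici (max r s), e p r * e p s * e p u ∂(volume.restrict (Ioc 0 t))
          ∂(ρ.prod (motionLaw P W))
        ≤ N * ∫⁻ p, e p r * e p s ∂(ρ.prod (motionLaw P W)) := by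
    intro r s hr hs
    rcases le_total r s with hrs | hrs
    · rw [max_eq_right hrs]
      exact key' r s hr hrs
    · rw [max_eq_left hrs]
      simp only [mul_comm (e _ r)]
      exact key' s r hs hrs
  have hmax : MeasurableSet {q : (((S × (ℝ≥0 → S)) × ℝ) × ℝ) × ℝ | max q.1.1.2 q.1.2 ≤ q.2} :=
    measurableSet_le (by fun_prop) (by fun_prop)
  have hE2 : Measurable fun q : ((S × (ℝ≥0 → S)) × ℝ) × ℝ => e q.1.1 q.1.2 * e q.1.1 q.2 :=
    (he.comp measurable_fst).mul (he.comp
      (f := fun q : ((S × (ℝ≥0 → S)) × ℝ) × ℝ => (q.1.1, q.2)) (by fun_prop))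
  have hE3 : Measurable fun q : ((S × (ℝ≥0 → S)) × ℝ) × ℝ =>
      ∫⁻ u in Ici (max q.1.2 q.2), e q.1.1 q.1.2 * e q.1.1 q.2 * e q.1.1 u
        ∂(volume.restrict (Ioc 0 t)) := by
    have h1 : Measurable fun q : (((S × (ℝ≥0 → S)) × ℝ) × ℝ) × ℝ =>
        {q : (((S × (ℝ≥0 → S)) × ℝ) × ℝ) × ℝ | max q.1.1.2 q.1.2 ≤ q.2}.indicator
          (fun q => e q.1.1.1 q.1.1.2 * e q.1.1.1 q.1.2 * e q.1.1.1 q.2) q :=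
      ((hE2.comp measurable_fst).mul (he.comp
        (f := fun q : (((S × (ℝ≥0 → S)) × ℝ) × ℝ) × ℝ => (q.1.1.1, q.2)) (by fun_prop))).indicator
        hmax
    convert h1.lintegral_prod_right' (ν := volume.restrict (Ioc 0 t)) using 2 with q
    rw [← lintegral_indicator measurableSet_Ici]
    rfl
  have hE3r : ∀ r, Measurable fun q : (S × (ℝ≥0 → S)) × ℝ =>
      ∫⁻ u in Ici (max r q.2), e q.1 r * e q.1 q.2 * e q.1 u ∂(volume.restrict (Ioc 0 t)) :=
    fun r => hE3.comp (f := fun q : (S × (ℝ≥0 → S)) × ℝ => ((q.1, r), q.2)) (by fun_prop)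
  have hE2r : ∀ r, Measurable fun q : (S × (ℝ≥0 → S)) × ℝ => e q.1 r * e q.1 q.2 :=
    fun r => hE2.comp (f := fun q : (S × (ℝ≥0 → S)) × ℝ => ((q.1, r), q.2)) (by fun_prop)
  calc ∫⁻ p, occupation t g p ^ 3 ∂(ρ.prod (motionLaw P W))
      ≤ ∫⁻ p, 4 * (∫⁻ r in Ioc 0 t, (∫⁻ s in Ioc 0 t, (∫⁻ u in Ici (max r s),
          e p r * e p s * e p u ∂(volume.restrict (Ioc 0 t))))) ∂(ρ.prod (motionLaw P W)) :=
        lintegral_mono fun p => lintegral_cube_le (he1 p)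
    _ = 4 * ∫⁻ r in Ioc 0 t, ∫⁻ s in Ioc 0 t, ∫⁻ p, (∫⁻ u in Ici (max r s),
          e p r * e p s * e p u ∂(volume.restrict (Ioc 0 t))) ∂(ρ.prod (motionLaw P W)) := by
        rw [lintegral_const_mul _ hE3.lintegral_prod_right'.lintegral_prod_right',
          lintegral_lintegral_swap hE3.lintegral_prod_right'.aemeasurable]
        congr 1
        exact lintegral_congr fun r => lintegral_lintegral_swap (hE3r r).aemeasurable
    _ ≤ 4 * ∫⁻ r in Ioc 0 t, ∫⁻ s in Ioc 0 t,
          N * ∫⁻ p, e p r * e p s ∂(ρ.prod (motionLaw P W)) := by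
        refine mul_le_mul_right ?_ 4
        exact setLIntegral_mono' measurableSet_Ioc fun r hr =>
          setLIntegral_mono' measurableSet_Ioc fun s hs => key r s hr.1 hs.1
    _ = 4 * N * ∫⁻ r in Ioc 0 t, ∫⁻ s in Ioc 0 t,
          ∫⁻ p, e p r * e p s ∂(ρ.prod (motionLaw P W)) := by
        have h1 : ∀ r, Measurable fun s => ∫⁻ p, e p r * e p s ∂(ρ.prod (motionLaw P W)) :=
          fun r => (hE2r r).lintegral_prod_left'
        have h2 : Measurable fun r => ∫⁻ s in Ioc 0 t,
            ∫⁻ p, e p r * e p s ∂(ρ.prod (motionLaw P W)) := by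
          have h3 : Measurable fun q : (ℝ × ℝ) × (S × (ℝ≥0 → S)) => e q.2 q.1.1 * e q.2 q.1.2 :=
            hE2.comp (f := fun q : (ℝ × ℝ) × (S × (ℝ≥0 → S)) => ((q.2, q.1.1), q.1.2))
              (by fun_prop)
          exact h3.lintegral_prod_right'.lintegral_prod_right'
        simp only [lintegral_const_mul _ (h1 _)]
        rw [lintegral_const_mul _ h2, mul_assoc]
    _ = 4 * N * ∫⁻ p, occupation t g p * occupation t g p ∂(ρ.prod (motionLaw P W)) := by
        congr 1
        have h1 : ∀ p, occupation t g p * occupation t g p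
            = ∫⁻ r in Ioc 0 t, ∫⁻ s in Ioc 0 t, e p r * e p s := by
          intro p
          simp only [lintegral_const_mul _ (he1 p)]
          rw [lintegral_mul_const _ (he1 p)]
          rfl
        simp only [h1]
        refine Eq.trans ?_
          (lintegral_lintegral_swap hE2.lintegral_prod_right'.aemeasurable).symm
        exact lintegral_congr fun r => (lintegral_lintegral_swap (hE2r r).aemeasurable).symm

end Moments

/-! ### Monotonicity and decay of return densities -/

section Decay

variable {S : Type*} [AddCommGroup S] [TopologicalSpace S] [IsTopologicalAddGroup S]
    [LocallyCompactSpace S] [T2Space S] [SecondCountableTopology S]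
    [MeasurableSpace S] [BorelSpace S]
    {Ω : Type*} [MeasurableSpace Ω]
    {ρ : Measure S} {P : Measure Ω} [IsProbabilityMeasure P] {W : ℝ≥0 → Ω → S}
    {g h χ : S → ℝ≥0∞}

lemma ENNReal.two_mul_mul_le_add_mul_self (a b : ℝ≥0∞) : 2 * (a * b) ≤ a * a + b * b := by
  rcases le_total a b with hab | hab
  · obtain ⟨c, rfl⟩ := exists_add_of_le hab
    have : a * a + (a + c) * (a + c) = 2 * (a * (a + c)) + c * c := by ring
    exact this ▸ le_self_add
  · obtain ⟨c, rfl⟩ := exists_add_of_le hab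
    have : (b + c) * (b + c) + b * b = 2 * ((b + c) * b) + c * c := by ring
    exact this ▸ le_self_add

lemma stepOp_translate (s : ℝ≥0) (y u : S) :
    stepOp P W s (fun v => h (v + y)) u = stepOp P W s h (u + y) := by
  simp only [stepOp, add_right_comm]

variable [ρ.IsAddHaarMeasure]

/-- Splitting the time in two halves, by symmetry of the semigroup. -/
lemma IsParticleMotion.energy_add_self (hW : IsParticleMotion ρ P W) (hg : Measurable g)
    (hh : Measurable h) (r : ℝ≥0) :
    energy ρ P W (r + r) g h = ∫⁻ x, stepOp P W r g x * stepOp P W r h x ∂ρ := by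
  have hTh := hW.measurable_stepOp_right hh r
  calc energy ρ P W (r + r) g h = energy ρ P W r g (stepOp P W r h) := by
        simp only [energy, hW.stepOp_add hh]
    _ = energy ρ P W r (stepOp P W r h) g := hW.energy_comm hg hTh r
    _ = _ := lintegral_congr fun x => mul_comm _ _

/-- The diagonal dominates: `(χ, T_s χ(· + y)) ≤ (χ, T_s χ)`. -/
lemma IsParticleMotion.energy_translate_le (hW : IsParticleMotion ρ P W) (hχ : Measurable χ)
    (s : ℝ≥0) (y : S) :
    energy ρ P W s χ (fun u => χ (u + y)) ≤ energy ρ P W s χ χ := by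
  obtain ⟨r, rfl⟩ : ∃ r, s = r + r := ⟨s / 2, (add_halves s).symm⟩
  have hT := hW.measurable_stepOp_right hχ r
  rw [hW.energy_add_self (h := fun u => χ (u + y)) hχ (hχ.comp (by fun_prop)), hW.energy_add_self hχ hχ]
  simp only [stepOp_translate]
  have h2 : 2 * ∫⁻ x, stepOp P W r χ x * stepOp P W r χ (x + y) ∂ρ
      ≤ 2 * ∫⁻ x, stepOp P W r χ x * stepOp P W r χ x ∂ρ := by
    rw [← lintegral_const_mul _ (f := fun x => stepOp P W r χ x * stepOp P W r χ (x + y))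
      (hT.mul (hT.comp (by fun_prop)))]
    refine (lintegral_mono fun x => ENNReal.two_mul_mul_le_add_mul_self _ _).trans_eq ?_
    rw [lintegral_add_left (f := fun x => stepOp P W r χ x * stepOp P W r χ x) (hT.mul hT),
      lintegral_add_right_eq_self (fun x => stepOp P W r χ x * stepOp P W r χ x) y, two_mul]
  exact (ENNReal.mul_le_mul_iff_right two_ne_zero ENNReal.ofNat_ne_top).1 h2

lemma IsParticleMotion.measurable_energy_translate (hW : IsParticleMotion ρ P W)
    (hg : Measurable g) (hh : Measurable h) (s : ℝ≥0) :
    Measurable fun z => energy ρ P W s g (fun u => h (u + z)) := by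
  simp only [energy, stepOp_translate]
  exact Measurable.lintegral_prod_right'
    (f := fun q : S × S => g q.2 * stepOp P W s h (q.2 + q.1))
    ((hg.comp measurable_snd).mul
      ((hW.measurable_stepOp_right hh s).comp (measurable_snd.add measurable_fst)))

/-- The Markov property at time `r`, with the displacement moved into the second argument. -/
lemma IsParticleMotion.energy_add (hW : IsParticleMotion ρ P W) (hg : Measurable g)
    (hh : Measurable h) (r s : ℝ≥0) :
    energy ρ P W (r + s) g h
      = ∫⁻ z, energy ρ P W s g (fun u => h (u + z)) ∂(stepLaw P W r) := by
  have := hW.isProbabilityMeasure_stepLaw r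
  have hT := hW.measurable_stepOp_right hh s
  simp only [energy, stepOp_translate]
  rw [lintegral_lintegral_swap ((hg.comp measurable_snd).mul
    (hT.comp (measurable_snd.add measurable_fst))).aemeasurable]
  refine lintegral_congr fun x => ?_
  rw [hW.stepOp_add hh, stepOp, lintegral_const_mul _ (f := fun z => stepOp P W s h (x + z))
    (hT.comp (by fun_prop))]

lemma IsParticleMotion.antitone_energy (hW : IsParticleMotion ρ P W) (hχ : Measurable χ) :
    Antitone fun s => energy ρ P W s χ χ := by
  intro s t hst
  obtain ⟨r, rfl⟩ := exists_add_of_le hst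
  have := hW.isProbabilityMeasure_stepLaw r
  simp only
  rw [add_comm, hW.energy_add hχ hχ]
  refine (lintegral_mono fun z => hW.energy_translate_le hχ s z).trans_eq ?_
  simp

lemma IsParticleMotion.lintegral_energy_translate (hW : IsParticleMotion ρ P W)
    (hg : Measurable g) (hh : Measurable h) (s : ℝ≥0) :
    ∫⁻ z, energy ρ P W s g (fun u => h (u + z)) ∂ρ = (∫⁻ x, g x ∂ρ) * ∫⁻ x, h x ∂ρ := by
  have hT := hW.measurable_stepOp_right hh s
  simp only [energy, stepOp_translate]
  rw [lintegral_lintegral_swap ((hg.comp measurable_snd).mul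
    (hT.comp (measurable_snd.add measurable_fst))).aemeasurable]
  rw [← lintegral_mul_const _ hg]
  refine lintegral_congr fun x => ?_
  rw [lintegral_const_mul _ (f := fun z => stepOp P W s h (x + z)) (hT.comp (by fun_prop)),
    lintegral_add_left_eq_self, hW.lintegral_stepOp hh]

lemma energy_zero (hh : Measurable h) : energy ρ P W 0 g h = ∫⁻ x, g x * h x ∂ρ := by
  simp only [energy, stepOp_zero hh]

/-- On a group of infinite Haar measure the return densities decay. By monotonicity
`(χ, T_n χ(· + z))` and `(χ, T_n χ)` become equal for almost all `z`, while the former has a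
bounded integral over `z`. -/
lemma IsParticleMotion.tendsto_energy_atTop (hW : IsParticleMotion ρ P W) (hρ : ρ univ = ∞)
    (hχ : Measurable χ) (h1 : ∫⁻ x, χ x ∂ρ ≠ ∞) (h2 : ∫⁻ x, χ x * χ x ∂ρ ≠ ∞) :
    Tendsto (fun s => energy ρ P W s χ χ) atTop (𝓝 0) := by
  have hanti := hW.antitone_energy hχ
  set c : ℝ≥0 → ℝ≥0∞ := fun s => energy ρ P W s χ χ with hc
  have hc0 : c 0 ≠ ∞ := by rw [hc]; simpa only [energy_zero hχ] using h2
  have hcfin : ∀ s, c s ≠ ∞ := fun s => ne_top_of_le_ne_top hc0 (hanti zero_le)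
  let d : ℕ → S → ℝ≥0∞ := fun n z => energy ρ P W n χ (fun u => χ (u + z))
  have hd : ∀ n, Measurable (d n) := fun n => hW.measurable_energy_translate hχ hχ n
  have hdc : ∀ n z, d n z ≤ c n := fun n z => hW.energy_translate_le hχ n z
  have hlim := tendsto_atTop_iInf hanti
  set L := ⨅ s, c s with hL
  have hlimn : Tendsto (fun n : ℕ => c n) atTop (𝓝 L) := hlim.comp tendsto_natCast_atTop_atTop
  have := hW.isProbabilityMeasure_stepLaw 1
  have hint : ∀ n : ℕ, ∫⁻ z, (c n - d n z) ∂(stepLaw P W 1) = c n - c ((n + 1 : ℕ) : ℝ≥0) := by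
    intro n
    have e : ∫⁻ z, d n z ∂(stepLaw P W 1) = c ((n + 1 : ℕ) : ℝ≥0) := by
      rw [hc, Nat.cast_add, Nat.cast_one, add_comm]
      exact (hW.energy_add hχ hχ 1 n).symm
    rw [lintegral_sub (hd n) (by rw [e]; exact hcfin _) (ae_of_all _ fun z => hdc n z), e]
    simp
  -- the increments of `c` telescope
  have hsum : ∑' n : ℕ, (c n - c ((n + 1 : ℕ) : ℝ≥0)) ≤ c 0 := by
    refine ENNReal.tsum_le_of_sum_range_le fun N => ?_
    have : (∑ n ∈ Finset.range N, (c n - c ((n + 1 : ℕ) : ℝ≥0))) + c N = c 0 := by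
      induction N with
      | zero => simp
      | succ N ih =>
        rw [Finset.sum_range_succ, add_assoc, tsub_add_cancel_of_le, ih]
        exact hanti (by exact_mod_cast Nat.le_succ N)
    exact this ▸ le_self_add
  -- summability for the law of `W_1 - W_0`, whose density is positive
  have hae : ∀ᵐ z ∂ρ, Tendsto (fun n => d n z) atTop (𝓝 L) := by
    refine (hW.absolutelyContinuous_stepLaw one_pos).ae_le ?_
    have hm : Measurable fun z => ∑' n : ℕ, (c n - d n z) :=
      Measurable.tsum fun n => measurable_const.sub (hd n)
    have hfin : ∫⁻ z, ∑' n : ℕ, (c n - d n z) ∂(stepLaw P W 1) ≠ ∞ := by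
      rw [lintegral_tsum (f := fun (n : ℕ) z => c n - d n z)
        fun n => (measurable_const.sub (hd n)).aemeasurable]
      simp only [hint]
      exact ne_top_of_le_ne_top hc0 hsum
    filter_upwards [ae_lt_top hm hfin] with z hz
    have h0 := ENNReal.tendsto_atTop_zero_of_tsum_ne_top hz.ne
    have h3 := ENNReal.Tendsto.sub hlimn h0 (Or.inr ENNReal.zero_ne_top)
    simp only [tsub_zero] at h3
    refine h3.congr fun n => ?_
    exact ENNReal.sub_sub_cancel (hcfin _) (hdc n z)
  have hfatou : L * ρ univ ≤ (∫⁻ x, χ x ∂ρ) * ∫⁻ x, χ x ∂ρ := by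
    calc L * ρ univ = ∫⁻ _, L ∂ρ := by simp
      _ = ∫⁻ z, liminf (fun n => d n z) atTop ∂ρ :=
          lintegral_congr_ae (by filter_upwards [hae] with z hz using hz.liminf_eq.symm)
      _ ≤ liminf (fun n => ∫⁻ z, d n z ∂ρ) atTop := lintegral_liminf_le hd
      _ = _ := by
          have : ∀ n, ∫⁻ z, d n z ∂ρ = (∫⁻ x, χ x ∂ρ) * ∫⁻ x, χ x ∂ρ := fun n =>
            hW.lintegral_energy_translate hχ hχ n
          simp [this]
  have hL0 : L = 0 := by
    by_contra hne
    rw [hρ, ENNReal.mul_top hne, top_le_iff] at hfatou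
    exact ENNReal.mul_ne_top h1 h1 hfatou
  rwa [hL0] at hlim

/-- The autocorrelation `v ↦ ∫ χ(u) χ(u + v) du`. -/
def autocorrelation (ρ : Measure S) (χ : S → ℝ≥0∞) (v : S) : ℝ≥0∞ := ∫⁻ u, χ u * χ (u + v) ∂ρ

/-- The potential of an autocorrelation is maximal at the origin. -/
lemma IsParticleMotion.stepOp_autocorrelation_le (hW : IsParticleMotion ρ P W)
    (hχ : Measurable χ) (s : ℝ≥0) (y : S) :
    stepOp P W s (autocorrelation ρ χ) y ≤ energy ρ P W s χ χ := by
  have := hW.isProbabilityMeasure_stepLaw s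
  refine le_trans (le_of_eq ?_) (hW.energy_translate_le hχ s y)
  simp only [stepOp, autocorrelation, energy]
  rw [lintegral_lintegral_swap ((hχ.comp measurable_snd).mul
    (hχ.comp (measurable_snd.add (measurable_fst.const_add y)))).aemeasurable]
  refine lintegral_congr fun u => ?_
  rw [lintegral_const_mul _ (f := fun z => χ (u + (y + z))) (hχ.comp (by fun_prop))]
  congr 1
  refine lintegral_congr fun z => ?_
  congr 1
  abel

/-- The `[0, ∞]`-valued version of a test function. -/
def TestFn.toENNReal (ψ : TestFn S) (x : S) : ℝ≥0∞ := ENNReal.ofReal (ψ.1 x)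

lemma TestFn.measurable_toENNReal (ψ : TestFn S) : Measurable ψ.toENNReal :=
  (map_continuous ψ.1).measurable.ennreal_ofReal

lemma TestFn.nonneg (ψ : TestFn S) (x : S) : 0 ≤ ψ.1 x := ψ.2 x

lemma TestFn.exists_le (ψ : TestFn S) : ∃ C : ℝ≥0, ∀ x, ψ.toENNReal x ≤ C := by
  obtain ⟨C, hC⟩ := ψ.1.hasCompactSupport.exists_bound_of_continuous (map_continuous ψ.1)
  refine ⟨C.toNNReal, fun x => ENNReal.ofReal_le_ofReal ((le_abs_self _).trans (hC x))⟩

lemma TestFn.integrable (ψ : TestFn S) : Integrable ψ.1 ρ :=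
  (map_continuous ψ.1).integrable_of_hasCompactSupport ψ.1.hasCompactSupport

lemma TestFn.lintegral_toENNReal (ψ : TestFn S) :
    ∫⁻ x, ψ.toENNReal x ∂ρ = ENNReal.ofReal (∫ x, ψ.1 x ∂ρ) :=
  (ofReal_integral_eq_lintegral_ofReal ψ.integrable (ae_of_all _ ψ.nonneg)).symm

lemma TestFn.lintegral_ne_top (ψ : TestFn S) : ∫⁻ x, ψ.toENNReal x ∂ρ ≠ ∞ := by
  rw [ψ.lintegral_toENNReal]; exact ENNReal.ofReal_ne_top

lemma TestFn.lintegral_mul_self_ne_top (ψ : TestFn S) :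
    ∫⁻ x, ψ.toENNReal x * ψ.toENNReal x ∂ρ ≠ ∞ := by
  obtain ⟨C, hC⟩ := ψ.exists_le
  refine ne_top_of_le_ne_top (ENNReal.mul_ne_top ENNReal.coe_ne_top ψ.lintegral_ne_top)
    ((lintegral_mono fun x => mul_le_mul_left (hC x) _).trans_eq
      (lintegral_const_mul (C : ℝ≥0∞) (ψ.measurable_toENNReal)))

/-- Every test function is dominated by a multiple of the autocorrelation of another one: take `χ`
equal to one on `V ∪ (V + supp ψ)` for a compact neighbourhood `V` of the origin. -/
lemma TestFn.exists_le_autocorrelation (ρ : Measure S) [ρ.IsAddHaarMeasure] (ψ : TestFn S) :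
    ∃ (χ : TestFn S) (C : ℝ≥0∞), C ≠ ∞ ∧
      ∀ x, ψ.toENNReal x ≤ C * autocorrelation ρ χ.toENNReal x := by
  obtain ⟨V, hV, hV0⟩ := exists_compact_mem_nhds (0 : S)
  have hK := ψ.1.hasCompactSupport.isCompact
  obtain ⟨χ, hχ1, -, hχc, hχ01⟩ := exists_continuous_one_zero_of_isCompact
    (hV.union (hV.add hK)) isClosed_empty (disjoint_empty _)
  obtain ⟨B, hB⟩ := ψ.exists_le
  have hρV : ρ V ≠ 0 := (MeasureTheory.Measure.measure_pos_of_mem_nhds ρ hV0).ne'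
  refine ⟨⟨⟨χ, hχc⟩, fun x => (hχ01 x).1⟩, B / ρ V, ENNReal.div_ne_top ENNReal.coe_ne_top hρV,
    fun x => ?_⟩
  by_cases hx : x ∈ tsupport ψ.1
  · refine (hB x).trans ?_
    have hle : ρ V ≤ autocorrelation ρ (TestFn.toENNReal ⟨⟨χ, hχc⟩, fun x => (hχ01 x).1⟩) x := by
      rw [← setLIntegral_one, autocorrelation]
      refine le_trans (setLIntegral_mono_ae' hV.measurableSet (ae_of_all _ fun u hu => ?_))
        (setLIntegral_le_lintegral V _)
      have e1 : χ u = 1 := hχ1 (Or.inl hu)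
      have e2 : χ (u + x) = 1 := hχ1 (Or.inr (add_mem_add hu hx))
      simp only [TestFn.toENNReal, CompactlySupportedContinuousMap.coe_mk, e1, e2,
        ENNReal.ofReal_one, mul_one, le_refl]
    calc (B : ℝ≥0∞) = B / ρ V * ρ V :=
          (ENNReal.div_mul_cancel hρV hV.measure_lt_top.ne).symm
      _ ≤ _ := mul_le_mul_right hle _
  · rw [TestFn.toENNReal, image_eq_zero_of_notMem_tsupport hx, ENNReal.ofReal_zero]
    exact zero_le

end Decay

/-! ### Averages over time -/

section TimeAverages

/-- Asymptotic equivalence of two functions passes to their integrals, as soon as the integral of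
the positive one diverges. -/
lemma tendsto_intervalIntegral_div {f g : ℝ → ℝ} {H : ℝ}
    (hf : ∀ t, 0 ≤ t → IntervalIntegrable f volume 0 t)
    (hg : ∀ t, 0 ≤ t → IntervalIntegrable g volume 0 t)
    (hpos : ∀ᶠ t in atTop, 0 < f t)
    (hlim : Tendsto (fun t => ∫ s in (0 : ℝ)..t, f s) atTop atTop)
    (h : Tendsto (fun t => (f t)⁻¹ * g t) atTop (𝓝 H)) :
    Tendsto (fun t => (∫ s in (0 : ℝ)..t, f s)⁻¹ * ∫ s in (0 : ℝ)..t, g s) atTop (𝓝 H) := by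
  rw [Metric.tendsto_nhds]
  intro ε hε
  have hev : ∀ᶠ t in atTop, |g t - H * f t| ≤ ε / 3 * f t := by
    have h1 := Metric.tendsto_nhds.1 h (ε / 3) (by positivity)
    filter_upwards [h1, hpos] with t ht hft
    rw [Real.dist_eq] at ht
    have e : g t - H * f t = f t * ((f t)⁻¹ * g t - H) := by field_simp
    rw [e, abs_mul, abs_of_pos hft, mul_comm]
    gcongr
  obtain ⟨T, hT⟩ := eventually_atTop.1 (hev.and (hpos.and (eventually_ge_atTop 0)))
  have hT0 : 0 ≤ T := (hT T le_rfl).2.2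
  let D : ℝ → ℝ := fun s => g s - H * f s
  have hD : ∀ t, 0 ≤ t → IntervalIntegrable D volume 0 t := fun t ht =>
    (hg t ht).sub ((hf t ht).const_mul H)
  set M := |∫ s in (0 : ℝ)..T, D s| + ε / 3 * |∫ s in (0 : ℝ)..T, f s| with hM
  filter_upwards [hlim.eventually_gt_atTop (3 * M / ε), hlim.eventually_gt_atTop 0,
    eventually_ge_atTop T] with t ht1 ht2 htT
  have ht0 : 0 ≤ t := hT0.trans htT
  have hfT : IntervalIntegrable f volume T t := (hf T hT0).symm.trans (hf t ht0)
  have hDT : IntervalIntegrable D volume T t := (hD T hT0).symm.trans (hD t ht0)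
  have e1 : ∫ s in (0 : ℝ)..t, D s = (∫ s in (0 : ℝ)..T, D s) + ∫ s in T..t, D s :=
    (intervalIntegral.integral_add_adjacent_intervals (hD T hT0) hDT).symm
  have e2 : ∫ s in (0 : ℝ)..t, f s = (∫ s in (0 : ℝ)..T, f s) + ∫ s in T..t, f s :=
    (intervalIntegral.integral_add_adjacent_intervals (hf T hT0) hfT).symm
  have e3 : ∫ s in (0 : ℝ)..t, D s = (∫ s in (0 : ℝ)..t, g s) - H * ∫ s in (0 : ℝ)..t, f s := by
    rw [intervalIntegral.integral_sub (hg t ht0) ((hf t ht0).const_mul H),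
      intervalIntegral.integral_const_mul]
  have h4 : |∫ s in T..t, D s| ≤ ε / 3 * ∫ s in T..t, f s := by
    rw [← intervalIntegral.integral_const_mul]
    refine (intervalIntegral.abs_integral_le_integral_abs htT).trans ?_
    refine intervalIntegral.integral_mono_on htT hDT.abs (hfT.const_mul _) fun s hs => ?_
    exact (hT s hs.1).1
  have h5 : |∫ s in (0 : ℝ)..t, D s| ≤ M + ε / 3 * ∫ s in (0 : ℝ)..t, f s := by
    rw [e1]
    refine (abs_add_le _ _).trans ?_
    have : -|∫ s in (0 : ℝ)..T, f s| ≤ ∫ s in (0 : ℝ)..T, f s := neg_abs_le _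
    have h6 : ∫ s in T..t, f s ≤ |∫ s in (0 : ℝ)..T, f s| + ∫ s in (0 : ℝ)..t, f s := by
      linarith
    calc |∫ s in (0 : ℝ)..T, D s| + |∫ s in T..t, D s|
        ≤ |∫ s in (0 : ℝ)..T, D s| + ε / 3 * (|∫ s in (0 : ℝ)..T, f s|
            + ∫ s in (0 : ℝ)..t, f s) := by
          gcongr
          exact h4.trans (by gcongr)
      _ = _ := by rw [hM]; ring
  set A := ∫ s in (0 : ℝ)..t, f s with hA
  rw [Real.dist_eq]
  have e4 : A⁻¹ * (∫ s in (0 : ℝ)..t, g s) - H = A⁻¹ * ∫ s in (0 : ℝ)..t, D s := by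
    rw [e3]; field_simp
  rw [e4, abs_mul, abs_of_pos (inv_pos.2 ht2)]
  have h7 : 3 * M < A * ε := (div_lt_iff₀ hε).1 ht1
  calc A⁻¹ * |∫ s in (0 : ℝ)..t, D s| ≤ A⁻¹ * (M + ε / 3 * A) := by gcongr
    _ < A⁻¹ * (A * ε) := by
        gcongr
        nlinarith
    _ = ε := by field_simp

lemma toReal_setLIntegral_Ioc {k : ℝ → ℝ≥0∞} (hk : Measurable k) (hfin : ∀ u, k u ≠ ∞) {t : ℝ}
    (ht : 0 ≤ t) : (∫⁻ u in Ioc 0 t, k u).toReal = ∫ u in (0 : ℝ)..t, (k u).toReal := by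
  rw [intervalIntegral.integral_of_le ht,
    integral_toReal hk.aemeasurable (ae_of_all _ fun u => (hfin u).lt_top)]

lemma setLIntegral_Ioc_ne_top {k : ℝ → ℝ≥0∞} {t : ℝ} {B : ℝ≥0∞} (hB : B ≠ ∞)
    (hkB : ∀ u ∈ Ioc 0 t, k u ≤ B) : ∫⁻ u in Ioc 0 t, k u ≠ ∞ := by
  refine ne_top_of_le_ne_top ?_ (setLIntegral_mono' measurableSet_Ioc hkB)
  rw [setLIntegral_const, Real.volume_Ioc]
  exact ENNReal.mul_ne_top hB ENNReal.ofReal_ne_top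

lemma intervalIntegrable_toReal {k : ℝ → ℝ≥0∞} (hk : Measurable k) {t : ℝ} (ht : 0 ≤ t)
    (h : ∫⁻ u in Ioc 0 t, k u ≠ ∞) :
    IntervalIntegrable (fun u => (k u).toReal) volume 0 t := by
  rw [intervalIntegrable_iff_integrableOn_Ioc_of_le ht]
  exact integrable_toReal_of_lintegral_ne_top hk.aemeasurable h

lemma measurable_setLIntegral_Ioc {k : ℝ → ℝ≥0∞} :
    Measurable fun t => ∫⁻ u in Ioc 0 t, k u :=
  Monotone.measurable fun _ _ hst => lintegral_mono_set (Ioc_subset_Ioc_right hst)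

/-- A primitive of a non-increasing function is concave; in particular its average over `[0, t]` is
comparable to its final value. -/
lemma ofReal_mul_setLIntegral_le {k : ℝ → ℝ≥0∞} (hk : Antitone k) {t : ℝ} (ht : 0 ≤ t) :
    ENNReal.ofReal t * ∫⁻ u in Ioc 0 t, k u ≤ 4 * ∫⁻ r in Ioc 0 t, ∫⁻ u in Ioc 0 r, k u := by
  set c : ℝ → ℝ≥0∞ := fun r => ∫⁻ u in Ioc 0 r, k u with hc
  have hcm : Monotone c := fun _ _ hst => lintegral_mono_set (Ioc_subset_Ioc_right hst)
  have h2 : c t ≤ 2 * c (t / 2) := by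
    have hd : Ioc 0 t = Ioc 0 (t / 2) ∪ Ioc (t / 2) t :=
      (Ioc_union_Ioc_eq_Ioc (by linarith) (by linarith)).symm
    have : ∫⁻ u in Ioc (t / 2) t, k u ≤ c (t / 2) := by
      rw [hc]
      simp only
      rw [← lintegral_indicator measurableSet_Ioc, ← lintegral_indicator measurableSet_Ioc,
        ← lintegral_sub_right_eq_self ((Ioc 0 (t / 2)).indicator k) (t / 2)]
      refine lintegral_mono fun u => ?_
      by_cases hu : u ∈ Ioc (t / 2) t
      · have hu' : u - t / 2 ∈ Ioc 0 (t / 2) := ⟨by linarith [hu.1], by linarith [hu.2]⟩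
        rw [indicator_of_mem hu, indicator_of_mem hu']
        exact hk (by linarith)
      · rw [indicator_of_notMem hu]
        exact zero_le
    calc c t ≤ c (t / 2) + ∫⁻ u in Ioc (t / 2) t, k u := by
          simp only [hc]; rw [hd]; exact lintegral_union_le _ _ _
      _ ≤ 2 * c (t / 2) := by rw [two_mul]; gcongr
  have h3 : ENNReal.ofReal (t / 2) * c (t / 2) ≤ ∫⁻ r in Ioc 0 t, c r := by
    calc ENNReal.ofReal (t / 2) * c (t / 2) = ∫⁻ _ in Ioc (t / 2) t, c (t / 2) := by
          rw [setLIntegral_const, Real.volume_Ioc, mul_comm]; congr 2; ring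
      _ ≤ ∫⁻ r in Ioc (t / 2) t, c r :=
          setLIntegral_mono' measurableSet_Ioc fun r hr => hcm hr.1.le
      _ ≤ ∫⁻ r in Ioc 0 t, c r := lintegral_mono_set (Ioc_subset_Ioc_left (by linarith))
  have h4 : ENNReal.ofReal t = 2 * ENNReal.ofReal (t / 2) := by
    rw [← ENNReal.ofReal_ofNat, ← ENNReal.ofReal_mul (by norm_num)]; congr 1; ring
  calc ENNReal.ofReal t * c t ≤ 2 * ENNReal.ofReal (t / 2) * (2 * c (t / 2)) := by
        rw [h4]; gcongr
    _ = 4 * (ENNReal.ofReal (t / 2) * c (t / 2)) := by ring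
    _ ≤ _ := by gcongr

/-- If a non-increasing function `k` vanishes at infinity and the twice iterated integral of `k` is
`O(a)`, then the square of the integral `c` of `k` is `o(a)`: write `c² / a = (c / t) (t c / a)`. -/
lemma tendsto_sq_div_of_antitone {k : ℝ → ℝ≥0∞} (hk : Antitone k) {B : ℝ≥0∞} (hB : B ≠ ∞)
    (hkB : ∀ u, k u ≤ B) (hk0 : Tendsto k atTop (𝓝 0)) {a : ℝ → ℝ} (ha : ∀ᶠ t in atTop, 0 < a t)
    {H : ℝ} (hH : Tendsto (fun t => (a t)⁻¹ *
      ∫ r in (0 : ℝ)..t, (∫⁻ u in Ioc 0 r, k u).toReal) atTop (𝓝 H)) :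
    Tendsto (fun t => (∫⁻ u in Ioc 0 t, k u).toReal ^ 2 / a t) atTop (𝓝 0) := by
  have hkm : Measurable k := hk.measurable
  have hkfin : ∀ u, k u ≠ ∞ := fun u => ne_top_of_le_ne_top hB (hkB u)
  have hcfin : ∀ t, ∫⁻ u in Ioc 0 t, k u ≠ ∞ := fun t => setLIntegral_Ioc_ne_top hB fun u _ => hkB u
  set c : ℝ → ℝ := fun t => (∫⁻ u in Ioc 0 t, k u).toReal with hc
  have hct : Tendsto (fun t => t⁻¹ * c t) atTop (𝓝 0) := by
    have h1 := tendsto_intervalIntegral_div (f := fun _ => (1 : ℝ)) (g := fun u => (k u).toReal)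
      (H := 0) (fun t _ => intervalIntegrable_const) (fun t ht => intervalIntegrable_toReal hkm ht
        (hcfin t)) (by simp) (by
          simp only [intervalIntegral.integral_const, smul_eq_mul, mul_one, sub_zero]
          exact tendsto_id) (by
          simpa [Function.comp_def] using (ENNReal.tendsto_toReal ENNReal.zero_ne_top).comp hk0)
    refine h1.congr' ?_
    filter_upwards [eventually_ge_atTop 0] with t ht
    rw [hc, ← toReal_setLIntegral_Ioc hkm hkfin ht]
    simp
  have hprod := (hct.mul hH).const_mul 4
  simp only [zero_mul, mul_zero] at hprod
  refine squeeze_zero' ?_ ?_ hprod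
  · filter_upwards [ha] with t hat
    positivity
  · filter_upwards [ha, eventually_gt_atTop 0] with t hat ht
    have hb : ∀ u ∈ Ioc 0 t, ∫⁻ v in Ioc 0 u, k v ≤ ∫⁻ v in Ioc 0 t, k v := fun u hu =>
      lintegral_mono_set (Ioc_subset_Ioc_right hu.2)
    have h1 : t * c t ≤ 4 * ∫ r in (0 : ℝ)..t, c r := by
      rw [← toReal_setLIntegral_Ioc measurable_setLIntegral_Ioc hcfin ht.le]
      have h2 := ENNReal.toReal_mono (ENNReal.mul_ne_top (by norm_num)
        (setLIntegral_Ioc_ne_top (hcfin t) hb)) (ofReal_mul_setLIntegral_le hk ht.le)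
      simpa [ENNReal.toReal_mul, ENNReal.toReal_ofReal ht.le] using h2
    have hc0 : 0 ≤ c t := ENNReal.toReal_nonneg
    calc c t ^ 2 / a t = t⁻¹ * c t * ((a t)⁻¹ * (t * c t)) := by field_simp
      _ ≤ t⁻¹ * c t * ((a t)⁻¹ * (4 * ∫ r in (0 : ℝ)..t, c r)) := by gcongr
      _ = _ := by ring

end TimeAverages

/-! ### Truncated and full potentials -/

section Potentials

variable {S : Type*} [AddCommGroup S] [TopologicalSpace S] [IsTopologicalAddGroup S]
    [LocallyCompactSpace S] [T2Space S] [SecondCountableTopology S]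
    [MeasurableSpace S] [BorelSpace S]
    {Ω : Type*} [MeasurableSpace Ω]

/-- The supremum of the truncated potential `∫_0^t T_s g ds`. -/
def supPotential (P : Measure Ω) (W : ℝ≥0 → Ω → S) (t : ℝ) (g : S → ℝ≥0∞) : ℝ≥0∞ :=
  ⨆ y, ∫⁻ v in Ioc 0 t, stepOp P W v.toNNReal g y

variable {ρ : Measure S} {P : Measure Ω} [IsProbabilityMeasure P] {W : ℝ≥0 → Ω → S}
  {g h χ : S → ℝ≥0∞}

lemma IsParticleMotion.stepOp_le (hW : IsParticleMotion ρ P W) {B : ℝ≥0∞} (hB : ∀ x, h x ≤ B)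
    (s : ℝ≥0) (x : S) : stepOp P W s h x ≤ B := by
  have := hW.isProbabilityMeasure_stepLaw s
  exact (lintegral_mono fun y => hB (x + y)).trans_eq (by simp)

lemma IsParticleMotion.measurable_stepOp_left (hW : IsParticleMotion ρ P W) (hh : Measurable h)
    (x : S) : Measurable fun v : ℝ => stepOp P W v.toNNReal h x :=
  (hW.measurable_stepOp hh).comp (measurable_real_toNNReal.prodMk measurable_const)

lemma IsParticleMotion.supPotential_ne_top (hW : IsParticleMotion ρ P W) (ψ : TestFn S) (t : ℝ) :
    supPotential P W t ψ.toENNReal ≠ ∞ := by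
  obtain ⟨B, hB⟩ := ψ.exists_le
  refine ne_top_of_le_ne_top (ENNReal.mul_ne_top (ENNReal.coe_ne_top (r := B))
    (ENNReal.ofReal_ne_top (r := t))) (iSup_le fun y => ?_)
  refine (lintegral_mono fun v => hW.stepOp_le hB _ y).trans_eq ?_
  rw [setLIntegral_const, Real.volume_Ioc, sub_zero]

lemma IsParticleMotion.energy_le (hW : IsParticleMotion ρ P W) (hg : Measurable g) {B : ℝ≥0∞}
    (hB : ∀ x, h x ≤ B) (s : ℝ≥0) : energy ρ P W s g h ≤ (∫⁻ x, g x ∂ρ) * B := by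
  rw [← lintegral_mul_const _ hg]
  exact lintegral_mono fun x => mul_le_mul_right (hW.stepOp_le hB s x) _

lemma TestFn.exists_energy_le (hW : IsParticleMotion ρ P W) [ρ.IsAddHaarMeasure]
    (φ ψ : TestFn S) :
    ∃ B : ℝ≥0∞, B ≠ ∞ ∧ ∀ s, energy ρ P W s φ.toENNReal ψ.toENNReal ≤ B := by
  obtain ⟨B, hB⟩ := ψ.exists_le
  exact ⟨_, ENNReal.mul_ne_top φ.lintegral_ne_top (ENNReal.coe_ne_top (r := B)),
    fun s => hW.energy_le φ.measurable_toENNReal hB s⟩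

lemma IsParticleMotion.ofReal_semigroup (hW : IsParticleMotion ρ P W) (ψ : TestFn S) (s : ℝ≥0)
    (x : S) : ENNReal.ofReal (semigroup P W s ψ.1 x) = stepOp P W s ψ.toENNReal x := by
  have hm : Measurable fun ω => x + (W s ω - W 0 ω) := (hW.measurable_increment s 0).const_add x
  obtain ⟨C, hC⟩ := ψ.1.hasCompactSupport.exists_bound_of_continuous (map_continuous ψ.1)
  have hint : Integrable (fun ω => ψ.1 (x + (W s ω - W 0 ω))) P :=
    Integrable.of_bound ((map_continuous ψ.1).measurable.comp hm).aestronglyMeasurable C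
      (ae_of_all _ fun ω => hC _)
  rw [semigroup, ofReal_integral_eq_lintegral_ofReal hint (ae_of_all _ fun ω => ψ.nonneg _),
    stepOp, stepLaw, lintegral_map (f := fun y => ψ.toENNReal (x + y))
      (ψ.measurable_toENNReal.comp (by fun_prop)) (hW.measurable_increment s 0)]
  rfl

lemma semigroup_nonneg (ψ : TestFn S) (s : ℝ≥0) (x : S) : 0 ≤ semigroup P W s ψ.1 x :=
  integral_nonneg fun _ => ψ.nonneg _

lemma IsParticleMotion.semigroup_eq (hW : IsParticleMotion ρ P W) (ψ : TestFn S) (s : ℝ≥0)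
    (x : S) : semigroup P W s ψ.1 x = (stepOp P W s ψ.toENNReal x).toReal := by
  rw [← hW.ofReal_semigroup, ENNReal.toReal_ofReal (semigroup_nonneg ψ s x)]

lemma IsParticleMotion.green_eq (hW : IsParticleMotion ρ P W) (ψ : TestFn S) (x : S) :
    green P W ψ x = ∫⁻ s in Ioi (0 : ℝ), stepOp P W s.toNNReal ψ.toENNReal x := by
  simp only [green, hW.ofReal_semigroup]

lemma IsParticleMotion.stepOp_ne_top (hW : IsParticleMotion ρ P W) (ψ : TestFn S) (s : ℝ≥0)
    (x : S) : stepOp P W s ψ.toENNReal x ≠ ∞ := by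
  rw [← hW.ofReal_semigroup]; exact ENNReal.ofReal_ne_top

lemma IsParticleMotion.greenUpTo_eq (hW : IsParticleMotion ρ P W) (ψ : TestFn S) (x : S) {t : ℝ}
    (ht : 0 ≤ t) : greenUpTo P W t ψ.1 x
      = (∫⁻ s in Ioc 0 t, stepOp P W s.toNNReal ψ.toENNReal x).toReal := by
  rw [toReal_setLIntegral_Ioc (hW.measurable_stepOp_left ψ.measurable_toENNReal x)
    (fun u => hW.stepOp_ne_top ψ _ x) ht]
  simp only [greenUpTo, hW.semigroup_eq]

lemma IsParticleMotion.lintegral_mul_setLIntegral_stepOp [ρ.IsAddHaarMeasure]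
    (hW : IsParticleMotion ρ P W) (hg : Measurable g) (hh : Measurable h) (I : Set ℝ) :
    ∫⁻ x, g x * (∫⁻ s in I, stepOp P W s.toNNReal h x) ∂ρ
      = ∫⁻ s in I, energy ρ P W s.toNNReal g h := by
  have hm : Measurable fun q : S × ℝ => g q.1 * stepOp P W q.2.toNNReal h q.1 :=
    (hg.comp measurable_fst).mul ((hW.measurable_stepOp hh).comp
      ((measurable_real_toNNReal.comp measurable_snd).prodMk measurable_fst))
  have h1 : ∀ x, g x * (∫⁻ s in I, stepOp P W s.toNNReal h x)
      = ∫⁻ s in I, g x * stepOp P W s.toNNReal h x := fun x =>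
    (lintegral_const_mul _ (hW.measurable_stepOp_left hh x)).symm
  simp only [h1]
  exact lintegral_lintegral_swap hm.aemeasurable

lemma IsParticleMotion.measurable_setLIntegral_stepOp (hW : IsParticleMotion ρ P W)
    (hh : Measurable h) (I : Set ℝ) :
    Measurable fun x => ∫⁻ s in I, stepOp P W s.toNNReal h x :=
  Measurable.lintegral_prod_right' (f := fun q : S × ℝ => stepOp P W q.2.toNNReal h q.1)
    ((hW.measurable_stepOp hh).comp
      ((measurable_real_toNNReal.comp measurable_snd).prodMk measurable_fst))

/-- Pairing a test function with a finite potential. -/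
lemma IsParticleMotion.integral_mul_toReal_setLIntegral_stepOp [ρ.IsAddHaarMeasure]
    (hW : IsParticleMotion ρ P W) (φ ψ : TestFn S) (I : Set ℝ)
    (hfin : ∀ x, ∫⁻ s in I, stepOp P W s.toNNReal ψ.toENNReal x ≠ ∞) :
    ∫ x, φ.1 x * (∫⁻ s in I, stepOp P W s.toNNReal ψ.toENNReal x).toReal ∂ρ
      = (∫⁻ s in I, energy ρ P W s.toNNReal φ.toENNReal ψ.toENNReal).toReal := by
  have hm := hW.measurable_setLIntegral_stepOp ψ.measurable_toENNReal I
  rw [← hW.lintegral_mul_setLIntegral_stepOp φ.measurable_toENNReal ψ.measurable_toENNReal,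
    ← integral_toReal
      (f := fun x => φ.toENNReal x * ∫⁻ s in I, stepOp P W s.toNNReal ψ.toENNReal x)
      (φ.measurable_toENNReal.mul hm).aemeasurable
      (ae_of_all _ fun x => ENNReal.mul_lt_top ENNReal.ofReal_lt_top (hfin x).lt_top)]
  refine integral_congr_ae (ae_of_all _ fun x => ?_)
  simp only [ENNReal.toReal_mul, TestFn.toENNReal, ENNReal.toReal_ofReal (φ.nonneg x)]

lemma IsParticleMotion.integral_mul_greenUpTo [ρ.IsAddHaarMeasure]
    (hW : IsParticleMotion ρ P W) (φ ψ : TestFn S) {t : ℝ} (ht : 0 ≤ t) :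
    ∫ x, φ.1 x * greenUpTo P W t ψ.1 x ∂ρ
      = (∫⁻ s in Ioc 0 t, energy ρ P W s.toNNReal φ.toENNReal ψ.toENNReal).toReal := by
  simp only [hW.greenUpTo_eq ψ _ ht]
  refine hW.integral_mul_toReal_setLIntegral_stepOp φ ψ _ fun x => ?_
  obtain ⟨B, hB⟩ := ψ.exists_le
  exact setLIntegral_Ioc_ne_top (ENNReal.coe_ne_top (r := B)) fun u _ => hW.stepOp_le hB _ x

/-- In the transient case the truncated potentials converge to the Green potential. -/
lemma IsParticleMotion.tendsto_energy_green [ρ.IsAddHaarMeasure] (hW : IsParticleMotion ρ P W)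
    (htr : IsTransientMotion P W) (φ ψ : TestFn S) :
    Tendsto (fun t : ℝ =>
      (∫⁻ s in Ioc 0 t, energy ρ P W s.toNNReal φ.toENNReal ψ.toENNReal).toReal) atTop
      (𝓝 (∫ x, φ.1 x * (green P W ψ x).toReal ∂ρ)) := by
  have hfin : ∀ x, green P W ψ x ≠ ∞ := fun x =>
    ((le_iSup (fun x => green P W ψ x) x).trans_lt (htr ψ)).ne
  have hem := (hW.measurable_energy φ.measurable_toENNReal ψ.measurable_toENNReal).comp
    measurable_real_toNNReal
  simp only [hW.green_eq] at hfin ⊢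
  rw [hW.integral_mul_toReal_setLIntegral_stepOp φ ψ _ hfin]
  refine (ENNReal.tendsto_toReal ?_).comp ?_
  · rw [← hW.lintegral_mul_setLIntegral_stepOp φ.measurable_toENNReal ψ.measurable_toENNReal]
    refine ne_top_of_le_ne_top
      (ENNReal.mul_ne_top (φ.lintegral_ne_top (ρ := ρ)) (htr ψ).ne) ?_
    rw [← lintegral_mul_const _ φ.measurable_toENNReal]
    refine lintegral_mono fun x => mul_le_mul_right ?_ _
    rw [← hW.green_eq]
    exact le_iSup (fun x => green P W ψ x) x
  · have h1 := (aecover_Iic (μ := volume.restrict (Ioi (0 : ℝ)))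
      (tendsto_id (x := atTop))).lintegral_tendsto_of_countably_generated hem.aemeasurable
    refine h1.congr fun t => ?_
    rw [Measure.restrict_restrict measurableSet_Iic, inter_comm, id, Ioi_inter_Iic]
    rfl

lemma IsParticleMotion.tendsto_supPotential_sq_div_of_transient (hW : IsParticleMotion ρ P W)
    (htr : IsTransientMotion P W) {a : ℝ → ℝ} (ha : Tendsto a atTop atTop) (ψ : TestFn S) :
    Tendsto (fun t => (supPotential P W t ψ.toENNReal).toReal ^ 2 / a t) atTop (𝓝 0) := by
  have hle : ∀ t, (supPotential P W t ψ.toENNReal).toReal ≤ (⨆ x, green P W ψ x).toReal := by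
    intro t
    refine ENNReal.toReal_mono (htr ψ).ne (iSup_mono fun y => ?_ : supPotential P W t _ ≤ _)
    rw [hW.green_eq]
    exact lintegral_mono_set Ioc_subset_Ioi_self
  refine squeeze_zero' ?_ ?_ (tendsto_const_nhds (x := (⨆ x, green P W ψ x).toReal ^ 2).div_atTop ha)
  · filter_upwards [ha.eventually_gt_atTop 0] with t ht
    positivity
  · filter_upwards [ha.eventually_gt_atTop 0] with t ht
    exact div_le_div_of_nonneg_right (pow_le_pow_left₀ ENNReal.toReal_nonneg (hle t) 2) ht.le

/-- If the group has infinite Haar measure and the covariances are of order `a`, then the squares of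
the truncated potentials are of smaller order. -/
lemma IsParticleMotion.tendsto_supPotential_sq_div [ρ.IsAddHaarMeasure]
    (hW : IsParticleMotion ρ P W) (hρ : ρ univ = ∞) {a : ℝ → ℝ} (ha : ∀ᶠ t in atTop, 0 < a t)
    {H : TestFn S → ℝ} (hH : ∀ χ : TestFn S, Tendsto (fun t => (a t)⁻¹ * ∫ r in (0 : ℝ)..t,
      (∫⁻ u in Ioc 0 r, energy ρ P W u.toNNReal χ.toENNReal χ.toENNReal).toReal) atTop (𝓝 (H χ)))
    (ψ : TestFn S) :
    Tendsto (fun t => (supPotential P W t ψ.toENNReal).toReal ^ 2 / a t) atTop (𝓝 0) := by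
  obtain ⟨χ, C, hC, hψ⟩ := ψ.exists_le_autocorrelation ρ
  have hχ := χ.measurable_toENNReal
  obtain ⟨B, hB, hBle⟩ := χ.exists_energy_le hW χ
  set k : ℝ → ℝ≥0∞ := fun u => energy ρ P W u.toNNReal χ.toENNReal χ.toENNReal with hk
  have hkanti : Antitone k := (hW.antitone_energy hχ).comp_monotone fun _ _ => Real.toNNReal_mono
  have hk0 : Tendsto k atTop (𝓝 0) :=
    (hW.tendsto_energy_atTop hρ hχ χ.lintegral_ne_top χ.lintegral_mul_self_ne_top).comp
      tendsto_real_toNNReal_atTop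
  have hmain := (tendsto_sq_div_of_antitone hkanti hB (fun u => hBle _) hk0 ha (hH χ)).const_mul
    (C.toReal ^ 2)
  rw [mul_zero] at hmain
  have hle : ∀ t, (supPotential P W t ψ.toENNReal).toReal
      ≤ C.toReal * (∫⁻ u in Ioc 0 t, k u).toReal := by
    intro t
    rw [← ENNReal.toReal_mul]
    refine ENNReal.toReal_mono (ENNReal.mul_ne_top hC
      (setLIntegral_Ioc_ne_top hB fun u _ => hBle _)) (iSup_le fun y => ?_)
    rw [← lintegral_const_mul _ hkanti.measurable]
    refine lintegral_mono fun u => ?_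
    calc stepOp P W u.toNNReal ψ.toENNReal y
        ≤ stepOp P W u.toNNReal (fun x => C * autocorrelation ρ χ.toENNReal x) y :=
          stepOp_mono _ hψ y
      _ = C * stepOp P W u.toNNReal (autocorrelation ρ χ.toENNReal) y :=
          lintegral_const_mul' _ _ hC
      _ ≤ C * k u := mul_le_mul_right (hW.stepOp_autocorrelation_le hχ _ y) _
  refine squeeze_zero' ?_ ?_ hmain
  · filter_upwards [ha] with t ht
    positivity
  · filter_upwards [ha] with t ht
    calc (supPotential P W t ψ.toENNReal).toReal ^ 2 / a t
        ≤ (C.toReal * (∫⁻ u in Ioc 0 t, k u).toReal) ^ 2 / a t := by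
          gcongr
          exact hle t
      _ = _ := by ring

end Potentials

/-! ### Occupation time fluctuations as sums over particles -/

section System

variable {S : Type*} [AddCommGroup S] [TopologicalSpace S] [IsTopologicalAddGroup S]
    [LocallyCompactSpace S] [T2Space S] [SecondCountableTopology S]
    [MeasurableSpace S] [BorelSpace S]
    {Ω₀ : Type*} [MeasurableSpace Ω₀] {Ω : Type*} [MeasurableSpace Ω]
    {ρ : Measure S} {P₀ : Measure Ω₀} [IsProbabilityMeasure P₀] {W : ℝ≥0 → Ω₀ → S}
    {P : Measure Ω} [IsProbabilityMeasure P] {κ : Ω → ℕ∞} {Z : ℕ → ℝ≥0 → Ω → S}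

/-- The occupation time functional of a test function, as a real number. -/
def occupationReal (t : ℝ) (φ : TestFn S) (p : S × (ℝ≥0 → S)) : ℝ :=
  (occupation t φ.toENNReal p).toReal

lemma occupation_ne_top (t : ℝ) (φ : TestFn S) (p : S × (ℝ≥0 → S)) :
    occupation t φ.toENNReal p ≠ ∞ := by
  obtain ⟨B, hB⟩ := φ.exists_le
  exact setLIntegral_Ioc_ne_top (ENNReal.coe_ne_top (r := B)) fun u _ => hB _

lemma occupationReal_nonneg (t : ℝ) (φ : TestFn S) (p : S × (ℝ≥0 → S)) :
    0 ≤ occupationReal t φ p := ENNReal.toReal_nonneg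

lemma measurable_occupationReal (t : ℝ) (φ : TestFn S) :
    Measurable (occupationReal (S := S) t φ) :=
  (measurable_occupation φ.measurable_toENNReal t).ennreal_toReal

/-- The displacement path of a particle. -/
def displacement (Z : ℕ → ℝ≥0 → Ω → S) (i : ℕ) (ω : Ω) (t : ℝ≥0) : S := Z i t ω - Z i 0 ω

lemma IsZeroLevelSystem.measurable_displacement (hZ : IsZeroLevelSystem ρ P₀ W P κ Z) (i : ℕ) :
    Measurable (displacement Z i) :=
  measurable_pi_lambda _ fun t => (hZ.measurable_position i t).sub (hZ.measurable_position i 0)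

lemma IsZeroLevelSystem.map_displacement (hZ : IsZeroLevelSystem ρ P₀ W P κ Z) (i : ℕ) :
    P.map (displacement Z i) = motionLaw P₀ W := (hZ.motion_law i).map_eq

lemma IsZeroLevelSystem.ae_position_eq (hZ : IsZeroLevelSystem ρ P₀ W P κ Z) :
    ∀ᵐ ω ∂P, ∀ i s, Z i s ω = Z i 0 ω + regEval s (displacement Z i ω) := by
  rw [ae_all_iff]
  intro i
  filter_upwards [hZ.cadlag i] with ω hω s
  have : regEval s (displacement Z i ω) = displacement Z i ω s :=
    regEval_eq ((hω s).1.sub continuousWithinAt_const)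
  rw [this, displacement, add_sub_cancel]

lemma integral_empiricalMeasure (φ : TestFn S) (s : ℝ≥0) (ω : Ω) :
    ∫ x, φ.1 x ∂(empiricalMeasure κ Z s ω)
      = (∑' i : ℕ, if (i : ℕ∞) < κ ω then φ.toENNReal (Z i s ω) else 0).toReal := by
  rw [integral_eq_lintegral_of_nonneg_ae (ae_of_all _ φ.nonneg)
    (map_continuous φ.1).measurable.aestronglyMeasurable, ← lintegral_empiricalMeasure]
  · rfl
  · exact φ.measurable_toENNReal

/-- The number of particles at time `s`, weighted by `g`, written through the jointly measurable
version of the paths. -/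
def weightedCount (κ : Ω → ℕ∞) (Z : ℕ → ℝ≥0 → Ω → S) (g : S → ℝ≥0∞) (s : ℝ) (ω : Ω) : ℝ≥0∞ :=
  ∑' i : ℕ, if (i : ℕ∞) < κ ω then g (Z i 0 ω + regEval s.toNNReal (displacement Z i ω)) else 0

lemma IsZeroLevelSystem.measurable_weightedCount (hZ : IsZeroLevelSystem ρ P₀ W P κ Z)
    {g : S → ℝ≥0∞} (hg : Measurable g) :
    Measurable fun q : Ω × ℝ => weightedCount κ Z g q.2 q.1 := by
  refine Measurable.tsum fun i => Measurable.ite ?_ ?_ measurable_const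
  · exact measurable_fst (measurableSet_index_lt hZ.measurable_number i)
  · exact (measurable_evaluation hg).comp
      (f := fun q : Ω × ℝ => ((Z i 0 q.1, displacement Z i q.1), q.2))
      ((((hZ.measurable_position i 0).comp measurable_fst).prodMk
        ((hZ.measurable_displacement i).comp measurable_fst)).prodMk measurable_snd)

lemma IsZeroLevelSystem.ae_occupationFluctuation_eq_integral
    (hZ : IsZeroLevelSystem ρ P₀ W P κ Z) (φ : TestFn S) :
    ∀ᵐ ω ∂P, ∀ t, occupationFluctuation ρ (empiricalMeasure κ Z) t φ.1 ω
      = ∫ s in (0 : ℝ)..t, ((weightedCount κ Z φ.toENNReal s ω).toReal - ∫ x, φ.1 x ∂ρ) := by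
  filter_upwards [hZ.ae_position_eq] with ω hω t
  simp only [occupationFluctuation, integral_empiricalMeasure, weightedCount, ← hω]

/-- All `t` are included, also negative ones, where only the initial configuration enters. -/
lemma IsZeroLevelSystem.aemeasurable_occupationFluctuation
    (hZ : IsZeroLevelSystem ρ P₀ W P κ Z) (φ : TestFn S) (t : ℝ) :
    AEMeasurable (occupationFluctuation ρ (empiricalMeasure κ Z) t φ.1) P := by
  have h1 : StronglyMeasurable fun q : Ω × ℝ =>
      (weightedCount κ Z φ.toENNReal q.2 q.1).toReal - ∫ x, φ.1 x ∂ρ :=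
    ((hZ.measurable_weightedCount φ.measurable_toENNReal).ennreal_toReal.sub_const _).stronglyMeasurable
  have h2 : ∀ I : Set ℝ, StronglyMeasurable fun ω =>
      ∫ s in I, ((weightedCount κ Z φ.toENNReal s ω).toReal - ∫ x, φ.1 x ∂ρ) := fun I =>
    h1.integral_prod_right' (ν := volume.restrict I)
  refine ((h2 (Ioc 0 t)).sub (h2 (Ioc t 0))).measurable.aemeasurable.congr ?_
  filter_upwards [hZ.ae_occupationFluctuation_eq_integral φ] with ω hω
  rw [hω t]
  rfl

lemma setLIntegral_weightedCount
    {g : S → ℝ≥0∞} (hg : Measurable g) (t : ℝ) (ω : Ω) :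
    ∫⁻ s in Ioc 0 t, weightedCount κ Z g s ω = ∑' i : ℕ, if (i : ℕ∞) < κ ω then
      occupation t g (Z i 0 ω, displacement Z i ω) else 0 := by
  simp only [weightedCount]
  have hm : ∀ i, Measurable fun s : ℝ =>
      g (Z i 0 ω + regEval s.toNNReal (displacement Z i ω)) := fun i =>
    (measurable_evaluation hg).comp
      (f := fun s : ℝ => ((Z i 0 ω, displacement Z i ω), s)) (by fun_prop)
  rw [lintegral_tsum]
  · refine tsum_congr fun i => ?_
    split_ifs
    · rfl
    · simp
  · intro i
    split_ifs
    · exact (hm i).aemeasurable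
    · exact aemeasurable_const

variable [ρ.IsAddHaarMeasure]

lemma IsZeroLevelSystem.ae_tsum_ne_top (hW : IsParticleMotion ρ P₀ W)
    (hZ : IsZeroLevelSystem ρ P₀ W P κ Z) (φ : TestFn S) (t : ℝ) :
    ∀ᵐ ω ∂P, (∑' i : ℕ, if (i : ℕ∞) < κ ω then
      occupation t φ.toENNReal (Z i 0 ω, displacement Z i ω) else 0) ≠ ∞ := by
  have := hW.isProbabilityMeasure_motionLaw
  have hm := measurable_occupation φ.measurable_toENNReal t
  have h1 := lintegral_tsum_markedPoisson hZ.measurable_number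
    (fun i => hZ.measurable_position i 0) hZ.initial_poisson hZ.measurable_displacement
    hZ.map_displacement hZ.initial_indep_motions hm
  rw [hW.lintegral_occupation φ.measurable_toENNReal] at h1
  have h2 : Measurable fun ω => ∑' i : ℕ, if (i : ℕ∞) < κ ω then
      occupation t φ.toENNReal (Z i 0 ω, displacement Z i ω) else 0 :=
    Measurable.tsum fun i => Measurable.ite (measurableSet_index_lt hZ.measurable_number i)
      (hm.comp ((hZ.measurable_position i 0).prodMk (hZ.measurable_displacement i)))
      measurable_const
  filter_upwards [ae_lt_top h2 (by
    rw [h1]; exact ENNReal.mul_ne_top ENNReal.ofReal_ne_top φ.lintegral_ne_top)] with ω hω using hω.ne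

/-- The occupation time fluctuation is a centred sum over the particles. -/
lemma IsZeroLevelSystem.ae_occupationFluctuation_eq (hW : IsParticleMotion ρ P₀ W)
    (hZ : IsZeroLevelSystem ρ P₀ W P κ Z) (φ : TestFn S) {t : ℝ} (ht : 0 ≤ t) :
    ∀ᵐ ω ∂P, (Summable fun i : ℕ => if (i : ℕ∞) < κ ω then
        occupationReal t φ (Z i 0 ω, displacement Z i ω) else 0) ∧
      occupationFluctuation ρ (empiricalMeasure κ Z) t φ.1 ω
        = (∑' i : ℕ, if (i : ℕ∞) < κ ω then
            occupationReal t φ (Z i 0 ω, displacement Z i ω) else 0) - t * ∫ x, φ.1 x ∂ρ := by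
  filter_upwards [hZ.ae_occupationFluctuation_eq_integral φ, hZ.ae_tsum_ne_top hW φ t] with ω h1 h2
  have e1 : ∀ i : ℕ, (if (i : ℕ∞) < κ ω then
      occupationReal t φ (Z i 0 ω, displacement Z i ω) else 0)
      = (if (i : ℕ∞) < κ ω then
        occupation t φ.toENNReal (Z i 0 ω, displacement Z i ω) else 0).toReal := fun i => by
    split_ifs
    · rfl
    · simp
  simp only [e1]
  refine ⟨ENNReal.summable_toReal h2, ?_⟩
  have hm : Measurable fun s => weightedCount κ Z φ.toENNReal s ω :=
    (hZ.measurable_weightedCount φ.measurable_toENNReal).comp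
      (measurable_const.prodMk measurable_id)
  have h3 := setLIntegral_weightedCount (κ := κ) (Z := Z) φ.measurable_toENNReal t ω
  rw [← h3] at h2
  rw [h1 t, intervalIntegral.integral_sub (intervalIntegrable_toReal hm ht h2)
    intervalIntegrable_const, intervalIntegral.integral_of_le ht,
    integral_toReal hm.aemeasurable (ae_lt_top hm h2), h3, ENNReal.tsum_toReal_eq]
  · simp
  · intro i
    split_ifs
    · exact occupation_ne_top t φ _
    · exact ENNReal.zero_ne_top

end System

/-! ### Characteristic function of the fluctuations -/

section Convergence

variable {S : Type*} [AddCommGroup S] [TopologicalSpace S] [IsTopologicalAddGroup S]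
    [LocallyCompactSpace S] [T2Space S] [SecondCountableTopology S]
    [MeasurableSpace S] [BorelSpace S]
    {Ω₀ : Type*} [MeasurableSpace Ω₀] {Ω : Type*} [MeasurableSpace Ω]
    {ρ : Measure S} [ρ.IsAddHaarMeasure]
    {P₀ : Measure Ω₀} [IsProbabilityMeasure P₀] {W : ℝ≥0 → Ω₀ → S}
    {P : Measure Ω} [IsProbabilityMeasure P] {κ : Ω → ℕ∞} {Z : ℕ → ℝ≥0 → Ω → S}

lemma IsParticleMotion.integrable_occupationReal (hW : IsParticleMotion ρ P₀ W) (t : ℝ)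
    (φ : TestFn S) : Integrable (occupationReal t φ) (ρ.prod (motionLaw P₀ W)) := by
  refine integrable_toReal_of_lintegral_ne_top
    (measurable_occupation φ.measurable_toENNReal t).aemeasurable ?_
  rw [hW.lintegral_occupation φ.measurable_toENNReal]
  exact ENNReal.mul_ne_top ENNReal.ofReal_ne_top φ.lintegral_ne_top

lemma IsParticleMotion.integral_occupationReal (hW : IsParticleMotion ρ P₀ W) {t : ℝ}
    (ht : 0 ≤ t) (φ : TestFn S) :
    ∫ p, occupationReal t φ p ∂(ρ.prod (motionLaw P₀ W)) = t * ∫ x, φ.1 x ∂ρ := by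
  simp only [occupationReal]
  rw [integral_toReal (measurable_occupation φ.measurable_toENNReal t).aemeasurable
    (ae_of_all _ fun p => (occupation_ne_top t φ p).lt_top),
    hW.lintegral_occupation φ.measurable_toENNReal, φ.lintegral_toENNReal, ENNReal.toReal_mul,
    ENNReal.toReal_ofReal ht, ENNReal.toReal_ofReal (integral_nonneg φ.nonneg)]

lemma IsParticleMotion.lintegral_occupation_mul_ne_top (hW : IsParticleMotion ρ P₀ W) (t : ℝ)
    (φ ψ : TestFn S) :
    ∫⁻ p, occupation t φ.toENNReal p * occupation t ψ.toENNReal p ∂(ρ.prod (motionLaw P₀ W))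
      ≠ ∞ := by
  obtain ⟨B, hB, hle⟩ := φ.exists_energy_le hW ψ
  rw [hW.lintegral_occupation_mul φ.measurable_toENNReal ψ.measurable_toENNReal]
  refine ENNReal.mul_ne_top ENNReal.ofNat_ne_top
    (setLIntegral_Ioc_ne_top (B := ∫⁻ u in Ioc 0 t,
      energy ρ P₀ W u.toNNReal φ.toENNReal ψ.toENNReal)
      (setLIntegral_Ioc_ne_top hB fun u _ => hle _) fun r hr => ?_)
  exact lintegral_mono_set (Ioc_subset_Ioc_right hr.2)

lemma occupationReal_mul (t : ℝ) (φ ψ : TestFn S) (p : S × (ℝ≥0 → S)) :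
    occupationReal t φ p * occupationReal t ψ p
      = (occupation t φ.toENNReal p * occupation t ψ.toENNReal p).toReal :=
  ENNReal.toReal_mul.symm

lemma IsParticleMotion.integrable_occupationReal_mul (hW : IsParticleMotion ρ P₀ W) (t : ℝ)
    (φ ψ : TestFn S) : Integrable (fun p => occupationReal t φ p * occupationReal t ψ p)
      (ρ.prod (motionLaw P₀ W)) := by
  simp only [occupationReal_mul]
  exact integrable_toReal_of_lintegral_ne_top
    ((measurable_occupation φ.measurable_toENNReal t).mul
      (measurable_occupation ψ.measurable_toENNReal t)).aemeasurable
    (hW.lintegral_occupation_mul_ne_top t φ ψ)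

lemma integral_occupationReal_mul_eq_toReal (t : ℝ)
    (φ ψ : TestFn S) :
    ∫ p, occupationReal t φ p * occupationReal t ψ p ∂(ρ.prod (motionLaw P₀ W))
      = (∫⁻ p, occupation t φ.toENNReal p * occupation t ψ.toENNReal p
        ∂(ρ.prod (motionLaw P₀ W))).toReal := by
  simp only [occupationReal_mul]
  exact integral_toReal ((measurable_occupation φ.measurable_toENNReal t).mul
      (measurable_occupation ψ.measurable_toENNReal t)).aemeasurable
    (ae_of_all _ fun p => ENNReal.mul_lt_top (occupation_ne_top t φ p).lt_top
      (occupation_ne_top t ψ p).lt_top)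

lemma IsParticleMotion.integral_occupationReal_mul (hW : IsParticleMotion ρ P₀ W) {t : ℝ}
    (ht : 0 ≤ t) (φ ψ : TestFn S) :
    ∫ p, occupationReal t φ p * occupationReal t ψ p ∂(ρ.prod (motionLaw P₀ W))
      = 2 * ∫ r in (0 : ℝ)..t,
        (∫⁻ u in Ioc 0 r, energy ρ P₀ W u.toNNReal φ.toENNReal ψ.toENNReal).toReal := by
  obtain ⟨B, hB, hle⟩ := φ.exists_energy_le hW ψ
  rw [integral_occupationReal_mul_eq_toReal,
    hW.lintegral_occupation_mul φ.measurable_toENNReal ψ.measurable_toENNReal, ENNReal.toReal_mul,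
    toReal_setLIntegral_Ioc measurable_setLIntegral_Ioc
      (fun r => setLIntegral_Ioc_ne_top hB fun u _ => hle _) ht]
  simp

lemma IsParticleMotion.integrable_occupationReal_cube (hW : IsParticleMotion ρ P₀ W) (t : ℝ)
    (ψ : TestFn S) :
    Integrable (fun p => occupationReal t ψ p ^ 3) (ρ.prod (motionLaw P₀ W)) ∧
    ∫ p, occupationReal t ψ p ^ 3 ∂(ρ.prod (motionLaw P₀ W))
      ≤ 4 * (supPotential P₀ W t ψ.toENNReal).toReal *
        ∫ p, occupationReal t ψ p * occupationReal t ψ p ∂(ρ.prod (motionLaw P₀ W)) := by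
  have hm := (measurable_occupation ψ.measurable_toENNReal t).pow_const 3
  have hle := hW.lintegral_occupation_cube_le ψ.measurable_toENNReal t
  change _ ≤ 4 * supPotential P₀ W t ψ.toENNReal * _ at hle
  have hfin : 4 * supPotential P₀ W t ψ.toENNReal *
      ∫⁻ p, occupation t ψ.toENNReal p * occupation t ψ.toENNReal p
        ∂(ρ.prod (motionLaw P₀ W)) ≠ ∞ :=
    ENNReal.mul_ne_top (ENNReal.mul_ne_top ENNReal.ofNat_ne_top (hW.supPotential_ne_top ψ t))
      (hW.lintegral_occupation_mul_ne_top t ψ ψ)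
  simp only [occupationReal, ← ENNReal.toReal_pow]
  refine ⟨integrable_toReal_of_lintegral_ne_top hm.aemeasurable (ne_top_of_le_ne_top hfin hle), ?_⟩
  rw [integral_toReal hm.aemeasurable
    (ae_of_all _ fun p => ENNReal.pow_lt_top (occupation_ne_top t ψ p).lt_top)]
  have h1 := integral_occupationReal_mul_eq_toReal (ρ := ρ) (P₀ := P₀) (W := W) t ψ ψ
  simp only [occupationReal] at h1
  rw [h1]
  simpa [ENNReal.toReal_mul] using ENNReal.toReal_mono hfin hle

/-- A combination of test functions with non-negative coefficients `|θ i|`. -/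
def TestFn.absCombination {ι : Type*} [Fintype ι] (θ : ι → ℝ) (φ : ι → TestFn S) : TestFn S :=
  ⟨∑ i, |θ i| • (φ i).1, Finset.sum_nonneg fun i _ => by
    intro x
    simpa using mul_nonneg (abs_nonneg (θ i)) ((φ i).nonneg x)⟩

lemma occupationReal_absCombination {ι : Type*} [Fintype ι] (θ : ι → ℝ) (φ : ι → TestFn S) (t : ℝ)
    (p : S × (ℝ≥0 → S)) :
    occupationReal t (TestFn.absCombination θ φ) p = ∑ i, |θ i| * occupationReal t (φ i) p := by
  have h1 : ∀ x, (TestFn.absCombination θ φ).toENNReal x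
      = ∑ i, ENNReal.ofReal |θ i| * (φ i).toENNReal x := by
    intro x
    simp only [TestFn.toENNReal, TestFn.absCombination,
      CompactlySupportedContinuousMap.coe_sum, Finset.sum_apply,
      CompactlySupportedContinuousMap.coe_smul, Pi.smul_apply, smul_eq_mul]
    rw [ENNReal.ofReal_sum_of_nonneg fun i _ => mul_nonneg (abs_nonneg _) ((φ i).nonneg x)]
    exact Finset.sum_congr rfl fun i _ => ENNReal.ofReal_mul (abs_nonneg _)
  have hm : ∀ i, Measurable fun s : ℝ => (φ i).toENNReal (p.1 + regEval s.toNNReal p.2) :=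
    fun i => (measurable_evaluation (φ i).measurable_toENNReal).comp
      (measurable_const.prodMk measurable_id)
  have h2 : occupation t (TestFn.absCombination θ φ).toENNReal p
      = ∑ i, ENNReal.ofReal |θ i| * occupation t (φ i).toENNReal p := by
    simp only [occupation, h1]
    rw [lintegral_finsetSum _ fun i _ => (hm i).const_mul _]
    exact Finset.sum_congr rfl fun i _ => lintegral_const_mul _ (hm i)
  rw [occupationReal, h2, ENNReal.toReal_sum fun i _ =>
    ENNReal.mul_ne_top ENNReal.ofReal_ne_top (occupation_ne_top t (φ i) p)]
  simp [ENNReal.toReal_mul, occupationReal]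

lemma IsParticleMotion.integrable_sum_sq (hW : IsParticleMotion ρ P₀ W) {ι : Type*} (s : Finset ι)
    (c : ι → ℝ) (φ : ι → TestFn S) (t : ℝ) :
    Integrable (fun p => (∑ i ∈ s, c i * occupationReal t (φ i) p) ^ 2)
      (ρ.prod (motionLaw P₀ W)) ∧
    ∫ p, (∑ i ∈ s, c i * occupationReal t (φ i) p) ^ 2 ∂(ρ.prod (motionLaw P₀ W))
      = ∑ i ∈ s, ∑ j ∈ s, c i * c j *
        ∫ p, occupationReal t (φ i) p * occupationReal t (φ j) p ∂(ρ.prod (motionLaw P₀ W)) := by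
  have h1 : ∀ p, (∑ i ∈ s, c i * occupationReal t (φ i) p) ^ 2
      = ∑ i ∈ s, ∑ j ∈ s, c i * c j * (occupationReal t (φ i) p * occupationReal t (φ j) p) := by
    intro p
    rw [sq, Finset.sum_mul_sum]
    exact Finset.sum_congr rfl fun i _ => Finset.sum_congr rfl fun j _ => by ring
  have h2 : ∀ i j, Integrable
      (fun p => c i * c j * (occupationReal t (φ i) p * occupationReal t (φ j) p))
      (ρ.prod (motionLaw P₀ W)) := fun i j =>
    (hW.integrable_occupationReal_mul t (φ i) (φ j)).const_mul _
  simp only [h1]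
  refine ⟨integrable_finsetSum _ fun i _ => integrable_finsetSum _ fun j _ => h2 i j, ?_⟩
  rw [integral_finsetSum _ fun i _ => integrable_finsetSum _ fun j _ => h2 i j]
  refine Finset.sum_congr rfl fun i _ => ?_
  rw [integral_finsetSum _ fun j _ => h2 i j]
  exact Finset.sum_congr rfl fun j _ => integral_const_mul _ _

/-- The characteristic function of linear combinations of the occupation time fluctuations. -/
lemma IsZeroLevelSystem.integral_cexp_occupationFluctuation (hW : IsParticleMotion ρ P₀ W)
    (hZ : IsZeroLevelSystem ρ P₀ W P κ Z) {ι : Type*} [Fintype ι] (θ : ι → ℝ) (φ : ι → TestFn S)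
    (b : ℝ) {t : ℝ} (ht : 0 ≤ t) :
    ∫ ω, Complex.exp ((∑ i, θ i *
        (b * occupationFluctuation ρ (empiricalMeasure κ Z) t (φ i).1 ω) : ℝ) * Complex.I) ∂P
      = Complex.exp (∫ p, (Complex.exp ((b * ∑ i, θ i * occupationReal t (φ i) p : ℝ) * Complex.I)
          - 1 - (b * ∑ i, θ i * occupationReal t (φ i) p : ℝ) * Complex.I)
          ∂(ρ.prod (motionLaw P₀ W))) := by
  have := hW.isProbabilityMeasure_motionLaw
  set m := ρ.prod (motionLaw P₀ W) with hm
  set V : S × (ℝ≥0 → S) → ℝ := fun p => b * ∑ i, θ i * occupationReal t (φ i) p with hV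
  have hVm : Measurable V := (Finset.measurable_fun_sum _ fun i _ =>
    (measurable_occupationReal t (φ i)).const_mul _).const_mul b
  have hVi : Integrable V m := (integrable_finsetSum _ fun i _ =>
    (hW.integrable_occupationReal t (φ i)).const_mul _).const_mul b
  have hVint : ∫ p, V p ∂m = b * ∑ i, θ i * (t * ∫ x, (φ i).1 x ∂ρ) := by
    simp only [hV]
    rw [integral_const_mul, integral_finsetSum _ fun i _ =>
      (hW.integrable_occupationReal t (φ i)).const_mul _]
    simp only [integral_const_mul, hW.integral_occupationReal ht]
  obtain ⟨-, hchar⟩ := integral_cexp_tsum_markedPoisson hZ.measurable_number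
    (fun i => hZ.measurable_position i 0) hZ.initial_poisson hZ.measurable_displacement
    hZ.map_displacement hZ.motions_indep hZ.initial_indep_motions hVm hVi
  have hae : ∀ᵐ ω ∂P, (∑ i, θ i *
      (b * occupationFluctuation ρ (empiricalMeasure κ Z) t (φ i).1 ω))
      = (∑' i : ℕ, if (i : ℕ∞) < κ ω then V (Z i 0 ω, displacement Z i ω) else 0)
        - ∫ p, V p ∂m := by
    have h1 := ae_all_iff.2 fun i => hZ.ae_occupationFluctuation_eq hW (φ i) ht
    filter_upwards [h1] with ω hω
    have h2 : ∀ k : ℕ, (if (k : ℕ∞) < κ ω then V (Z k 0 ω, displacement Z k ω) else 0)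
        = b * ∑ i, θ i * (if (k : ℕ∞) < κ ω then
          occupationReal t (φ i) (Z k 0 ω, displacement Z k ω) else 0) := by
      intro k
      split_ifs <;> simp [hV]
    simp only [h2]
    rw [tsum_mul_left, Summable.tsum_finsetSum fun i _ => (hω i).1.mul_left _, hVint, ← mul_sub,
      ← Finset.sum_sub_distrib, Finset.mul_sum]
    refine Finset.sum_congr rfl fun i _ => ?_
    rw [(hω i).2, tsum_mul_left]
    ring
  calc _ = ∫ ω, Complex.exp ((∑' i : ℕ, if (i : ℕ∞) < κ ω then
        V (Z i 0 ω, displacement Z i ω) else 0 : ℝ) * Complex.I)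
        * Complex.exp (-(∫ p, V p ∂m : ℝ) * Complex.I) ∂P := by
        refine integral_congr_ae ?_
        filter_upwards [hae] with ω hω
        rw [hω, ← Complex.exp_add]
        congr 1
        push_cast
        ring
    _ = Complex.exp (∫ p, (Complex.exp (V p * Complex.I) - 1) ∂m)
        * Complex.exp (-(∫ p, V p ∂m : ℝ) * Complex.I) := by
        rw [integral_mul_const]
        congr 1
    _ = _ := by
        rw [← Complex.exp_add]
        congr 1
        have hVI : Integrable (fun p => (V p : ℂ) * Complex.I) m := hVi.ofReal.mul_const _
        have he : Integrable (fun p => Complex.exp (V p * Complex.I) - 1) m := by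
          refine hVi.abs.mono' ?_ (ae_of_all _ fun p => norm_cexp_sub_one_le (V p))
          exact ((Complex.measurable_exp.comp
            ((Complex.measurable_ofReal.comp hVm).mul_const _)).sub_const _).aestronglyMeasurable
        rw [integral_sub he hVI, integral_mul_const, integral_complex_ofReal]
        ring

end Convergence

/-! ### The limit theorem -/

section Limit

variable {S : Type*} [AddCommGroup S] [TopologicalSpace S] [IsTopologicalAddGroup S]
    [LocallyCompactSpace S] [T2Space S] [SecondCountableTopology S]
    [MeasurableSpace S] [BorelSpace S]
    {Ω₀ : Type*} [MeasurableSpace Ω₀] {Ω : Type*} [MeasurableSpace Ω]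
    {ρ : Measure S} [ρ.IsAddHaarMeasure]
    {P₀ : Measure Ω₀} [IsProbabilityMeasure P₀] {W : ℝ≥0 → Ω₀ → S}
    {P : Measure Ω} [IsProbabilityMeasure P] {κ : Ω → ℕ∞} {Z : ℕ → ℝ≥0 → Ω → S}

lemma rpow_neg_half_sq {a : ℝ} (ha : 0 < a) : (a ^ (-(1 / 2) : ℝ)) ^ 2 = a⁻¹ := by
  rw [← Real.rpow_natCast, ← Real.rpow_mul ha.le]
  norm_num
  exact Real.rpow_neg_one a

/-- Convergence of the normalised fluctuations, given that the covariances of the occupation times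
are asymptotically `a Γ` and that the squares of the truncated potentials are `o(a)`. -/
theorem IsZeroLevelSystem.convergesToGaussianField (hW : IsParticleMotion ρ P₀ W)
    (hZ : IsZeroLevelSystem ρ P₀ W P κ Z) {a : ℝ → ℝ} (ha : ∀ᶠ t in atTop, 0 < a t)
    {Γ : TestFn S → TestFn S → ℝ}
    (hΓ : ∀ φ ψ, Tendsto (fun t => (a t)⁻¹ *
      ∫ p, occupationReal t φ p * occupationReal t ψ p ∂(ρ.prod (motionLaw P₀ W))) atTop
      (𝓝 (Γ φ ψ)))
    (hN : ∀ ψ : TestFn S, Tendsto (fun t => (supPotential P₀ W t ψ.toENNReal).toReal ^ 2 / a t)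
      atTop (𝓝 0)) :
    ConvergesToGaussianField P (fun t φ ω => (a t) ^ (-(1 / 2) : ℝ) *
      occupationFluctuation ρ (empiricalMeasure κ Z) t φ.1 ω) Γ := by
  set m := ρ.prod (motionLaw P₀ W) with hm
  have hsymm : ∀ φ ψ, Γ φ ψ = Γ ψ φ := by
    intro φ ψ
    refine tendsto_nhds_unique (hΓ φ ψ) ((hΓ ψ φ).congr fun t => ?_)
    simp only [mul_comm (occupationReal t ψ _)]
  have hquad : ∀ {ι : Type _} (s : Finset ι) (c : ι → ℝ) (φ : ι → TestFn S),
      Tendsto (fun t => (a t)⁻¹ * ∫ p, (∑ i ∈ s, c i * occupationReal t (φ i) p) ^ 2 ∂m) atTop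
        (𝓝 (∑ i ∈ s, ∑ j ∈ s, c i * c j * Γ (φ i) (φ j))) := by
    intro ι s c φ
    have h1 := tendsto_finsetSum s fun i _ => tendsto_finsetSum s fun j _ =>
      (hΓ (φ i) (φ j)).const_mul (c i * c j)
    refine h1.congr fun t => ?_
    rw [(hW.integrable_sum_sq s c φ t).2, Finset.mul_sum]
    refine Finset.sum_congr rfl fun i _ => ?_
    rw [Finset.mul_sum]
    exact Finset.sum_congr rfl fun j _ => by ring
  have hpos : ∀ c : TestFn S →₀ ℝ, 0 ≤ c.sum fun φ x => c.sum fun ψ y => x * y * Γ φ ψ := by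
    intro c
    refine ge_of_tendsto (hquad c.support c id) ?_
    filter_upwards [ha] with t ht
    exact mul_nonneg (inv_nonneg.2 ht.le) (integral_nonneg fun p => sq_nonneg _)
  obtain ⟨ν, hνp, hν, hν0, hνΓ⟩ := exists_gaussianField Γ hsymm hpos
  refine ⟨ν, hνp, hν, hν0, hνΓ, fun I => ?_⟩
  refine tendstoInDistribution_of_tendsto_integral_cexp P hν hν0 hνΓ I
    (fun t φ ω => (a t) ^ (-(1 / 2) : ℝ) *
      occupationFluctuation ρ (empiricalMeasure κ Z) t φ.1 ω)
    (fun t φ => (hZ.aemeasurable_occupationFluctuation φ t).const_mul _) fun θ => ?_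
  -- `V` is the functional in the exponent; its majorant `U` is the functional of one test function
  let φ : I → TestFn S := fun i => i
  let ψ : TestFn S := TestFn.absCombination θ φ
  let b : ℝ → ℝ := fun t => (a t) ^ (-(1 / 2) : ℝ)
  let V : ℝ → S × (ℝ≥0 → S) → ℝ := fun t p => b t * ∑ i, θ i * occupationReal t (φ i) p
  let U : ℝ → S × (ℝ≥0 → S) → ℝ := fun t p => |b t| * occupationReal t ψ p
  have hVi : ∀ t, Integrable (V t) m := fun t => (integrable_finsetSum _ fun i _ =>
    (hW.integrable_occupationReal t (φ i)).const_mul _).const_mul _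
  have hV2 : ∀ t p, V t p ^ 2 = b t ^ 2 * (∑ i, θ i * occupationReal t (φ i) p) ^ 2 :=
    fun t p => mul_pow _ _ _
  have hU3 : ∀ t p, U t p ^ 3 = |b t| ^ 3 * occupationReal t ψ p ^ 3 := fun t p => mul_pow _ _ _
  have hVU : ∀ t p, |V t p| ≤ U t p := by
    intro t p
    rw [abs_mul]
    refine mul_le_mul_of_nonneg_left ?_ (abs_nonneg _)
    rw [occupationReal_absCombination]
    refine (Finset.abs_sum_le_sum_abs _ _).trans_eq (Finset.sum_congr rfl fun i _ => ?_)
    rw [abs_mul, abs_of_nonneg (occupationReal_nonneg t (φ i) p)]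
  have hlim := tendsto_integral_cexp_sub_one_sub m V U (l := atTop)
    (σ := ∑ i, ∑ j, θ i * θ j * Γ (φ i) (φ j)) hVi
    (fun t => by
      simp only [hV2]
      exact (hW.integrable_sum_sq Finset.univ θ φ t).1.const_mul _)
    hVU
    (fun t => by
      simp only [hU3]
      exact (hW.integrable_occupationReal_cube t ψ).1.const_mul _)
    (by
      refine (hquad Finset.univ θ φ).congr' ?_
      filter_upwards [ha] with t ht
      simp only [hV2]
      rw [integral_const_mul, rpow_neg_half_sq ht])
    (by
      -- `∫ U³ ≤ 4 (N / √a) (a⁻¹ ∫ F_ψ²)`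
      have h1 := ((hN ψ).sqrt.mul (hΓ ψ ψ)).const_mul 4
      rw [Real.sqrt_zero, zero_mul, mul_zero] at h1
      refine squeeze_zero' (Eventually.of_forall fun t => integral_nonneg fun p =>
        pow_nonneg (mul_nonneg (abs_nonneg _) (occupationReal_nonneg t ψ p)) 3) ?_ h1
      filter_upwards [ha] with t ht
      have hb : 0 ≤ b t := Real.rpow_nonneg ht.le _
      have hb2 : b t ^ 2 = (a t)⁻¹ := rpow_neg_half_sq ht
      have hbs : b t = √((a t)⁻¹) := by rw [← hb2, Real.sqrt_sq hb]
      simp only [hU3]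
      rw [integral_const_mul, abs_of_nonneg hb]
      calc b t ^ 3 * ∫ p, occupationReal t ψ p ^ 3 ∂m
          ≤ b t ^ 3 * (4 * (supPotential P₀ W t ψ.toENNReal).toReal *
              ∫ p, occupationReal t ψ p * occupationReal t ψ p ∂m) := by
            gcongr
            exact (hW.integrable_occupationReal_cube t ψ).2
        _ = 4 * ((supPotential P₀ W t ψ.toENNReal).toReal * b t * (b t ^ 2 *
              ∫ p, occupationReal t ψ p * occupationReal t ψ p ∂m)) := by ring
        _ = _ := by
            rw [hb2, div_eq_mul_inv, Real.sqrt_mul (sq_nonneg _),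
              Real.sqrt_sq ENNReal.toReal_nonneg, ← hbs])
  have hexp := (Complex.continuous_exp.tendsto _).comp hlim
  refine (hexp.congr' ?_)
  filter_upwards [eventually_ge_atTop 0] with t ht
  exact (hZ.integral_cexp_occupationFluctuation hW θ φ (b t) ht).symm

/-- The covariances of the occupation times are asymptotic to the integrated growth function. -/
lemma IsParticleMotion.tendsto_inv_mul_integral_occupationReal_mul (hW : IsParticleMotion ρ P₀ W)
    {f : ℝ → ℝ} (hf : ∀ t, 0 ≤ t → IntervalIntegrable f volume 0 t)
    (hpos : ∀ᶠ t in atTop, 0 < f t)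
    (hlim : Tendsto (fun t => ∫ s in (0 : ℝ)..t, f s) atTop atTop) (φ ψ : TestFn S) {γ : ℝ}
    (h : Tendsto (fun t => (f t)⁻¹ *
      (∫⁻ u in Ioc 0 t, energy ρ P₀ W u.toNNReal φ.toENNReal ψ.toENNReal).toReal) atTop (𝓝 γ)) :
    Tendsto (fun t => (∫ s in (0 : ℝ)..t, f s)⁻¹ * ∫ r in (0 : ℝ)..t,
      (∫⁻ u in Ioc 0 r, energy ρ P₀ W u.toNNReal φ.toENNReal ψ.toENNReal).toReal) atTop (𝓝 γ) ∧
    Tendsto (fun t => (∫ s in (0 : ℝ)..t, f s)⁻¹ *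
      ∫ p, occupationReal t φ p * occupationReal t ψ p ∂(ρ.prod (motionLaw P₀ W))) atTop
      (𝓝 (2 * γ)) := by
  obtain ⟨B, hB, hle⟩ := φ.exists_energy_le hW ψ
  have hfin : ∀ r : ℝ, ∫⁻ u in Ioc 0 r, energy ρ P₀ W u.toNNReal φ.toENNReal ψ.toENNReal ≠ ∞ :=
    fun r => setLIntegral_Ioc_ne_top hB fun u _ => hle _
  have h1 := tendsto_intervalIntegral_div hf (fun t ht => intervalIntegrable_toReal
    measurable_setLIntegral_Ioc ht (setLIntegral_Ioc_ne_top (hfin t) fun r hr =>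
      lintegral_mono_set (Ioc_subset_Ioc_right hr.2))) hpos hlim h
  refine ⟨h1, (h1.const_mul 2).congr' ?_⟩
  filter_upwards [eventually_ge_atTop 0] with t ht
  rw [hW.integral_occupationReal_mul ht]
  ring

lemma IsGrowthFunction.intervalIntegrable {T : ℝ} {f : ℝ → ℝ} (hf : IsGrowthFunction T f) {t : ℝ}
    (ht : 0 ≤ t) : IntervalIntegrable f volume 0 t := by
  rcases le_total t T with htT | htT
  · exact hf.integrable.mono_set (by
      rw [uIcc_of_le ht, uIcc_of_le hf.pos.le]; exact Icc_subset_Icc_right htT)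
  · refine hf.integrable.trans (MonotoneOn.intervalIntegrable (hf.mono.mono ?_))
    rw [uIcc_of_le htT]
    exact Icc_subset_Ici_self

lemma IsGrowthFunction.tendsto_integral {T : ℝ} {f : ℝ → ℝ} (hf : IsGrowthFunction T f) :
    Tendsto (fun t => ∫ s in (0 : ℝ)..t, f s) atTop atTop := by
  obtain ⟨T₁, hT₁⟩ := eventually_atTop.1
    ((hf.tendsto.eventually_ge_atTop 1).and (eventually_ge_atTop 0))
  have h0 : 0 ≤ T₁ := (hT₁ T₁ le_rfl).2
  have hlin : Tendsto (fun t : ℝ => (∫ s in (0 : ℝ)..T₁, f s) + (t - T₁)) atTop atTop :=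
    tendsto_atTop_add_const_left _ _ (tendsto_atTop_add_const_right _ (-T₁) tendsto_id)
  refine tendsto_atTop_mono' _ ?_ hlin
  filter_upwards [eventually_ge_atTop T₁] with t ht
  have hi : IntervalIntegrable f volume T₁ t :=
    (hf.intervalIntegrable h0).symm.trans (hf.intervalIntegrable (h0.trans ht))
  rw [← intervalIntegral.integral_add_adjacent_intervals (hf.intervalIntegrable h0) hi]
  gcongr
  calc t - T₁ = ∫ _ in T₁..t, (1 : ℝ) := by simp
    _ ≤ ∫ s in T₁..t, f s :=
      intervalIntegral.integral_mono_on ht intervalIntegrable_const hi fun s hs => (hT₁ s hs.1).1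

end Limit

end

theorem theorem2p2p1
    {S Ω₀ Ω : Type*} [AddCommGroup S] [TopologicalSpace S] [IsTopologicalAddGroup S]
    [LocallyCompactSpace S] [T2Space S] [SecondCountableTopology S]
    [MeasurableSpace S] [BorelSpace S]
    (ρ : Measure S) [ρ.IsAddHaarMeasure]
    [MeasurableSpace Ω₀] (P₀ : Measure Ω₀) [IsProbabilityMeasure P₀]
    (W : ℝ≥0 → Ω₀ → S) (hW : IsParticleMotion ρ P₀ W)
    [MeasurableSpace Ω] (P : Measure Ω) [IsProbabilityMeasure P]
    (κ : Ω → ℕ∞) (Z : ℕ → ℝ≥0 → Ω → S) (hZ : IsZeroLevelSystem ρ P₀ W P κ Z) :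
    (IsTransientMotion P₀ W →
      ConvergesToGaussianField P
        (fun t φ ω => t ^ (-(1 / 2) : ℝ) *
          occupationFluctuation ρ (empiricalMeasure κ Z) t φ.1 ω)
        (fun φ ψ => 2 * ∫ x, φ.1 x * (green P₀ W ψ x).toReal ∂ρ)) ∧
    (NoncompactSpace S → IsRecurrentMotion P₀ W →
      ∀ (T : ℝ) (f : ℝ → ℝ) (H : LinearMap.BilinForm ℝ C_c(S, ℝ)),
        IsGrowthFunction T f → GreenGrowsLike ρ P₀ W f H →
        ConvergesToGaussianField P
          (fun t φ ω => (∫ s in (0 : ℝ)..t, f s) ^ (-(1 / 2) : ℝ) *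
            occupationFluctuation ρ (empiricalMeasure κ Z) t φ.1 ω)
          (fun φ ψ => 2 * H φ.1 ψ.1)) := by
  refine ⟨fun htr => ?_, fun hnc _ T f H hf hH => ?_⟩
  · refine hZ.convergesToGaussianField hW (a := fun t => t) (eventually_gt_atTop 0) (fun φ ψ => ?_)
      fun ψ => hW.tendsto_supPotential_sq_div_of_transient htr tendsto_id ψ
    -- the case of the constant growth function `1`
    have h1 := (hW.tendsto_inv_mul_integral_occupationReal_mul (f := fun _ => 1)
      (fun _ _ => intervalIntegrable_const) (by simp)
      (by
        simp only [intervalIntegral.integral_const, smul_eq_mul, mul_one, sub_zero]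
        exact tendsto_id) φ ψ
      (by simpa only [inv_one, one_mul] using hW.tendsto_energy_green htr φ ψ)).2
    simpa only [intervalIntegral.integral_const, smul_eq_mul, mul_one, sub_zero] using h1
  · have hρ : ρ univ = ∞ := measure_univ_of_isAddLeftInvariant ρ
    have h1 := fun φ ψ : TestFn S => hW.tendsto_inv_mul_integral_occupationReal_mul
      (fun t ht => hf.intervalIntegrable ht) (hf.tendsto.eventually_gt_atTop 0) hf.tendsto_integral
      φ ψ ((hH.tendsto φ ψ).congr' (by
        filter_upwards [eventually_ge_atTop 0] with t ht
        rw [hW.integral_mul_greenUpTo φ ψ ht]))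
    have hapos := hf.tendsto_integral.eventually_gt_atTop 0
    exact hZ.convergesToGaussianField hW hapos (fun φ ψ => (h1 φ ψ).2)
      fun ψ => hW.tendsto_supPotential_sq_div hρ hapos (fun χ => (h1 χ χ).1) ψ
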